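/- **Setting.** Let $u\in\mathbb C\setminus\{0\}$. Let $Z\subset\mathbb C$ be a domain and $f,g$ meromorphic in $Z$, where $f$ has exactly one zero $z_0$ in $Z$, and it is simple. Every pole $w\in Z$ of $f$ or $g$ is assumed to be *admissible*: either $f$ has a pole of order $m>2$ at $w$ and $g$ is analytic there or has a pole of order less than $\frac12m+1$; or $f$ and $g$ both have a double pole at $w$ and $(z-w)^2g(z)\to-\frac14$. If $Z$ is unbounded, the point $\infty$ is called *admissible* if for all large $z\in Z$ one has $f(z)=z^m\sum_{s\ge0}f_sz^{-s}$ and $g(z)=z^p\sum_{s\ge0}g_sz^{-s}$ with convergent series, $m,p\in\mathbb Z$, $f_0\ne0$, and either $m>-2$, $p<\frac12m-1$, or $m=p=-2$, $g_0=-\frac14$. Let $D\subset Z$ be a simply connected domain that contains $z_0$ and no poles ($Z$ with the poles removed and suitably cut), on which there is a single-valued analytic function $\zeta$ with $\xi:=\frac23\zeta^{3/2}=\int_{z_0}^zf^{1/2}(t)\,dt$, that is, $\zeta(z_0)=0$ and $\zeta\,(d\zeta/dz)^2=f$. Put $$\Phi=\frac{4ff''-5f'^2}{16f^3}+\frac gf,\qquad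 \psi=\tfrac5{16}\zeta^{-2}+\zeta\,\Phi,$$ where $\psi$ is given its limiting value at $z_0$, and consider the equation, in the variable $\zeta$ (with $d/d\zeta=(d\zeta/dz)^{-1}d/dz$ on functions of $z\in D$), $$\frac{d^2W}{d\zeta^2}=\{u^2\zeta+\psi\}W.\tag{1}$$ **Regions and branches.** For $j\in\{0,1,-1\}$ let $T_j=\{z\in D:|\arg(u^{2/3}\zeta e^{-2\pi ij/3})|\le\frac13\pi\}$, with $u^{2/3}$ having its principal value, and let $D_j$ be $D$ without $z_0$ and without the curve on which $u^{2/3}\zeta e^{-2\pi ij/3}$ is negative. For each $j$ the functions $\xi=\frac23\zeta^{3/2}$, $f^{1/2}=d\xi/dz$, $\zeta^{-1/4}$ denote branches analytic in $D_j$. For $j=0$ the branch of $\xi$ is such that $\mathrm{Re}(u\xi)>0$ in the interior of $T_0$ and $\mathrm{Re}(u\xi)<0$ in the interior of $T_1$ and $T_{-1}$; for $j=\pm1$ it is such that $\mathrm{Re}(u\xi)<0$ in the interior of $T_j$ and $\mathrm{Re}(u\xi)>0$ in the interior of $T_0$ and $T_{-j}$ (in each case away from the curve removed). The branch of $\zeta^{-1/4}$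 is $u^{1/6}e^{-\pi ij/6}(u^{2/3}\zeta e^{-2\pi ij/3})^{-1/4}$ with principal powers. **Coefficients.** With the branch belonging to $j$, let $\hat F_1=\frac12\Phi$ and $\hat F_{s+1}=-\frac12f^{-1/2}\hat F_s'-\frac12\sum_{k=1}^{s-1}\hat F_k\hat F_{s-k}$ $(s\ge1)$. Let $\hat E_{2s+1}=\int\hat F_{2s+1}f^{1/2}\,dz$, with the constant of integration such that $(z-z_0)^{1/2}\hat E_{2s+1}$ is meromorphic at $z_0$, and let $\hat E_{2s}$ be given by the formal identity $$\sum_{s\ge1}\frac{\hat E_{2s}(z)}{u^{2s}}=-\frac12\ln\Big\{1+\sum_{s\ge0}\frac{\hat F_{2s+1}(z)}{u^{2s+2}}\Big\}+\sum_{s\ge1}\frac{\alpha_{2s}}{u^{2s}}$$ with arbitrary constants $\alpha_{2s}$. **Reference points and paths.** For each $j$ let $z^{(j)}$ be $\infty$, if admissible, or a pole in $Z$, such that $z^{(j)}$ is the limit of a given arc in $T_j$. A curve is said to lead to $z^{(j)}$ if it converges to $z^{(j)}$ and, for every neighbourhood $N$ of $z^{(j)}$, its end and that of the given arc lie in the same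 path component of $N\cap T_j$. Let $Z_j$ be the set of all $z$ that can be linked with $z^{(j)}$ by a *progressive path*: a path $\hat{\mathcal L}_j$ in $D_j$ that leads to $z^{(j)}$, is a finite chain of $R_2$ arcs (twice continuously differentiable with nonvanishing derivative; no regularity at the end $z^{(j)}$ itself is required), and along which $\mathrm{Re}((-1)^ju\xi(v))$ is nonincreasing as $v$ passes from $z^{(j)}$ to $z$. **Theorem.** For $j\in\{0,1,-1\}$ and $s\ge1$ the limit $\hat E_s(z^{(j)})$ of $\hat E_s$ along curves leading to $z^{(j)}$ exists and does not depend on the curve. There are three solutions $W_0,W_1,W_{-1}$ of (1), analytic in $D$ (including $z_0$) and independent of $n$, such that for every integer $n\ge1$ and $z\in Z_j$ $$W_0=\frac1{\zeta^{1/4}}\exp\Big\{-u\xi+\sum_{s=1}^{n-1}(-1)^s\frac{\hat E_s(z)-\hat E_s(z^{(0)})}{u^s}\Big\}\{1+\eta_{n,0}(u,z)\}\quad(j=0),$$ $$W_{\pm1}=\frac1{\zeta^{1/4}}\exp\Big\{u\xi+\sum_{s=1}^{n-1}\frac{\hat E_s(z)-\hat E_s(z^{(\pm1)})}{u^s}\Big\}\{1+\eta_{n,\pm1}(u,z)\}\quad(j=\pm1),$$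 where, for every progressive path $\hat{\mathcal L}_j$ from $z^{(j)}$ to $z$ along which the integrals below converge, $$|\eta_{n,j}(u,z)|\le|u|^{-n}\omega_{n,j}(u,z)\exp\{|u|^{-1}\varpi_{n,j}(u,z)+|u|^{-n}\omega_{n,j}(u,z)\},$$ $$\omega_{n,j}=2\int_{z^{(j)}}^z|\hat F_nf^{1/2}\,dt|+\sum_{s=1}^{n-1}\frac1{|u|^s}\int_{z^{(j)}}^z\Big|\sum_{k=s}^{n-1}\hat F_k\hat F_{s+n-k-1}f^{1/2}\,dt\Big|,\qquad \varpi_{n,j}=4\sum_{s=0}^{n-2}\frac1{|u|^s}\int_{z^{(j)}}^z|\hat F_{s+1}f^{1/2}\,dt|,$$ the integrals being taken along $\hat{\mathcal L}_j$. The integrals do converge whenever the path is an $R_2$ arc up to and including its end $z^{(j)}$ (in the coordinate $1/v$ if $z^{(j)}=\infty$). -/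

import Mathlib

open Complex Filter Topology Set
open scoped ENNReal

noncomputable section

namespace LiouvilleGreen

/-- A pole of one of the coefficient functions `f`, `g` of `w'' = (u² f + g) w`. -/
def IsPole (f g : ℂ → ℂ) (w : ℂ) : Prop :=
  meromorphicOrderAt f w < 0 ∨ meromorphicOrderAt g w < 0

/-- Admissible (finite) poles: either `f` has a pole of order `m > 2` while `g` is analytic or has a
pole of order `p < m/2 + 1`, or `f`, `g` both have double poles and `(z - w)² g(z) → -1/4`. -/
def AdmissiblePole (f g : ℂ → ℂ) (w : ℂ) : Prop :=
  (∃ m : ℤ, 2 < m ∧ meromorphicOrderAt f w = ((-m : ℤ) : WithTop ℤ) ∧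
    MeromorphicAt g w ∧
    ∀ p : ℤ, meromorphicOrderAt g w = ((-p : ℤ) : WithTop ℤ) → 2 * p < m + 2) ∨
  (meromorphicOrderAt f w = ((-2 : ℤ) : WithTop ℤ) ∧
    meromorphicOrderAt g w = ((-2 : ℤ) : WithTop ℤ) ∧
    Tendsto (fun z => (z - w) ^ 2 * g z) (𝓝[≠] w) (𝓝 (-1 / 4)))

/-- Admissibility of the point at infinity of the unbounded domain `Z`: there
`f(z) = z^m ∑ f_s z^{-s}` and `g(z) = z^p ∑ g_s z^{-s}` with convergent series (the functions `A`
and `B` of `1/z`), `f_0 ≠ 0`, and either `m > -2`, `p < m/2 - 1`, or `m = p = -2`, `g_0 = -1/4`. -/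
def AdmissibleAtInfinity (f g : ℂ → ℂ) (Z : Set ℂ) : Prop :=
  ∃ (m p : ℤ) (A B : ℂ → ℂ), AnalyticAt ℂ A 0 ∧ AnalyticAt ℂ B 0 ∧ A 0 ≠ 0 ∧
    (∀ᶠ z in Bornology.cobounded ℂ ⊓ 𝓟 Z, f z = z ^ m * A z⁻¹ ∧ g z = z ^ p * B z⁻¹) ∧
    ((-2 < m ∧ 2 * p < m - 2) ∨ (m = -2 ∧ p = -2 ∧ B 0 = -1 / 4))

/-- The equation `w'' = (u² f + g) w` with one simple turning point `z₀`, together with its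
Liouville variable `ζ`.

`Z` is the domain in which `f`, `g` are meromorphic with admissible poles only and in which `z₀` is
the only zero of `f`.  `D` is the domain, free of poles and simply connected, on which the
multivalued functions of the theory are considered (`Z` with its poles removed and suitably cut; one
may take `D = Z` if `Z` is simply connected and has no poles).  On `D` the variable `ζ` is a single
valued analytic function with `(2/3) ζ^{3/2} = ∫_{z₀}^z f^{1/2}`, that is, `ζ(z₀) = 0` and
`ζ (dζ/dz)² = f`. -/
structure TurningPointProblem where
  f : ℂ → ℂ
  g : ℂ → ℂ
  u : ℂ
  u_ne_zero : u ≠ 0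
  Z : Set ℂ
  isOpen_Z : IsOpen Z
  isConnected_Z : IsConnected Z
  meromorphic_f : MeromorphicOn f Z
  meromorphic_g : MeromorphicOn g Z
  analytic_off_poles : ∀ z ∈ Z, ¬ IsPole f g z → AnalyticAt ℂ f z ∧ AnalyticAt ℂ g z
  admissible_poles : ∀ w ∈ Z, IsPole f g w → AdmissiblePole f g w
  z₀ : ℂ
  zero_f : f z₀ = 0
  simple_zero_f : deriv f z₀ ≠ 0
  only_zero_f : ∀ z ∈ Z, ¬ IsPole f g z → f z = 0 → z = z₀
  D : Set ℂ
  isOpen_D : IsOpen D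
  isSimplyConnected_D : IsSimplyConnected D
  D_subset : D ⊆ {z ∈ Z | ¬ IsPole f g z}
  z₀_mem : z₀ ∈ D
  ζ : ℂ → ℂ
  analytic_ζ : AnalyticOnNhd ℂ ζ D
  ζ_z₀ : ζ z₀ = 0
  ζ_eq : ∀ z ∈ D, ζ z * deriv ζ z ^ 2 = f z

namespace TurningPointProblem

variable (P : TurningPointProblem)

/-- The function `Φ = (4 f f'' - 5 f'²) / (16 f³) + g / f`. -/
def Phi (z : ℂ) : ℂ :=
  (4 * P.f z * deriv (deriv P.f) z - 5 * deriv P.f z ^ 2) / (16 * P.f z ^ 3) + P.g z / P.f z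

/-- The function `ψ = (5/16) ζ⁻² + ζ Φ`, as a function of `z`, extended to the turning point by its
limit there. -/
def psi : ℂ → ℂ :=
  Function.update (fun z => 5 / 16 * (P.ζ z ^ 2)⁻¹ + P.ζ z * P.Phi z) P.z₀
    (limUnder (𝓝[≠] P.z₀) fun z => 5 / 16 * (P.ζ z ^ 2)⁻¹ + P.ζ z * P.Phi z)

/-- The derivation `d/dζ = (dζ/dz)⁻¹ d/dz` acting on functions expressed through `z`. -/
def dzeta (W : ℂ → ℂ) (z : ℂ) : ℂ := deriv W z / deriv P.ζ z

/-- `W`, expressed through `z`, is an analytic solution on `D` (turning point included) of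
`d²W/dζ² = (u² ζ + ψ) W`. -/
def IsSolution (W : ℂ → ℂ) : Prop :=
  AnalyticOnNhd ℂ W P.D ∧
    ∀ z ∈ P.D, P.dzeta (P.dzeta W) z = (P.u ^ 2 * P.ζ z + P.psi z) * W z

/-! The index `j ∈ {0, 1, -1}` is an element of `SignType`. -/

/-- `u^{2/3} ζ e^{-2πij/3}` -/
def rot (j : SignType) (z : ℂ) : ℂ :=
  P.u ^ (2 / 3 : ℂ) * P.ζ z * exp (-(2 * Real.pi * I * (j : ℂ) / 3))

/-- The region `T_j` of the `z` plane: `|arg (u^{2/3} ζ e^{-2πij/3})| ≤ π/3`. -/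
def T (j : SignType) : Set ℂ := {z ∈ P.D | |arg (P.rot j z)| ≤ Real.pi / 3}

/-- The part of `D` on which the branch of `ξ` belonging to `W_j` is analytic: `z₀` and the curve
`arg (u^{2/3} ζ e^{-2πij/3}) = π`, opposite to `T_j`, are removed. -/
def slit (j : SignType) : Set ℂ := {z ∈ P.D | P.rot j z ∈ slitPlane}

/-- The sign of `u ξ` in the exponent of `W_j`: `-1` for `j = 0` and `+1` for `j = ±1`. -/
def sgn (j : SignType) : ℂ := if j = 0 then -1 else 1

/-- The branch of `ξ = (2/3) ζ^{3/2}` belonging to `W_j`: for `j = 0`, `Re (u ξ)` is positive inside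
`T_0` and negative inside `T_1`, `T_{-1}`; for `j = ±1`, it is negative inside `T_j` and positive
inside the other two. -/
def xi (j : SignType) (z : ℂ) : ℂ :=
  -sgn j * (2 / 3 * P.rot j z ^ (3 / 2 : ℂ)) / P.u

/-- The branch of `f^{1/2} = dξ/dz` belonging to `W_j`. -/
def fsqrt (j : SignType) : ℂ → ℂ := deriv (P.xi j)

/-- The branch of `ζ^{-1/4}` belonging to `W_j`, analytic on `slit j`. -/
def zetaInvQuarter (j : SignType) (z : ℂ) : ℂ :=
  P.u ^ (1 / 6 : ℂ) * exp (-(Real.pi * I * (j : ℂ) / 6)) * P.rot j z ^ (-1 / 4 : ℂ)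

/-- The coefficients `F̂_s` (for `s ≥ 1`; the value at `s = 0` is not used):
`F̂_1 = Φ/2` and `F̂_{s+1} = -(1/2) f^{-1/2} F̂_s' - (1/2) ∑_{k=1}^{s-1} F̂_k F̂_{s-k}`. -/
def F (j : SignType) : ℕ → ℂ → ℂ
  | 0 => 0
  | 1 => fun z => 1 / 2 * P.Phi z
  | s + 2 => fun z => -(1 / 2) * (P.fsqrt j z)⁻¹ * deriv (F j (s + 1)) z
      - 1 / 2 * ∑ i : Fin s, F j (i + 1) z * F j (s - i) z

/-- The coefficient of `u^{-2k}` in the formal series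
`-(1/2) ln (1 + ∑_{s ≥ 0} F̂_{2s+1}(z) u^{-2s-2})` (the variable `X` stands for `u^{-2}`). -/
def evenCoeff (j : SignType) (k : ℕ) (z : ℂ) : ℂ :=
  PowerSeries.coeff k (PowerSeries.C (-1 / 2 : ℂ) *
    PowerSeries.logOf (1 + PowerSeries.X * PowerSeries.mk fun s => P.F j (2 * s + 1) z))

/-- `E` is an admissible choice of the functions `Ê_s` in the branch belonging to `W_j`.
The odd ones are integrals `∫ F̂_{2k+1} f^{1/2} dz` with the constant such that
`(z - z₀)^{1/2} Ê_{2k+1}` (equivalently `f^{1/2} Ê_{2k+1}`, the zero of `f` being simple)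
is meromorphic at `z₀`; the even ones are given by the formal logarithm, up to arbitrary additive
constants `α_{2k}`. -/
structure IsEhat (j : SignType) (E : ℕ → ℂ → ℂ) : Prop where
  odd_deriv : ∀ k : ℕ, ∀ z ∈ P.slit j,
    HasDerivAt (E (2 * k + 1)) (P.F j (2 * k + 1) z * P.fsqrt j z) z
  odd_meromorphic : ∀ k : ℕ, ∃ M : ℂ → ℂ, MeromorphicAt M P.z₀ ∧
    ∀ᶠ z in 𝓝 P.z₀, z ∈ P.slit j → P.fsqrt j z * E (2 * k + 1) z = M z
  even_eq : ∀ k : ℕ, 1 ≤ k → ∃ α : ℂ, ∀ z ∈ P.slit j, E (2 * k) z = P.evenCoeff j k z + α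

/-- The neighbourhood filter on `ℂ` of a point of the Riemann sphere. -/
def sphereNhds (p : OnePoint ℂ) : Filter ℂ := comap ((↑) : ℂ → OnePoint ℂ) (𝓝 p)

/-- The reference point `z^{(j)} ∈ T_j`: the point at infinity or a pole in `Z`, in either case
admissible, reached along an arc in `T_j`.  The arc only serves to specify which part of `T_j` near
`z^{(j)}` is meant, should there be several. -/
structure RefPoint (j : SignType) where
  pt : OnePoint ℂ
  admissible : (pt = OnePoint.infty ∧ AdmissibleAtInfinity P.f P.g P.Z) ∨
    ∃ w ∈ P.Z, pt = (w : OnePoint ℂ) ∧ IsPole P.f P.g w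
  arc : ℝ → ℂ
  continuous_arc : ContinuousOn arc (Ioc 0 1)
  arc_mem : ∀ t ∈ Ioc (0 : ℝ) 1, arc t ∈ P.T j
  arc_tendsto : Tendsto arc (𝓝[>] 0) (sphereNhds pt)

variable {P} {j : SignType} (r : P.RefPoint j)

/-- `c t → z^{(j)}` as `t → 0+` within `T_j`, in the part of `T_j` near `z^{(j)}` specified by the
reference arc: in every neighbourhood of `z^{(j)}`, the ends of `c` and of the reference arc can be
joined within `T_j`. -/
def RefPoint.Reaches (c : ℝ → ℂ) : Prop :=
  Tendsto c (𝓝[>] 0) (sphereNhds r.pt) ∧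
    ∀ N ∈ sphereNhds r.pt, ∀ᶠ q : ℝ × ℝ in 𝓝[>] 0 ×ˢ 𝓝[>] 0,
      JoinedIn (N ∩ P.T j) (c q.1) (r.arc q.2)

/-- `c : (0, 1] → ℂ` is a progressive path `L̂_j` from `z^{(j)}` (at `t = 0+`) to `z` (at `t = 1`):
a finite chain of `R₂` arcs (twice continuously differentiable, nonvanishing derivative)
in the domain of the branch of `ξ`, along which `Re ((-1)^j u ξ)` is nonincreasing. -/
structure RefPoint.IsProgressivePath (c : ℝ → ℂ) (z : ℂ) : Prop where
  reaches : r.Reaches c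
  endpoint : c 1 = z
  mem : ∀ t ∈ Ioc (0 : ℝ) 1, c t ∈ P.slit j
  chain : ∃ (N : ℕ) (τ : ℕ → ℝ), τ 0 = 0 ∧ τ N = 1 ∧ ∀ i < N, τ i < τ (i + 1) ∧
    ContDiffOn ℝ 2 c (Icc (τ i) (τ (i + 1)) ∩ Ioi 0) ∧
    ∀ t ∈ Icc (τ i) (τ (i + 1)) ∩ Ioi 0,
      derivWithin c (Icc (τ i) (τ (i + 1)) ∩ Ioi 0) t ≠ 0
  progressive : AntitoneOn (fun t => (-sgn j * (P.u * P.xi j (c t))).re) (Ioc 0 1)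

/-- The first arc of the path `c` is an `R₂` arc up to and including its initial point `z^{(j)}`, in
the local coordinate `v - w` at a finite point `w`, respectively `1/v` at infinity. -/
def RefPoint.RegularAtStart (c : ℝ → ℂ) : Prop :=
  ∃ (δ : ℝ) (b : ℝ → ℂ), 0 < δ ∧ ContDiffOn ℝ 2 b (Icc 0 δ) ∧ b 0 = 0 ∧
    derivWithin b (Icc 0 δ) 0 ≠ 0 ∧
    ((r.pt = OnePoint.infty ∧ ∀ t ∈ Ioc 0 δ, b t = (c t)⁻¹) ∨
      ∃ w : ℂ, r.pt = (w : OnePoint ℂ) ∧ ∀ t ∈ Ioc 0 δ, b t = c t - w)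

/-- The region of validity `Z_j(u, z^{(j)})`. -/
def RefPoint.region : Set ℂ := {z | ∃ c, r.IsProgressivePath c z}

/-- `∫ |h(t) dt|` along the path `c`, a value in `[0, ∞]`. -/
def pathInt (h : ℂ → ℂ) (c : ℝ → ℂ) : ℝ≥0∞ :=
  ∫⁻ t in Ioc (0 : ℝ) 1, ‖h (c t) * deriv c t‖ₑ

variable (P) (j)

/-- `ω_{n,j}` along the path `c`. -/
def omega (n : ℕ) (c : ℝ → ℂ) : ℝ≥0∞ :=
  2 * pathInt (fun t => P.F j n t * P.fsqrt j t) c +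
    ∑ s ∈ Finset.Icc 1 (n - 1), (‖P.u‖ₑ ^ s)⁻¹ *
      pathInt (fun t => (∑ k ∈ Finset.Icc s (n - 1), P.F j k t * P.F j (s + n - k - 1) t)
        * P.fsqrt j t) c

/-- `ϖ_{n,j}` along the path `c`. -/
def varpi (n : ℕ) (c : ℝ → ℂ) : ℝ≥0∞ :=
  4 * ∑ s ∈ Finset.range (n - 1), (‖P.u‖ₑ ^ s)⁻¹ *
    pathInt (fun t => P.F j (s + 1) t * P.fsqrt j t) c

/-- The leading factor of `W_j`: `ζ^{-1/4} exp {-u ξ + ∑_{s<n} (-1)^s (Ê_s(z) - e_s) / u^s}` for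
`j = 0`, and `ζ^{-1/4} exp {u ξ + ∑_{s<n} (Ê_s(z) - e_s) / u^s}` for `j = ±1`, where `e_s` stands
for `Ê_s(z^{(j)})`. -/
def lgApprox (E : ℕ → ℂ → ℂ) (e : ℕ → ℂ) (n : ℕ) (z : ℂ) : ℂ :=
  P.zetaInvQuarter j z * exp (sgn j * P.u * P.xi j z +
    ∑ s ∈ Finset.Icc 1 (n - 1), sgn j ^ s * (E s z - e s) / P.u ^ s)

end TurningPointProblem

end LiouvilleGreen

end

/-! For the branch belonging to j let x = -sgn j · u ξ (`expo`). Then Re x does not increase along a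
progressive path, and W_j should behave like ζ^{-1/4} e^{-x}. With a = ζ^{1/4} e^x W, Liouville's
transformation turns (1) into a'' = 2a' + (Φ/u²) a, where primes mean d/dx. Let S be the truncated
sum in the exponent and λ = S'. The relative error η = a e^{-S} - 1 then satisfies η'' = (2 - 2λ) η'
- R (1 + η) with R = λ' + λ² - 2λ - Φ/u². The recursion for the F̂_s cancels all of R except the
terms that are counted in ω (`riccati_residual`). For this, every Ê_s has to be a primitive of F̂_s
f^{1/2}. For even s that is the formal identity (ln(1 + odd part))' = -2 · (even part).

The only growth in the equation for η' is e^{2x}, and |e^{2x}| does not increase along the path.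
Variation of constants and Gronwall's inequality (`error_bound`) therefore give the stated bound, as
soon as η and η' tend to 0 at z^{(j)}. What remains is the behaviour at the end of the path: Ê_s
must have a limit, F̂_s must tend to 0, and one W, independent of n, must satisfy a → 1, a' → 0
(`RefPoint.exists_solution`).

Admissibility says that in the local coordinate t = z - w or t = 1/z one has f = t^{2κ-μ} a(t) and Φ
= t^l h(t) with 2l > μ (`LocalForm`). All F̂_s are then of the form t^l (A + rB) with A, B analytic
in t and r² = t^μ/a (`LocalForm.Regular`). This class is preserved by the recursion and yields the
limits and the convergence of the integrals.

To construct W, put s = log t. The system for (a, a') is holomorphic in a left half plane, with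
exponent X(s). Take the solutions with value (1, 0) at points p_n that recede to infinity. If p_n
can be joined to s by a path on which Re X descends and ∫|φ dX| is small, the same Gronwall estimate
holds uniformly in n, and a subsequence converges to a solution close to (1, 0)
(`exists_recessive`). For μ = 0 one has X = βs + O(1), and straight segments serve. For μ > 0, X is
close to e^w with w affine in s, so that the half plane consists of alternating hills and valleys of
Re X. A progressive path has Re X ≥ 0 near its end and climbs towards it, hence stays on one hill.
Every other path leading to z^{(j)} can be joined to it inside T_j and ends on the same hill. The
values at one point of the first path determine a solution on all of the simply connected D. -/

noncomputable section

/-! ### Holomorphic linear equations on simply connected domains -/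

noncomputable section LinearODE

variable {E : Type*} [NormedAddCommGroup E] [NormedSpace ℂ E]

/-- `V` solves the linear equation `V' = A V` on `U`. -/
def SolvesOn (A : ℂ → E →L[ℂ] E) (V : ℂ → E) (U : Set ℂ) : Prop :=
  ∀ z ∈ U, HasDerivAt V (A z (V z)) z

namespace SolvesOn

variable {A : ℂ → E →L[ℂ] E} {V V₁ V₂ : ℂ → E} {U U' : Set ℂ}

theorem mono (h : SolvesOn A V U) (hU : U' ⊆ U) : SolvesOn A V U' := fun z hz => h z (hU hz)

theorem differentiableOn (h : SolvesOn A V U) : DifferentiableOn ℂ V U :=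
  fun z hz => (h z hz).differentiableAt.differentiableWithinAt

theorem sub (h₁ : SolvesOn A V₁ U) (h₂ : SolvesOn A V₂ U) :
    SolvesOn A (fun z => V₁ z - V₂ z) U := fun z hz => by
  rw [map_sub]; exact (h₁ z hz).sub (h₂ z hz)

theorem add (h₁ : SolvesOn A V₁ U) (h₂ : SolvesOn A V₂ U) :
    SolvesOn A (fun z => V₁ z + V₂ z) U := fun z hz => by
  rw [map_add]; exact (h₁ z hz).add (h₂ z hz)

theorem const_smul (h₁ : SolvesOn A V₁ U) (c : ℂ) :
    SolvesOn A (fun z => c • V₁ z) U := fun z hz => by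
  rw [map_smul]; exact (h₁ z hz).const_smul c

/-- A solution that vanishes at a point vanishes near that point. -/
theorem eventually_eq_zero (hU : IsOpen U) (hA : ContinuousOn A U) (h : SolvesOn A V U)
    {p : ℂ} (hp : p ∈ U) (h0 : V p = 0) : ∀ᶠ z in 𝓝 p, V z = 0 := by
  have hAc : ContinuousAt A p := hA.continuousAt (hU.mem_nhds hp)
  set M := ‖A p‖ + 1 with hM
  have hM0 : 0 < M := by positivity
  have hev : ∀ᶠ z in 𝓝 p, ‖A z‖ < M ∧ z ∈ U :=
    (hAc.norm.eventually (gt_mem_nhds (by simp [hM]))).and (hU.mem_nhds hp)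
  obtain ⟨ε, hε, hball⟩ := Metric.eventually_nhds_iff_ball.1 hev
  set r := min (ε / 2) (1 / (2 * M)) with hr
  have hr0 : 0 < r := by positivity
  have hsub : Metric.closedBall p r ⊆ Metric.ball p ε :=
    Metric.closedBall_subset_ball (by
      have : r ≤ ε / 2 := min_le_left _ _
      linarith)
  have hMr : M * r ≤ 1 / 2 := by
    have : r ≤ 1 / (2 * M) := min_le_right _ _
    calc M * r ≤ M * (1 / (2 * M)) := by gcongr
      _ = 1 / 2 := by field_simp
  have hVc : ContinuousOn V (Metric.closedBall p r) := fun z hz =>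
    (h z (hball z (hsub hz)).2).continuousAt.continuousWithinAt
  obtain ⟨z₁, hz₁, hmax⟩ := (isCompact_closedBall p r).exists_isMaxOn
    ⟨p, Metric.mem_closedBall_self hr0.le⟩ hVc.norm
  -- Since `V p = 0` and `M * r ≤ 1 / 2`, the mean value inequality bounds `V` by half of its own
  -- maximum, which is therefore 0.
  have key : ∀ z ∈ Metric.closedBall p r, ‖V z‖ ≤ ‖V z₁‖ / 2 := by
    intro z hz
    have := (convex_closedBall p r).norm_image_sub_le_of_norm_hasDerivWithin_le
      (f := V) (f' := fun z => A z (V z)) (C := M * ‖V z₁‖)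
      (fun y hy => (h y (hball y (hsub hy)).2).hasDerivWithinAt)
      (fun y hy => (A y).le_opNorm_of_le (hmax hy) |>.trans (by
        gcongr; exact (hball y (hsub hy)).1.le))
      (Metric.mem_closedBall_self hr0.le) hz
    rw [h0, sub_zero] at this
    have hz' : ‖z - p‖ ≤ r := by simpa [dist_eq_norm] using hz
    calc ‖V z‖ ≤ M * ‖V z₁‖ * ‖z - p‖ := this
      _ ≤ M * ‖V z₁‖ * r := by gcongr
      _ = (M * r) * ‖V z₁‖ := by ring
      _ ≤ 1 / 2 * ‖V z₁‖ := by gcongr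
      _ = _ := by ring
  have hz1 : ‖V z₁‖ ≤ 0 := by linarith [key z₁ hz₁]
  filter_upwards [Metric.closedBall_mem_nhds p hr0] with z hz
  have := key z hz
  rw [← norm_le_zero_iff]
  linarith

theorem eqOn [CompleteSpace E] (hU : IsOpen U) (hUc : IsPreconnected U) (hA : ContinuousOn A U)
    (h₁ : SolvesOn A V₁ U) (h₂ : SolvesOn A V₂ U) {p : ℂ} (hp : p ∈ U) (h0 : V₁ p = V₂ p) :
    EqOn V₁ V₂ U := by
  refine (h₁.differentiableOn.analyticOnNhd hU).eqOn_of_preconnected_of_eventuallyEq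
    (h₂.differentiableOn.analyticOnNhd hU) hUc hp ?_
  filter_upwards [(h₁.sub h₂).eventually_eq_zero hU hA hp (by simp [h0])] with z hz
  exact sub_eq_zero.1 hz

/-- Picard iteration on a ball on which the coefficient is small compared with the radius. -/
theorem exists_ball [CompleteSpace E] {c : ℂ} {r M : ℝ} (hA : DifferentiableOn ℂ A (Metric.ball c r))
    (hM : ∀ z ∈ Metric.ball c r, ‖A z‖ ≤ M) (hMr : M * (2 * r) ≤ 1 / 2)
    {p : ℂ} (hp : p ∈ Metric.ball c r) (v : E) :
    ∃ V, SolvesOn A V (Metric.ball c r) ∧ V p = v := by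
  set B := Metric.ball c r with hB
  have hM0 : 0 ≤ M := (norm_nonneg _).trans (hM p hp)
  have step : ∀ V : ℂ → E, DifferentiableOn ℂ V B → ∃ W : ℂ → E, W p = 0 ∧
      ∀ z ∈ B, HasDerivAt W (A z (V z)) z := fun V hV =>
    (Complex.IsExactOn.with_val_at
      (DifferentiableOn.isExactOn_ball (f := fun z => A z (V z)) (hA.clm_apply hV)) p 0)
  let T : {V : ℂ → E // DifferentiableOn ℂ V B} → {V : ℂ → E // DifferentiableOn ℂ V B} :=
    fun V => ⟨(step V.1 V.2).choose, fun z hz =>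
      ((step V.1 V.2).choose_spec.2 z hz).differentiableAt.differentiableWithinAt⟩
  -- The `S n` are the increments of the Picard iteration, not its iterates: each is the primitive
  -- of `A` applied to the preceding one that vanishes at `p`. Their bounds halve at every step and
  -- their sum is the solution.
  let S : ℕ → {V : ℂ → E // DifferentiableOn ℂ V B} := fun n =>
    T^[n] ⟨fun _ => v, differentiableOn_const v⟩
  have hS : ∀ n, (S (n + 1)).1 p = 0 ∧ ∀ z ∈ B, HasDerivAt (S (n + 1)).1 (A z ((S n).1 z)) z := by
    intro n
    have : S (n + 1) = T (S n) := Function.iterate_succ_apply' _ _ _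
    rw [this]
    exact (step (S n).1 (S n).2).choose_spec
  have hb : ∀ n, ∀ z ∈ B, ‖(S n).1 z‖ ≤ (1 / 2) ^ n * ‖v‖ := by
    intro n
    induction n with
    | zero => intro z _; simp [S]
    | succ n ih =>
      intro z hz
      have := (convex_ball c r).norm_image_sub_le_of_norm_hasDerivWithin_le
        (f := (S (n + 1)).1) (f' := fun z => A z ((S n).1 z)) (C := M * ((1 / 2) ^ n * ‖v‖))
        (fun y hy => ((hS n).2 y hy).hasDerivWithinAt)
        (fun y hy => (A y).le_opNorm_of_le (ih y hy) |>.trans (by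
          gcongr; exact hM y hy)) hp hz
      rw [(hS n).1, sub_zero] at this
      have hz' : ‖z - p‖ ≤ 2 * r := by
        rw [← dist_eq_norm]
        have h1 := Metric.mem_ball.1 hz
        have h2 := Metric.mem_ball'.1 hp
        linarith [dist_triangle z c p]
      calc ‖(S (n + 1)).1 z‖ ≤ M * ((1 / 2) ^ n * ‖v‖) * ‖z - p‖ := this
        _ ≤ M * ((1 / 2) ^ n * ‖v‖) * (2 * r) := by gcongr
        _ = (M * (2 * r)) * ((1 / 2) ^ n * ‖v‖) := by ring
        _ ≤ 1 / 2 * ((1 / 2) ^ n * ‖v‖) := by gcongr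
        _ = _ := by ring
  have hu : Summable fun n : ℕ => (1 / 2 : ℝ) ^ n * ‖v‖ :=
    (summable_geometric_of_lt_one (by norm_num) (by norm_num)).mul_right _
  have hsum : ∀ z ∈ B, Summable fun n => (S n).1 z := fun z hz =>
    Summable.of_norm_bounded hu fun n => hb n z hz
  refine ⟨fun z => ∑' n, (S n).1 z, fun z hz => ?_, ?_⟩
  · have hd := differentiableOn_tsum_of_summable_norm hu (fun n => (S n).2) Metric.isOpen_ball hb
    have hs := hasSum_deriv_of_summable_norm hu (fun n => (S n).2) Metric.isOpen_ball hb hz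
    have hd' := (hd.differentiableAt (Metric.isOpen_ball.mem_nhds hz)).hasDerivAt
    convert hd' using 1
    rw [← hs.tsum_eq, hs.summable.tsum_eq_zero_add, (A z).map_tsum (hsum z hz)]
    have h0 : deriv (S 0).1 z = 0 := by simp [S]
    rw [h0, zero_add]
    exact tsum_congr fun n => ((hS n).2 z hz).deriv.symm
  · show ∑' n, (S n).1 p = v
    rw [(hsum p hp).tsum_eq_zero_add]
    simp only [(hS _).1, tsum_zero, add_zero]
    rfl

end SolvesOn

/-- The type `E` with the discrete topology. -/
structure Discr (E : Type*) where
  val : E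

instance (E : Type*) : TopologicalSpace (Discr E) := ⊥

instance (E : Type*) : DiscreteTopology (Discr E) := ⟨rfl⟩

/-- Balls on which the equation `V' = A V` can be solved by Picard iteration. -/
theorem exists_picard_radius {A : ℂ → E →L[ℂ] E} {U : Set ℂ} (hU : IsOpen U)
    (hA : ContinuousOn A U) (c : U) :
    ∃ r M : ℝ, 0 < r ∧ Metric.ball (c : ℂ) r ⊆ U ∧ (∀ z ∈ Metric.ball (c : ℂ) r, ‖A z‖ ≤ M) ∧
      M * (2 * r) ≤ 1 / 2 := by
  have hAc : ContinuousAt A c := hA.continuousAt (hU.mem_nhds c.2)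
  have hM0 : 0 < ‖A c‖ + 1 := by positivity
  have hev : ∀ᶠ z in 𝓝 (c : ℂ), ‖A z‖ < ‖A c‖ + 1 ∧ z ∈ U :=
    (hAc.norm.eventually (gt_mem_nhds (by simp))).and (hU.mem_nhds c.2)
  obtain ⟨ε, hε, hball⟩ := Metric.eventually_nhds_iff_ball.1 hev
  have hsub : Metric.ball (c : ℂ) (min ε (1 / (4 * (‖A c‖ + 1)))) ⊆ Metric.ball (c : ℂ) ε :=
    Metric.ball_subset_ball (min_le_left _ _)
  refine ⟨min ε (1 / (4 * (‖A c‖ + 1))), ‖A c‖ + 1, by positivity,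
    fun z hz => (hball z (hsub hz)).2, fun z hz => (hball z (hsub hz)).1.le, ?_⟩
  have : min ε (1 / (4 * (‖A c‖ + 1))) ≤ 1 / (4 * (‖A c‖ + 1)) := min_le_right _ _
  calc (‖A c‖ + 1) * (2 * min ε (1 / (4 * (‖A c‖ + 1))))
      ≤ (‖A c‖ + 1) * (2 * (1 / (4 * (‖A c‖ + 1)))) := by gcongr
    _ = 1 / 2 := by field_simp; norm_num

/-- The linear equation `V' = A V` with holomorphic coefficient has a global solution with
prescribed value on a simply connected domain. -/
theorem SolvesOn.exists_of_isSimplyConnected [CompleteSpace E] {A : ℂ → E →L[ℂ] E} {U : Set ℂ}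
    (hU : IsOpen U) (hUs : IsSimplyConnected U) (hA : DifferentiableOn ℂ A U)
    {p : ℂ} (hp : p ∈ U) (v : E) : ∃ V, SolvesOn A V U ∧ V p = v := by
  choose r M hr hrU hM hMr using exists_picard_radius hU hA.continuousOn
  have hex : ∀ (i x : U), (x : ℂ) ∈ Metric.ball (i : ℂ) (r i) → ∀ v : E,
      ∃ V, SolvesOn A V (Metric.ball (i : ℂ) (r i)) ∧ V x = v := fun i x hx v =>
    SolvesOn.exists_ball (hA.mono (hrU i)) (hM i) (hMr i) hx v
  choose! sol hsol hval using hex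
  have huniq : ∀ (i x : U), (x : ℂ) ∈ Metric.ball (i : ℂ) (r i) → ∀ V,
      SolvesOn A V (Metric.ball (i : ℂ) (r i)) → EqOn V (sol i x (V x))
        (Metric.ball (i : ℂ) (r i)) := fun i x hx V hV =>
    hV.eqOn Metric.isOpen_ball (convex_ball _ _).isPreconnected
      (hA.continuousOn.mono (hrU i)) (hsol i x hx _) hx (hval i x hx _).symm
  have hself : ∀ i : U, (i : ℂ) ∈ Metric.ball (i : ℂ) (r i) := fun i => Metric.mem_ball_self (hr i)
  -- Germs of solutions form a bundle with discrete fibre. In chart `i` a germ is recorded by the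
  -- value at the centre of ball `i` of the solution through it. The change from `i` to `j` follows
  -- that solution from the centre of `i` to `x`, and then inside ball `j` to its centre. With
  -- `indexAt := id` the fibre over `x` is the set of values at `x` itself.
  let Z : FiberBundleCore U U (Discr E) :=
    { baseSet := fun i => {x | (x : ℂ) ∈ Metric.ball (i : ℂ) (r i)}
      isOpen_baseSet := fun i => Metric.isOpen_ball.preimage continuous_subtype_val
      indexAt := id
      mem_baseSet_at := hself
      coordChange := fun i j x v => ⟨sol j x (sol i i v.val x) j⟩
      coordChange_self := by
        rintro i x hx ⟨v⟩
        show Discr.mk (sol i x (sol i i v x) i) = ⟨v⟩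
        rw [← huniq i x hx _ (hsol i i (hself i) v) (hself i), hval i i (hself i)]
      continuousOn_coordChange := by
        rintro i j ⟨x₀, v₀⟩ ⟨⟨hxi, hxj⟩, -⟩
        apply ContinuousAt.continuousWithinAt
        have hev : ∀ᶠ q : U × Discr E in 𝓝 (x₀, v₀),
            (⟨sol j q.1 (sol i i q.2.val q.1) j⟩ : Discr E) =
              ⟨sol j x₀ (sol i i v₀.val x₀) j⟩ := by
          have h1 : ∀ᶠ q : U × Discr E in 𝓝 (x₀, v₀), q.2 = v₀ :=
            (continuous_snd (X := U) (Y := Discr E)).continuousAt.eventually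
              (p := fun y => y = v₀) (by simp [nhds_discrete])
          have h2 : ∀ᶠ q : U × Discr E in 𝓝 (x₀, v₀),
              (q.1 : ℂ) ∈ Metric.ball (i : ℂ) (r i) ∩ Metric.ball (j : ℂ) (r j) :=
            (continuous_subtype_val.comp continuous_fst).continuousAt.eventually
              ((Metric.isOpen_ball.inter Metric.isOpen_ball).mem_nhds ⟨hxi, hxj⟩)
          filter_upwards [h1, h2] with q hq1 hq2
          rw [hq1, Discr.mk.injEq]
          have e : EqOn (sol i i v₀.val) (sol j x₀ (sol i i v₀.val x₀))
              (Metric.ball (i : ℂ) (r i) ∩ Metric.ball (j : ℂ) (r j)) :=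
            ((hsol i i (hself i) v₀.val).mono inter_subset_left).eqOn
              (Metric.isOpen_ball.inter Metric.isOpen_ball)
              ((convex_ball _ _).inter (convex_ball _ _)).isPreconnected
              (hA.continuousOn.mono (inter_subset_left.trans (hrU i)))
              ((hsol j x₀ hxj _).mono inter_subset_right) ⟨hxi, hxj⟩ (hval j x₀ hxj _).symm
          rw [e hq2]
          exact (huniq j q.1 hq2.2 _ (hsol j x₀ hxj _) (hself j)).symm
        exact (continuousAt_const (y := (⟨sol j x₀ (sol i i v₀.val x₀) j⟩ : Discr E))).congr
          (hev.mono fun q hq => hq.symm)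
      coordChange_comp := by
        rintro i j k x ⟨⟨hi, hj⟩, hk⟩ ⟨v⟩
        show Discr.mk (sol k x (sol j j (sol j x (sol i i v x) j) x) k) = ⟨sol k x (sol i i v x) k⟩
        rw [← huniq j j (hself j) _ (hsol j x hj _) hj, hval j x hj] }
  have hcov : IsCoveringMap (Bundle.TotalSpace.proj : Bundle.TotalSpace (Discr E) Z.Fiber → U) :=
    FiberBundle.isCoveringMap (F := Discr E) (E := Z.Fiber)
  have := hUs.simplyConnectedSpace
  have := hU.locallyPathConnectedSpace
  -- Analytic continuation without monodromy: a lift of the identity of `U` to the covering is a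
  -- coherent choice of germs, with the germ at `p` prescribed.
  obtain ⟨F, ⟨hF0, hF⟩, -⟩ := hcov.existsUnique_continuousMap_lifts (ContinuousMap.id U) ⟨p, hp⟩
    (⟨⟨p, hp⟩, Discr.mk v⟩ : Bundle.TotalSpace (Discr E) Z.Fiber) rfl
  have hFp : ∀ x, (F x).1 = x := fun x => congrFun hF x
  let w : ∀ x : U, E := fun x => (show Discr E from (F x).2).val
  -- The fibre being discrete, the section is locally constant in the chart at `x₀`. This says that
  -- its values near `x₀` lie on a single solution.
  have hloc : ∀ x₀ : U, ∀ᶠ x : U in 𝓝 x₀, w x = sol x₀ x₀ (w x₀) x := by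
    intro x₀
    have hmem : F x₀ ∈ (Z.localTriv x₀).source := by
      rw [Z.mem_localTriv_source, ← Z.baseSet_at]
      show ((F x₀).1 : ℂ) ∈ Metric.ball (x₀ : ℂ) (r x₀)
      rw [hFp]; exact hself x₀
    have hc : ContinuousAt (fun x => ((Z.localTriv x₀) (F x)).2) x₀ :=
      continuous_snd.continuousAt.comp
        (((Z.localTriv x₀).toOpenPartialHomeomorph.continuousAt hmem).comp F.continuous.continuousAt)
    have h1 := hc.eventually
      (show ∀ᶠ y in 𝓝 ((Z.localTriv x₀) (F x₀)).2, y = ((Z.localTriv x₀) (F x₀)).2 from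
        by simp [nhds_discrete])
    have h2 : ∀ᶠ x : U in 𝓝 x₀, (x : ℂ) ∈ Metric.ball (x₀ : ℂ) (r x₀) :=
      continuous_subtype_val.continuousAt.eventually (Metric.isOpen_ball.mem_nhds (hself x₀))
    filter_upwards [h1, h2] with x hx1 hx2
    have e1 : ((Z.localTriv x₀) (F x)).2.val = sol x₀ x (sol x x (w x) x) x₀ := by
      rw [Z.localTriv_apply]
      show sol x₀ (F x).1 (sol (F x).1 (F x).1 (w x) (F x).1) x₀ = _
      rw [hFp]
    have e2 : ((Z.localTriv x₀) (F x₀)).2.val = w x₀ := by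
      rw [Z.localTriv_apply]
      show sol x₀ (F x₀).1 (sol (F x₀).1 (F x₀).1 (w x₀) (F x₀).1) x₀ = _
      rw [hFp, hval _ _ (hself x₀), hval _ _ (hself x₀)]
    have e3 : sol x₀ x (sol x x (w x) x) x₀ = w x₀ := by
      rw [← e1, ← e2, hx1]
    rw [hval _ _ (hself x)] at e3
    rw [← e3, ← huniq x₀ x₀ (hself x₀) _ (hsol x₀ x hx2 _) hx2, hval _ _ hx2]
  classical
  let V : ℂ → E := fun z => if hz : z ∈ U then w ⟨z, hz⟩ else 0
  have hV : ∀ x : U, V x = w x := fun x => by simp [V]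
  refine ⟨V, fun z hz => ?_, ?_⟩
  · have h3 : ∀ᶠ y in 𝓝 z, V y = sol ⟨z, hz⟩ ⟨z, hz⟩ (w ⟨z, hz⟩) y := by
      have := hloc ⟨z, hz⟩
      rw [nhds_subtype_eq_comap, eventually_comap] at this
      filter_upwards [this, hU.mem_nhds hz] with y hy hyU
      rw [hV ⟨y, hyU⟩]
      exact hy ⟨y, hyU⟩ rfl
    have := (hsol ⟨z, hz⟩ ⟨z, hz⟩ (hself _) (w ⟨z, hz⟩) z (hself ⟨z, hz⟩)).congr_of_eventuallyEq h3
    rwa [← h3.self_of_nhds] at this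
  · have : w ⟨p, hp⟩ = v := by
      show (show Discr E from (F ⟨p, hp⟩).2).val = v
      rw [hF0]
    rw [← this]; exact hV ⟨p, hp⟩

end LinearODE

end

/-! ### Gronwall estimate along a path of descent -/

noncomputable section

section Gronwall

open MeasureTheory intervalIntegral

theorem IntervalIntegrable.norm_sub_le_integral_norm {E : Type*} [NormedAddCommGroup E] [NormedSpace ℝ E]
    [CompleteSpace E] {α β : ℝ} (hαβ : α ≤ β) {S : Set ℝ} (hS : S.Countable) {f f' : ℝ → E}
    (hf : ContinuousOn f (Icc α β)) (hf' : IntervalIntegrable f' volume α β)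
    (hd : ∀ t ∈ Ioo α β \ S, HasDerivAt f (f' t) t) :
    ‖f β - f α‖ ≤ ∫ t in α..β, ‖f' t‖ := by
  rw [← integral_eq_of_hasDerivAt_off_countable_of_le f f' hαβ hS hf hd hf']
  exact norm_integral_le_integral_norm hαβ

theorem IntervalIntegrable.hasDerivAt_primitive {f : ℝ → ℝ} {α β t : ℝ} (hf : IntervalIntegrable f volume α β)
    (ht : t ∈ Ioo α β) (hc : ContinuousAt f t) :
    HasDerivAt (fun s => ∫ r in α..s, f r) (f t) t := by
  have hαβ : α ≤ β := (ht.1.trans ht.2).le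
  refine integral_hasDerivAt_right (hf.mono_set ?_) ?_ hc
  · rw [uIcc_of_le ht.1.le, uIcc_of_le hαβ]
    exact Icc_subset_Icc_right ht.2.le
  · exact ⟨Ioc α β, Ioc_mem_nhds ht.1 ht.2, hf.1.aestronglyMeasurable⟩

theorem IntervalIntegrable.continuousOn_primitive_Icc {f : ℝ → ℝ} {α β : ℝ} (hαβ : α ≤ β)
    (hf : IntervalIntegrable f volume α β) :
    ContinuousOn (fun s => ∫ r in α..s, f r) (Icc α β) := by
  have := continuousOn_primitive_interval' hf (left_mem_uIcc (a := α) (b := β))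
  rwa [uIcc_of_le hαβ] at this

/-- Growth of solutions of the error equation along a path on which `Re x` is nonincreasing. -/
theorem error_bound {α β : ℝ} (hαβ : α ≤ β) {S : Set ℝ} (hS : S.Countable)
    {x x' η b h R : ℝ → ℂ} (hx : ContinuousOn x (Icc α β)) (hη : ContinuousOn η (Icc α β))
    (hb : ContinuousOn b (Icc α β)) (hh : ContinuousOn h (Icc α β)) (hR : ContinuousOn R (Icc α β))
    (hx'c : ∀ t ∈ Ioo α β \ S, ContinuousAt x' t) (hx'i : IntervalIntegrable x' volume α β)
    (dx : ∀ t ∈ Ioo α β \ S, HasDerivAt x (x' t) t)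
    (dη : ∀ t ∈ Ioo α β \ S, HasDerivAt η (x' t * b t) t)
    (db : ∀ t ∈ Ioo α β \ S, HasDerivAt b (x' t * ((2 - 2 * h t) * b t - R t * (1 + η t))) t)
    (mono : AntitoneOn (fun t => (x t).re) (Icc α β)) :
    ‖η β‖ ≤ (‖η α‖ + ‖b α‖ + ∫ t in α..β, ‖R t * x' t‖) *
        Real.exp (∫ t in α..β, (2 * ‖h t‖ + ‖R t‖) * ‖x' t‖) ∧
    ‖b β‖ ≤ (‖η α‖ + ‖b α‖ + ∫ t in α..β, ‖R t * x' t‖) *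
        Real.exp (∫ t in α..β, (2 * ‖h t‖ + ‖R t‖) * ‖x' t‖) := by
  have hu : uIcc α β = Icc α β := uIcc_of_le hαβ
  -- The equation reads `b' = x' (2 b + g)`. The term `2 b` is absorbed by an exponential, and all
  -- the rest is treated as forcing.
  set g : ℝ → ℂ := fun t => -2 * h t * b t - R t * (1 + η t) with hg
  have hgc : ContinuousOn g (Icc α β) := by fun_prop
  have hgi : IntervalIntegrable (fun t => x' t * g t) volume α β :=
    hx'i.mul_continuousOn (by rwa [hu])
  have hgn : IntervalIntegrable (fun t => ‖x' t * g t‖) volume α β := hgi.norm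
  have hsub : ∀ {F : Type} [NormedAddCommGroup F] {f : ℝ → F} {t}, t ∈ Icc α β →
      IntervalIntegrable f volume α β → IntervalIntegrable f volume α t := fun ht hf =>
    hf.mono_set (by rw [uIcc_of_le ht.1, hu]; exact Icc_subset_Icc_right ht.2)
  set ε := ‖η α‖ + ‖b α‖ with hε
  set N : ℝ → ℝ := fun t => ε + ∫ s in α..t, ‖x' s * g s‖ with hN
  -- Variation of constants: the factor `exp (2 (x t - x s))` removes `2 b`, and it has modulus at
  -- most 1 because `Re x` does not increase.
  have bb : ∀ t ∈ Icc α β, ‖b t‖ ≤ ‖b α‖ + ∫ s in α..t, ‖x' s * g s‖ := by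
    intro t ht
    have hE : ContinuousOn (fun s => exp (2 * (x t - x s))) (Icc α t) := by
      have := hx.mono (Icc_subset_Icc_right ht.2)
      fun_prop
    have hle := IntervalIntegrable.norm_sub_le_integral_norm ht.1 hS
      (f := fun s => exp (2 * (x t - x s)) * b s)
      (f' := fun s => exp (2 * (x t - x s)) * (x' s * g s))
      (hE.mul (hb.mono (Icc_subset_Icc_right ht.2)))
      ((hsub ht hgi).continuousOn_mul (by rwa [uIcc_of_le ht.1]))
      (fun s hs => by
        have hs' : s ∈ Ioo α β \ S := ⟨⟨hs.1.1, hs.1.2.trans_le ht.2⟩, hs.2⟩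
        have h1 := (((dx s hs').const_sub (x t)).const_mul 2).cexp
        refine (h1.fun_mul (db s hs')).congr_deriv ?_
        simp only [hg]; ring)
    have h1 : ∀ s ∈ Icc α t, ‖exp (2 * (x t - x s))‖ ≤ 1 := by
      intro s hs
      rw [norm_exp, Real.exp_le_one_iff]
      have : (x t).re ≤ (x s).re := mono ⟨hs.1, hs.2.trans ht.2⟩ ht hs.2
      simp; linarith
    have h2 : ∫ s in α..t, ‖exp (2 * (x t - x s)) * (x' s * g s)‖ ≤ ∫ s in α..t, ‖x' s * g s‖ := by
      refine integral_mono_on ht.1 ?_ (hsub ht hgn) fun s hs => ?_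
      · exact ((hsub ht hgi).continuousOn_mul (by rwa [uIcc_of_le ht.1])).norm
      · rw [norm_mul]
        exact mul_le_of_le_one_left (norm_nonneg _) (h1 s hs)
    have h3 : ‖exp (2 * (x t - x α)) * b α‖ ≤ ‖b α‖ := by
      rw [norm_mul]
      exact mul_le_of_le_one_left (norm_nonneg _) (h1 α (left_mem_Icc.2 ht.1))
    have h4 := norm_sub_norm_le (exp (2 * (x t - x t)) * b t) (exp (2 * (x t - x α)) * b α)
    simp only [sub_self, mul_zero, exp_zero, one_mul] at h4 hle
    linarith
  -- In `η - b / 2` the term `2 b` cancels and only `-x' g / 2` is left. Half of the bound for `b`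
  -- added to this one gives the same majorant `N` for `η` as for `b`, so that no constant is lost.
  have pb : ∀ t ∈ Icc α β, ‖η t - b t / 2‖ ≤ ‖η α‖ + ‖b α‖ / 2 +
      (∫ s in α..t, ‖x' s * g s‖) / 2 := by
    intro t ht
    have hle := IntervalIntegrable.norm_sub_le_integral_norm ht.1 hS
      (f := fun s => η s - b s / 2)
      (f' := fun s => (-1 / 2 : ℂ) * (x' s * g s))
      ((hη.sub (hb.div_const 2)).mono (Icc_subset_Icc_right ht.2))
      ((hsub ht hgi).const_mul _)
      (fun s hs => by
        have hs' : s ∈ Ioo α β \ S := ⟨⟨hs.1.1, hs.1.2.trans_le ht.2⟩, hs.2⟩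
        refine ((dη s hs').fun_sub ((db s hs').div_const 2)).congr_deriv ?_
        simp only [hg]; ring)
    have h2 : ∫ s in α..t, ‖(-1 / 2 : ℂ) * (x' s * g s)‖ = (∫ s in α..t, ‖x' s * g s‖) / 2 := by
      simp only [norm_mul (-1 / 2 : ℂ)]
      rw [intervalIntegral.integral_const_mul]
      norm_num
      ring
    have h4 := norm_sub_norm_le (η t - b t / 2) (η α - b α / 2)
    have h5 : ‖η α - b α / 2‖ ≤ ‖η α‖ + ‖b α‖ / 2 := by
      refine (norm_sub_le _ _).trans ?_
      simp
    linarith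
  have hbN : ∀ t ∈ Icc α β, ‖b t‖ ≤ N t := fun t ht => by
    have := bb t ht; simp only [hN, hε]; linarith [norm_nonneg (η α)]
  have hηN : ∀ t ∈ Icc α β, ‖η t‖ ≤ N t := fun t ht => by
    have h1 := bb t ht
    have h2 := pb t ht
    have h3 : ‖η t‖ ≤ ‖η t - b t / 2‖ + ‖b t‖ / 2 := by
      calc ‖η t‖ = ‖(η t - b t / 2) + b t / 2‖ := by ring_nf
        _ ≤ _ := (norm_add_le _ _).trans (by simp)
    simp only [hN, hε]; linarith
  set k : ℝ → ℝ := fun t => (2 * ‖h t‖ + ‖R t‖) * ‖x' t‖ with hk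
  have hki : IntervalIntegrable k volume α β :=
    hx'i.norm.continuousOn_mul (by rw [hu]; fun_prop)
  have hRi : IntervalIntegrable (fun t => ‖R t * x' t‖) volume α β :=
    (hx'i.continuousOn_mul (by rwa [hu])).norm
  set K : ℝ → ℝ := fun t => ∫ s in α..t, k s with hK
  have hk0 : ∀ t, 0 ≤ k t := fun t => by positivity
  have hK0 : ∀ t ∈ Icc α β, 0 ≤ K t := fun t ht => integral_nonneg ht.1 fun s _ => hk0 s
  have hNc : ContinuousOn N (Icc α β) := continuousOn_const.add
    (IntervalIntegrable.continuousOn_primitive_Icc hαβ hgn)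
  have hKc : ContinuousOn K (Icc α β) := IntervalIntegrable.continuousOn_primitive_Icc hαβ hki
  have cAt : ∀ {F : Type} [TopologicalSpace F] {f : ℝ → F} {t}, ContinuousOn f (Icc α β) →
      t ∈ Ioo α β → ContinuousAt f t := fun hf ht => hf.continuousAt (Icc_mem_nhds ht.1 ht.2)
  have hNd : ∀ t ∈ Ioo α β \ S, HasDerivAt N (‖x' t * g t‖) t := fun t ht =>
    (IntervalIntegrable.hasDerivAt_primitive hgn ht.1
      ((hx'c t ht).mul (cAt hgc ht.1)).norm).const_add _
  have hKd : ∀ t ∈ Ioo α β \ S, HasDerivAt K (k t) t := fun t ht =>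
    IntervalIntegrable.hasDerivAt_primitive hki ht.1
      ((((cAt hh ht.1).norm.const_mul 2).add (cAt hR ht.1).norm).mul (hx'c t ht).norm)
  have hZi : IntervalIntegrable
      (fun t => ‖x' t * g t‖ * Real.exp (-K t) + N t * (Real.exp (-K t) * -k t)) volume α β := by
    refine (hgn.mul_continuousOn ?_).add ((hki.neg.continuousOn_mul ?_).continuousOn_mul ?_)
    all_goals rw [hu]
    · fun_prop
    · fun_prop
    · exact hNc
  -- Gronwall by the integrating factor `exp (-K)`: below, `N' ≤ k N + ‖R x'‖`, so the derivative of
  -- `N exp (-K)` is at most `‖R x'‖`.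
  have hZ := integral_eq_of_hasDerivAt_off_countable_of_le (fun t => N t * Real.exp (-K t))
    (fun t => ‖x' t * g t‖ * Real.exp (-K t) + N t * (Real.exp (-K t) * -k t)) hαβ hS
    (hNc.mul (by fun_prop)) (fun t ht => (hNd t ht).mul ((hKd t ht).neg.exp)) hZi
  have hle : ∫ t in α..β, (‖x' t * g t‖ * Real.exp (-K t) + N t * (Real.exp (-K t) * -k t)) ≤
      ∫ t in α..β, ‖R t * x' t‖ := by
    refine integral_mono_on hαβ hZi hRi fun t ht => ?_
    have h1 : ‖x' t * g t‖ ≤ k t * N t + ‖R t * x' t‖ := by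
      have : ‖g t‖ ≤ 2 * ‖h t‖ * ‖b t‖ + ‖R t‖ * (1 + ‖η t‖) := by
        refine (norm_sub_le _ _).trans ?_
        rw [norm_mul, norm_mul, norm_mul]
        gcongr
        · simp
        · exact (norm_add_le _ _).trans (by simp)
      rw [norm_mul, norm_mul]
      calc ‖x' t‖ * ‖g t‖ ≤ ‖x' t‖ * (2 * ‖h t‖ * N t + ‖R t‖ * (1 + N t)) := by
            gcongr
            refine this.trans ?_
            gcongr
            · exact hbN t ht
            · exact hηN t ht
        _ = _ := by simp only [hk]; ring
    have h2 : Real.exp (-K t) ≤ 1 := Real.exp_le_one_iff.2 (by linarith [hK0 t ht])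
    calc ‖x' t * g t‖ * Real.exp (-K t) + N t * (Real.exp (-K t) * -k t)
        = (‖x' t * g t‖ - k t * N t) * Real.exp (-K t) := by ring
      _ ≤ ‖R t * x' t‖ * Real.exp (-K t) := by gcongr; linarith
      _ ≤ ‖R t * x' t‖ := mul_le_of_le_one_right (norm_nonneg _) h2
  have hfin : N β ≤ (ε + ∫ t in α..β, ‖R t * x' t‖) * Real.exp (K β) := by
    have hα : N α * Real.exp (-K α) = ε := by simp [hN, hK]
    have : N β * Real.exp (-K β) ≤ ε + ∫ t in α..β, ‖R t * x' t‖ := by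
      linarith
    calc N β = N β * Real.exp (-K β) * Real.exp (K β) := by
          rw [mul_assoc, ← Real.exp_add]; simp
      _ ≤ _ := by gcongr
  exact ⟨(hηN β (right_mem_Icc.2 hαβ)).trans hfin, (hbN β (right_mem_Icc.2 hαβ)).trans hfin⟩

end Gronwall

end

/-! ### Algebra of the Riccati recursion and of the formal logarithm -/

noncomputable section

/-- The residual of the truncated Liouville-Green series in the Riccati equation. -/
theorem riccati_residual (F DF : ℕ → ℂ)
    (hDF : ∀ s, DF (s + 1) = -2 * F (s + 2) - ∑ i ∈ Finset.range s, F (i + 1) * F (s - i))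
    (v : ℂ) {n : ℕ} (hn : 1 ≤ n) :
    ∑ s ∈ Finset.Icc 1 (n - 1), v ^ (s + 2) * DF s +
        (∑ s ∈ Finset.Icc 1 (n - 1), v ^ (s + 1) * F s) ^ 2 +
        2 * ∑ s ∈ Finset.Icc 1 (n - 1), v ^ (s + 1) * F s - 2 * v ^ 2 * F 1 =
      -2 * v ^ (n + 1) * F n + ∑ s ∈ Finset.Icc 1 (n - 1), v ^ (s + n + 1) *
        ∑ k ∈ Finset.Icc s (n - 1), F k * F (s + n - k - 1) := by
  obtain ⟨m, rfl⟩ : ∃ m, n = m + 1 := ⟨n - 1, by omega⟩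
  simp only [Nat.add_sub_cancel]
  have hDF' : ∀ s ∈ Finset.Icc 1 m, v ^ (s + 2) * DF s = -2 * (v ^ (s + 2) * F (s + 1)) -
      ∑ k ∈ Finset.Icc 1 (s - 1), v ^ (s + 2) * (F k * F (s - k)) := by
    intro s hs
    obtain ⟨r, rfl⟩ : ∃ r, s = r + 1 := ⟨s - 1, by have := (Finset.mem_Icc.1 hs).1; omega⟩
    rw [hDF, ← Finset.mul_sum, Nat.add_sub_cancel]
    have : ∑ i ∈ Finset.range r, F (i + 1) * F (r - i) =
        ∑ k ∈ Finset.Icc 1 r, F k * F (r + 1 - k) := by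
      refine Finset.sum_nbij' (fun i => i + 1) (fun k => k - 1) ?_ ?_ ?_ ?_ ?_
      · intro i hi; simp at hi ⊢; omega
      · intro i hi; simp at hi ⊢; omega
      · intro i hi; simp
      · intro i hi; simp at hi ⊢; omega
      · intro i hi; simp
    rw [this]; ring
  -- The square is a sum over pairs (k, l). Pairs with k + l ≤ m, grouped by s = k + l, will cancel
  -- against the convolutions in the recursion. The others, grouped by s = k + l - m, form the
  -- quadratic part of the residual.
  have hsq : (∑ s ∈ Finset.Icc 1 m, v ^ (s + 1) * F s) ^ 2 =
      ∑ s ∈ Finset.Icc 1 m, ∑ k ∈ Finset.Icc 1 (s - 1), v ^ (s + 2) * (F k * F (s - k)) +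
      ∑ s ∈ Finset.Icc 1 m, v ^ (s + (m + 1) + 1) *
        ∑ k ∈ Finset.Icc s m, F k * F (s + (m + 1) - k - 1) := by
    have e1 : (∑ s ∈ Finset.Icc 1 m, v ^ (s + 1) * F s) ^ 2 =
        ∑ k ∈ Finset.Icc 1 m, ∑ l ∈ Finset.Icc 1 m, v ^ (k + l + 2) * (F k * F l) := by
      rw [sq, Finset.sum_mul_sum]
      refine Finset.sum_congr rfl fun k _ => Finset.sum_congr rfl fun l _ => by ring
    simp only [Finset.mul_sum]
    rw [e1, Finset.sum_sigma', Finset.sum_sigma', Finset.sum_sigma',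
      ← Finset.sum_filter_add_sum_filter_not _ (fun p : (_ : ℕ) × ℕ => p.1 + p.2 ≤ m)]
    congr 1
    · refine Finset.sum_nbij' (fun p => ⟨p.1 + p.2, p.1⟩) (fun p => ⟨p.2, p.1 - p.2⟩) ?_ ?_ ?_ ?_ ?_
      · rintro ⟨k, l⟩ h; simp at h ⊢; omega
      · rintro ⟨k, l⟩ h; simp at h ⊢; omega
      · rintro ⟨k, l⟩ h; simp
      · rintro ⟨k, l⟩ h; simp at h ⊢; omega
      · rintro ⟨k, l⟩ h; simp
    · refine Finset.sum_nbij' (fun p => ⟨p.1 + p.2 - m, p.1⟩) (fun p => ⟨p.2, p.1 + m - p.2⟩) ?_ ?_ ?_ ?_ ?_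
      · rintro ⟨k, l⟩ h; simp at h ⊢; omega
      · rintro ⟨k, l⟩ h; simp at h ⊢; omega
      · rintro ⟨k, l⟩ h; simp at h ⊢; omega
      · rintro ⟨k, l⟩ h; simp at h ⊢; omega
      · rintro ⟨k, l⟩ h; simp at h ⊢
        rw [show k + l - m + (m + 1) + 1 = k + l + 2 by omega,
          show k + l - m + (m + 1) - k - 1 = l by omega]
  -- The linear terms of the recursion are those of the Riccati equation shifted by one index. Only
  -- the two ends survive: `F 1`, which is the potential, and `F n`, the linear part of the
  -- residual.
  have htel : ∑ s ∈ Finset.Icc 1 m, v ^ (s + 2) * F (s + 1) + v ^ 2 * F 1 =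
      ∑ s ∈ Finset.Icc 1 m, v ^ (s + 1) * F s + v ^ (m + 2) * F (m + 1) := by
    clear hDF' hsq hn
    induction m with
    | zero => simp
    | succ m ih =>
      rw [Finset.sum_Icc_succ_top (by omega), Finset.sum_Icc_succ_top (by omega)]
      linear_combination ih
  rw [Finset.sum_congr rfl hDF', Finset.sum_sub_distrib, ← Finset.mul_sum, hsq]
  linear_combination (-2) * htel

namespace PowerSeries

theorem coeff_pow_eq_zero_of_lt {R : Type*} [CommRing R] {Y : PowerSeries R}
    (hY : constantCoeff Y = 0) {k d : ℕ} (h : k < d) : coeff k (Y ^ d) = 0 := by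
  obtain ⟨Z, rfl⟩ := X_dvd_iff.2 hY
  rw [mul_pow, coeff_X_pow_mul', if_neg (by omega)]

theorem coeff_logOf_one_add {Y : PowerSeries ℂ} (hY : constantCoeff Y = 0) (k : ℕ) :
    coeff k (logOf (1 + Y)) = ∑ d ∈ Finset.range k, (-1 : ℂ) ^ d / (d + 1) * coeff k (Y ^ (d + 1)) := by
  rw [logOf_eq, add_sub_cancel_left, coeff_subst' (HasSubst.of_constantCoeff_zero' hY)]
  rw [finsum_eq_sum_of_support_subset (s := Finset.range (k + 1))]
  · rw [Finset.sum_range_succ']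
    simp only [coeff_log, if_true, smul_eq_mul, zero_mul, add_zero]
    refine Finset.sum_congr rfl fun d _ => ?_
    rw [if_neg (by omega)]
    simp [pow_succ]
  · intro d hd
    by_contra hlt
    apply hd
    simp only [Finset.coe_range, mem_Iio, not_lt] at hlt
    simp only
    rw [coeff_pow_eq_zero_of_lt hY (by omega), smul_zero]

/-- Logarithmic differentiation of a power series whose coefficients depend on a parameter. -/
theorem hasDerivAt_coeff_logOf {Y : ℂ → PowerSeries ℂ} {Y' G : PowerSeries ℂ} {z : ℂ}
    (hY0 : ∀ z, constantCoeff (Y z) = 0) (hG0 : constantCoeff G = 0)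
    (hY : ∀ k, HasDerivAt (fun z => coeff k (Y z)) (coeff k Y') z) (hYG : Y' = G * (1 + Y z)) (k : ℕ) :
    HasDerivAt (fun z => coeff k (logOf (1 + Y z))) (coeff k G) z := by
  have hpow : ∀ d k : ℕ, HasDerivAt (fun z => coeff k (Y z ^ (d + 1)))
      (coeff k (((d : ℂ) + 1) • (Y z ^ d * Y'))) z := by
    intro d
    induction d with
    | zero => intro k; simpa using hY k
    | succ d ih =>
      intro k
      have : ∀ z, coeff k (Y z ^ (d + 1 + 1)) = ∑ p ∈ Finset.HasAntidiagonal.antidiagonal k,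
          coeff p.1 (Y z ^ (d + 1)) * coeff p.2 (Y z) := fun z => by rw [pow_succ, coeff_mul]
      simp only [this]
      refine (HasDerivAt.fun_sum fun p _ => (ih p.1).fun_mul (hY p.2)).congr_deriv ?_
      rw [Finset.sum_add_distrib, ← coeff_mul, ← coeff_mul, ← map_add]
      congr 1
      push_cast
      simp only [smul_eq_C_mul, map_add, map_natCast, map_one]
      ring
  simp only [coeff_logOf_one_add (hY0 _)]
  refine (HasDerivAt.fun_sum fun d _ => (hpow d k).const_mul _).congr_deriv ?_
  have e1 : ∀ d ∈ Finset.range k, (-1 : ℂ) ^ d / (d + 1) * coeff k (((d : ℂ) + 1) • (Y z ^ d * Y')) =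
      coeff k ((-Y z) ^ d * Y') := by
    intro d _
    have : (d : ℂ) + 1 ≠ 0 := by exact_mod_cast Nat.succ_ne_zero d
    rw [coeff_smul, smul_eq_mul, ← mul_assoc, div_mul_cancel₀ _ this, neg_pow (Y z), mul_assoc,
      show ((-1 : PowerSeries ℂ)) ^ d = C ((-1 : ℂ) ^ d) by simp, coeff_C_mul]
  rw [Finset.sum_congr rfl e1, ← map_sum, ← Finset.sum_mul, hYG]
  -- The truncated geometric series inverts `1 + Y` up to `(-Y) ^ k`. Multiplied by `G`, which has
  -- no constant term, this remainder begins in degree `k + 1` and does not touch the coefficient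
  -- `k`.
  have e2 : (∑ d ∈ Finset.range k, (-Y z) ^ d) * (G * (1 + Y z)) = G - G * (-Y z) ^ k := by
    have := geom_sum_mul (-Y z) k
    linear_combination (-G) * this
  rw [e2, map_sub, sub_eq_self]
  obtain ⟨H, rfl⟩ := X_dvd_iff.2 hG0
  obtain ⟨Z, hZ⟩ := X_dvd_iff.2 (hY0 z)
  rw [hZ, show X * H * (-(X * Z)) ^ k = X ^ (k + 1) * (H * (-Z) ^ k) by ring,
    coeff_X_pow_mul', if_neg (by omega)]

end PowerSeries

/-- The even coefficients of a Riccati series are obtained from the odd ones. -/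
theorem riccati_odd_even (F DF : ℕ → ℂ)
    (hDF : ∀ s, DF (s + 1) = -2 * F (s + 2) - ∑ i ∈ Finset.range s, F (i + 1) * F (s - i)) (k : ℕ) :
    DF (2 * k + 1) = -2 * (F (2 * k + 2) + ∑ i ∈ Finset.range k, F (2 * i + 2) * F (2 * (k - 1 - i) + 1)) := by
  rw [hDF]
  -- The two indices add up to `2 k + 1`, so one is odd and one is even. The two sums obtained from
  -- the parity of `i` are reflections of each other, hence equal; this gives the factor 2.
  have hs : ∀ k, ∑ i ∈ Finset.range (2 * k), F (i + 1) * F (2 * k - i) =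
      ∑ i ∈ Finset.range k, F (2 * i + 1) * F (2 * k - 2 * i) +
      ∑ i ∈ Finset.range k, F (2 * i + 2) * F (2 * k - (2 * i + 1)) := by
    intro k
    have : ∀ (f : ℕ → ℂ) k, ∑ i ∈ Finset.range (2 * k), f i = ∑ i ∈ Finset.range k, f (2 * i) +
        ∑ i ∈ Finset.range k, f (2 * i + 1) := by
      intro f k
      induction k with
      | zero => simp
      | succ k ih =>
        rw [show 2 * (k + 1) = 2 * k + 1 + 1 by ring, Finset.sum_range_succ, Finset.sum_range_succ, ih,
          Finset.sum_range_succ, Finset.sum_range_succ]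
        ring
    rw [this]
  rw [hs, ← Finset.sum_range_reflect (fun i => F (2 * i + 1) * F (2 * k - 2 * i))]
  have e : ∑ i ∈ Finset.range k, F (2 * (k - 1 - i) + 1) * F (2 * k - 2 * (k - 1 - i)) =
      ∑ i ∈ Finset.range k, F (2 * i + 2) * F (2 * (k - 1 - i) + 1) := by
    refine Finset.sum_congr rfl fun i hi => ?_
    have := Finset.mem_range.1 hi
    rw [show 2 * k - 2 * (k - 1 - i) = 2 * i + 2 by omega, mul_comm]
  have e' : ∑ i ∈ Finset.range k, F (2 * i + 2) * F (2 * k - (2 * i + 1)) =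
      ∑ i ∈ Finset.range k, F (2 * i + 2) * F (2 * (k - 1 - i) + 1) := by
    refine Finset.sum_congr rfl fun i hi => ?_
    have := Finset.mem_range.1 hi
    rw [show 2 * k - (2 * i + 1) = 2 * (k - 1 - i) + 1 by omega]
  rw [e, e']; ring

end

/-! ### Liouville transformation: regularity of ψ, branches, amplitude equation -/

noncomputable section

namespace LiouvilleGreen.TurningPointProblem

variable (P : TurningPointProblem) {j : SignType} {z : ℂ}

theorem analyticAt_f (hz : z ∈ P.D) : AnalyticAt ℂ P.f z :=
  (P.analytic_off_poles z (P.D_subset hz).1 (P.D_subset hz).2).1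

theorem analyticAt_g (hz : z ∈ P.D) : AnalyticAt ℂ P.g z :=
  (P.analytic_off_poles z (P.D_subset hz).1 (P.D_subset hz).2).2

theorem f_ne_zero (hz : z ∈ P.D) (h : z ≠ P.z₀) : P.f z ≠ 0 := fun h0 =>
  h (P.only_zero_f z (P.D_subset hz).1 (P.D_subset hz).2 h0)

theorem hasDerivAt_ζ (hz : z ∈ P.D) : HasDerivAt P.ζ (deriv P.ζ z) z :=
  (P.analytic_ζ z hz).differentiableAt.hasDerivAt

theorem hasDerivAt_deriv_ζ (hz : z ∈ P.D) : HasDerivAt (deriv P.ζ) (deriv (deriv P.ζ) z) z :=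
  (P.analytic_ζ z hz).deriv.differentiableAt.hasDerivAt

theorem hasDerivAt_deriv2_ζ (hz : z ∈ P.D) :
    HasDerivAt (deriv (deriv P.ζ)) (deriv (deriv (deriv P.ζ)) z) z :=
  (P.analytic_ζ z hz).deriv.deriv.differentiableAt.hasDerivAt

theorem eventually_mem_D (hz : z ∈ P.D) : ∀ᶠ y in 𝓝 z, y ∈ P.D := P.isOpen_D.mem_nhds hz

theorem deriv_f (hz : z ∈ P.D) :
    deriv P.f z = deriv P.ζ z ^ 3 + 2 * P.ζ z * deriv P.ζ z * deriv (deriv P.ζ) z := by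
  have h : P.f =ᶠ[𝓝 z] fun y => P.ζ y * deriv P.ζ y ^ 2 :=
    (P.eventually_mem_D hz).mono fun y hy => (P.ζ_eq y hy).symm
  rw [h.deriv_eq]
  refine (((P.hasDerivAt_ζ hz).fun_mul ((P.hasDerivAt_deriv_ζ hz).fun_pow 2)).congr_deriv ?_).deriv
  push_cast; ring

theorem deriv2_f (hz : z ∈ P.D) :
    deriv (deriv P.f) z = 5 * deriv P.ζ z ^ 2 * deriv (deriv P.ζ) z +
      2 * P.ζ z * deriv (deriv P.ζ) z ^ 2 +
      2 * P.ζ z * deriv P.ζ z * deriv (deriv (deriv P.ζ)) z := by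
  have h : deriv P.f =ᶠ[𝓝 z] fun y =>
      deriv P.ζ y ^ 3 + 2 * P.ζ y * deriv P.ζ y * deriv (deriv P.ζ) y :=
    (P.eventually_mem_D hz).mono fun y hy => P.deriv_f hy
  rw [h.deriv_eq]
  refine ((((P.hasDerivAt_deriv_ζ hz).fun_pow 3).fun_add ((((P.hasDerivAt_ζ hz).const_mul 2).fun_mul
    (P.hasDerivAt_deriv_ζ hz)).fun_mul (P.hasDerivAt_deriv2_ζ hz))).congr_deriv ?_).deriv
  push_cast; ring

/-- At the turning point f' = ζ'³, and the zero is simple; elsewhere f = ζ ζ'² does not vanish. -/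
theorem deriv_ζ_ne_zero (hz : z ∈ P.D) : deriv P.ζ z ≠ 0 := by
  intro h
  by_cases h0 : z = P.z₀
  · have := P.deriv_f hz
    rw [h] at this
    apply P.simple_zero_f
    rw [← h0, this]; ring
  · apply P.f_ne_zero hz h0
    rw [← P.ζ_eq z hz, h]; ring

theorem ζ_ne_zero (hz : z ∈ P.D) (h : z ≠ P.z₀) : P.ζ z ≠ 0 := by
  intro h0
  apply P.f_ne_zero hz h
  rw [← P.ζ_eq z hz, h0, zero_mul]

/-- The analytic expression of `ψ` in terms of the derivatives of `ζ`. -/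
def psiReg (z : ℂ) : ℂ :=
  (2 * deriv P.ζ z * deriv (deriv (deriv P.ζ)) z - 3 * deriv (deriv P.ζ) z ^ 2) /
    (4 * deriv P.ζ z ^ 4) + P.g z / deriv P.ζ z ^ 2

theorem analyticAt_psiReg (hz : z ∈ P.D) : AnalyticAt ℂ P.psiReg z := by
  have h1 := (P.analytic_ζ z hz).deriv
  have h2 := h1.deriv
  have h3 := h2.deriv
  have hg := P.analyticAt_g hz
  have h0 := P.deriv_ζ_ne_zero hz
  unfold psiReg
  exact (((analyticAt_const.mul h1).mul h3).sub (analyticAt_const.mul (h2.pow 2))).div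
    (analyticAt_const.mul (h1.pow 4)) (by simp [h0]) |>.add (hg.div (h1.pow 2) (by simp [h0]))

/-- When f = ζ ζ'² is inserted in Φ, the term 5/(16 ζ²) cancels and what is left is a Schwarzian
derivative of ζ together with g/ζ'². This has no singularity at the turning point. -/
theorem psiReg_eq (hz : z ∈ P.D) (h : z ≠ P.z₀) :
    5 / 16 * (P.ζ z ^ 2)⁻¹ + P.ζ z * P.Phi z = P.psiReg z := by
  have h0 := P.deriv_ζ_ne_zero hz
  have h1 := P.ζ_ne_zero hz h
  unfold Phi psiReg
  rw [P.deriv_f hz, P.deriv2_f hz, ← P.ζ_eq z hz]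
  field_simp
  ring

theorem psi_eq (hz : z ∈ P.D) : P.psi z = P.psiReg z := by
  unfold psi
  by_cases h : z = P.z₀
  · subst h
    rw [Function.update_self]
    have : Tendsto (fun z => 5 / 16 * (P.ζ z ^ 2)⁻¹ + P.ζ z * P.Phi z) (𝓝[≠] P.z₀)
        (𝓝 (P.psiReg P.z₀)) := by
      refine ((P.analyticAt_psiReg hz).continuousAt.tendsto.mono_left nhdsWithin_le_nhds).congr' ?_
      filter_upwards [nhdsWithin_le_nhds (P.eventually_mem_D hz), self_mem_nhdsWithin] with y hy hy'
      exact (P.psiReg_eq hy hy').symm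
    exact this.limUnder_eq
  · rw [Function.update_of_ne h]
    exact P.psiReg_eq hz h

/-- The coefficient of the first order system for `(W, dW/dζ)`. -/
def sysCoeff (z : ℂ) : ℂ × ℂ →L[ℂ] ℂ × ℂ :=
  deriv P.ζ z • ((ContinuousLinearMap.inl ℂ ℂ ℂ).comp (ContinuousLinearMap.snd ℂ ℂ ℂ) +
    (P.u ^ 2 * P.ζ z + P.psiReg z) •
      (ContinuousLinearMap.inr ℂ ℂ ℂ).comp (ContinuousLinearMap.fst ℂ ℂ ℂ))

/-- The equation is written as a first order system in z. Its coefficients are analytic on the whole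
of `D` because they involve `psiReg`, and ζ' has no zeros. -/
theorem exists_isSolution {p : ℂ} (hp : p ∈ P.D) (w v : ℂ) :
    ∃ W, P.IsSolution W ∧ W p = w ∧ P.dzeta W p = v := by
  have hA : DifferentiableOn ℂ P.sysCoeff P.D := by
    intro y hy
    have h1 := (P.analytic_ζ y hy).differentiableAt
    have h2 := (P.analytic_ζ y hy).deriv.differentiableAt
    have h3 := (P.analyticAt_psiReg hy).differentiableAt
    unfold sysCoeff
    exact (h2.smul ((differentiableAt_const _).add
      (((h1.const_mul _).add h3).smul (differentiableAt_const _)))).differentiableWithinAt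
  obtain ⟨V, hV, hVp⟩ := SolvesOn.exists_of_isSimplyConnected P.isOpen_D P.isSimplyConnected_D hA hp
    (w, v)
  have h1 : ∀ y ∈ P.D, HasDerivAt (fun z => (V z).1) (deriv P.ζ y * (V y).2) y := fun y hy => by
    refine ((ContinuousLinearMap.fst ℂ ℂ ℂ).hasFDerivAt.comp_hasDerivAt y (hV y hy)).congr_deriv ?_
    simp [sysCoeff]
  have h2 : ∀ y ∈ P.D, HasDerivAt (fun z => (V z).2)
      (deriv P.ζ y * ((P.u ^ 2 * P.ζ y + P.psiReg y) * (V y).1)) y := fun y hy => by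
    refine ((ContinuousLinearMap.snd ℂ ℂ ℂ).hasFDerivAt.comp_hasDerivAt y (hV y hy)).congr_deriv ?_
    simp [sysCoeff]
  have h3 : ∀ y ∈ P.D, P.dzeta (fun z => (V z).1) y = (V y).2 := fun y hy => by
    rw [dzeta, (h1 y hy).deriv, mul_div_cancel_left₀ _ (P.deriv_ζ_ne_zero hy)]
  refine ⟨fun z => (V z).1, ⟨?_, fun y hy => ?_⟩, by simp [hVp], by rw [h3 p hp, hVp]⟩
  · exact DifferentiableOn.analyticOnNhd
      (fun y hy => (h1 y hy).differentiableAt.differentiableWithinAt) P.isOpen_D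
  · have : P.dzeta (fun z => (V z).1) =ᶠ[𝓝 y] fun z => (V z).2 :=
      (P.eventually_mem_D hy).mono h3
    rw [dzeta, this.deriv_eq, (h2 y hy).deriv, mul_div_cancel_left₀ _ (P.deriv_ζ_ne_zero hy),
      P.psi_eq hy]

theorem continuousOn_rot : ContinuousOn (P.rot j) P.D := fun y hy =>
  (((P.analytic_ζ y hy).continuousAt.const_mul _).mul_const _).continuousWithinAt

theorem isOpen_slit : IsOpen (P.slit j) :=
  P.continuousOn_rot.isOpen_inter_preimage P.isOpen_D isOpen_slitPlane

theorem slit_ne (hz : z ∈ P.slit j) : z ≠ P.z₀ := by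
  rintro rfl
  have := slitPlane_ne_zero hz.2
  simp [rot, P.ζ_z₀] at this

theorem slit_ζ_ne (hz : z ∈ P.slit j) : P.ζ z ≠ 0 := P.ζ_ne_zero hz.1 (P.slit_ne hz)

theorem T_subset_slit (hz : z ∈ P.T j) (h : z ≠ P.z₀) : z ∈ P.slit j := by
  refine ⟨hz.1, mem_slitPlane_iff_arg.2 ⟨fun h' => ?_, ?_⟩⟩
  · have := hz.2
    rw [h', abs_of_pos Real.pi_pos] at this
    linarith [Real.pi_pos]
  · have hu : P.u ^ (2 / 3 : ℂ) ≠ 0 := by simp [cpow_eq_zero_iff, P.u_ne_zero]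
    exact mul_ne_zero (mul_ne_zero hu (P.ζ_ne_zero hz.1 h)) (exp_ne_zero _)

theorem sgn_sq (j : SignType) : sgn j ^ 2 = 1 := by
  unfold sgn; split_ifs <;> norm_num

theorem norm_sgn (j : SignType) : ‖sgn j‖ = 1 := by
  unfold sgn; split_ifs <;> norm_num

/-- The exponent `-sgn j u ξ = (2/3) (u^{2/3} ζ e^{-2πij/3})^{3/2}` of the decaying exponential. -/
def expo (j : SignType) (z : ℂ) : ℂ := 2 / 3 * P.rot j z ^ (3 / 2 : ℂ)

theorem xi_eq (j : SignType) (z : ℂ) : P.xi j z = -sgn j * P.expo j z / P.u := rfl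

theorem expo_eq (j : SignType) (z : ℂ) : -sgn j * (P.u * P.xi j z) = P.expo j z := by
  rw [xi_eq]
  have := P.u_ne_zero
  field_simp
  linear_combination P.expo j z * sgn_sq j

/-- The derivative of `expo j`. -/
def dexpo (j : SignType) (z : ℂ) : ℂ :=
  P.rot j z ^ (1 / 2 : ℂ) * (P.u ^ (2 / 3 : ℂ) * deriv P.ζ z * exp (-(2 * Real.pi * I * (j : ℂ) / 3)))

theorem hasDerivAt_rot (hz : z ∈ P.D) : HasDerivAt (P.rot j)
    (P.u ^ (2 / 3 : ℂ) * deriv P.ζ z * exp (-(2 * Real.pi * I * (j : ℂ) / 3))) z :=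
  ((P.hasDerivAt_ζ hz).const_mul _).mul_const _

theorem hasDerivAt_expo (hz : z ∈ P.slit j) : HasDerivAt (P.expo j) (P.dexpo j z) z := by
  have := ((P.hasDerivAt_rot hz.1).cpow_const (c := (3 / 2 : ℂ)) hz.2).const_mul (2 / 3)
  refine this.congr_deriv ?_
  rw [dexpo, show (3 / 2 - 1 : ℂ) = 1 / 2 by norm_num]
  ring

theorem exp_rot_cube (j : SignType) : exp (-(2 * Real.pi * I * (j : ℂ) / 3)) ^ 3 = 1 := by
  rw [← exp_nat_mul]
  have e : ((3 : ℕ) : ℂ) * (-(2 * Real.pi * I * (j : ℂ) / 3)) = -(2 * Real.pi * I * (j : ℂ)) := by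
    push_cast; ring
  rw [e]
  cases j
  · simp
  · simp [exp_two_pi_mul_I]
  · simp [exp_neg, exp_two_pi_mul_I]

theorem u_cpow_cube : (P.u ^ (2 / 3 : ℂ)) ^ 3 = P.u ^ 2 := by
  rw [← cpow_nat_mul]
  norm_num

/-- The square of the half power supplies a third factor of u^{2/3} and of the rotation. The former
combine to u², and the rotation disappears because it is a cube root of unity. The result is
therefore independent of `j`. -/
theorem dexpo_sq (hz : z ∈ P.slit j) : P.dexpo j z ^ 2 = P.u ^ 2 * P.f z := by
  have h1 : (P.rot j z ^ (1 / 2 : ℂ)) ^ 2 = P.rot j z := by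
    rw [← cpow_nat_mul]; norm_num
  rw [dexpo, mul_pow, h1, rot, ← P.ζ_eq z hz.1]
  linear_combination (P.ζ z * deriv P.ζ z ^ 2 * exp (-(2 * Real.pi * I * (j : ℂ) / 3)) ^ 3) * P.u_cpow_cube
    + P.u ^ 2 * (P.ζ z * deriv P.ζ z ^ 2) * exp_rot_cube j

theorem slit_f_ne (hz : z ∈ P.slit j) : P.f z ≠ 0 := P.f_ne_zero hz.1 (P.slit_ne hz)

theorem dexpo_ne (hz : z ∈ P.slit j) : P.dexpo j z ≠ 0 := by
  intro h
  have := P.dexpo_sq hz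
  rw [h] at this
  simp [P.u_ne_zero, P.slit_f_ne hz] at this

theorem fsqrt_eq (hz : z ∈ P.slit j) : P.fsqrt j z = -sgn j * P.dexpo j z / P.u :=
  (((P.hasDerivAt_expo hz).const_mul (-sgn j)).div_const P.u).deriv

theorem dexpo_eq (hz : z ∈ P.slit j) : P.dexpo j z = -sgn j * P.u * P.fsqrt j z := by
  rw [P.fsqrt_eq hz]
  have := P.u_ne_zero
  field_simp
  linear_combination (-P.dexpo j z) * sgn_sq j

theorem fsqrt_sq (hz : z ∈ P.slit j) : P.fsqrt j z ^ 2 = P.f z := by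
  have h := P.dexpo_sq hz
  rw [P.dexpo_eq hz] at h
  have := P.u_ne_zero
  have h2 : P.u ^ 2 * P.fsqrt j z ^ 2 = P.u ^ 2 * P.f z := by
    linear_combination h - P.u ^ 2 * P.fsqrt j z ^ 2 * sgn_sq j
  exact mul_left_cancel₀ (pow_ne_zero 2 this) h2

theorem fsqrt_ne (hz : z ∈ P.slit j) : P.fsqrt j z ≠ 0 := by
  intro h
  have := P.fsqrt_sq hz
  rw [h] at this
  simp [(P.slit_f_ne hz).symm] at this

theorem analyticAt_expo (hz : z ∈ P.slit j) : AnalyticAt ℂ (P.expo j) z :=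
  DifferentiableOn.analyticAt
    (fun _ hy => (P.hasDerivAt_expo hy).differentiableAt.differentiableWithinAt)
    (P.isOpen_slit.mem_nhds hz)

theorem eventually_mem_slit (hz : z ∈ P.slit j) : ∀ᶠ y in 𝓝 z, y ∈ P.slit j :=
  P.isOpen_slit.mem_nhds hz

theorem analyticAt_dexpo (hz : z ∈ P.slit j) : AnalyticAt ℂ (P.dexpo j) z :=
  (P.analyticAt_expo hz).deriv.congr
    ((P.eventually_mem_slit hz).mono fun _ hy => (P.hasDerivAt_expo hy).deriv)

theorem analyticAt_fsqrt (hz : z ∈ P.slit j) : AnalyticAt ℂ (P.fsqrt j) z :=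
  ((analyticAt_const.mul (P.analyticAt_expo hz)).div_const (c := P.u)).deriv

theorem analyticAt_Phi (hz : z ∈ P.slit j) : AnalyticAt ℂ P.Phi z := by
  have hf := P.analyticAt_f hz.1
  have hg := P.analyticAt_g hz.1
  have h0 := P.slit_f_ne hz
  unfold Phi
  exact (((analyticAt_const.mul hf).mul hf.deriv.deriv).sub
    (analyticAt_const.mul (hf.deriv.pow 2))).div
    (analyticAt_const.mul (hf.pow 3)) (by simp [h0]) |>.add (hg.div hf h0)

theorem zetaInvQuarter_ne (hz : z ∈ P.slit j) : P.zetaInvQuarter j z ≠ 0 := by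
  have h := slitPlane_ne_zero hz.2
  simp [zetaInvQuarter, cpow_eq_zero_iff, P.u_ne_zero, h]

theorem hasDerivAt_zetaInvQuarter (hz : z ∈ P.slit j) : HasDerivAt (P.zetaInvQuarter j)
    (-(deriv P.ζ z / (4 * P.ζ z)) * P.zetaInvQuarter j z) z := by
  have := ((P.hasDerivAt_rot hz.1).cpow_const (c := (-1 / 4 : ℂ)) hz.2).const_mul
    (P.u ^ (1 / 6 : ℂ) * exp (-(Real.pi * I * (j : ℂ) / 6)))
  refine this.congr_deriv ?_
  have h := slitPlane_ne_zero hz.2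
  rw [zetaInvQuarter, cpow_sub _ _ h, cpow_one]
  have h2 : P.u ^ (2 / 3 : ℂ) * deriv P.ζ z * exp (-(2 * Real.pi * I * (j : ℂ) / 3)) =
      P.rot j z * (deriv P.ζ z / P.ζ z) := by
    have := P.slit_ζ_ne hz
    rw [rot]; field_simp
  rw [h2]
  have := P.slit_ζ_ne hz
  field_simp

/-! The first order system satisfied by the normalized solution `a = W e^x / ζ^{-1/4}` and its
derivative `b = da/dx`, where `x = expo j`. -/

/-- `dζ/dx` -/
def zetaRate (j : SignType) (z : ℂ) : ℂ := deriv P.ζ z / P.dexpo j z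

/-- The solution normalized by its leading behaviour. -/
def amp (j : SignType) (W : ℂ → ℂ) (z : ℂ) : ℂ :=
  exp (P.expo j z) / P.zetaInvQuarter j z * W z

/-- The derivative of `amp j W` with respect to `expo j`. -/
def ampRate (j : SignType) (W : ℂ → ℂ) (z : ℂ) : ℂ :=
  exp (P.expo j z) / P.zetaInvQuarter j z *
    (P.dzeta W z * P.zetaRate j z + W z + P.zetaRate j z * W z / (4 * P.ζ z))

theorem zetaRate_ne (hz : z ∈ P.slit j) : P.zetaRate j z ≠ 0 :=
  div_ne_zero (P.deriv_ζ_ne_zero hz.1) (P.dexpo_ne hz)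

theorem zetaRate_sq (hz : z ∈ P.slit j) : P.u ^ 2 * P.ζ z * P.zetaRate j z ^ 2 = 1 := by
  have h1 := P.dexpo_ne hz
  have h2 := P.dexpo_sq hz
  rw [← P.ζ_eq z hz.1] at h2
  rw [zetaRate]
  field_simp
  linear_combination -h2

/-- The derivative comes from differentiating the identity `zetaRate_sq`, so that no branch of a
root enters. -/
theorem hasDerivAt_zetaRate (hz : z ∈ P.slit j) : HasDerivAt (P.zetaRate j)
    (-(P.zetaRate j z * deriv P.ζ z / (2 * P.ζ z))) z := by
  have hd : DifferentiableAt ℂ (P.zetaRate j) z :=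
    (P.analytic_ζ z hz.1).deriv.differentiableAt.fun_div (P.analyticAt_dexpo hz).differentiableAt
      (P.dexpo_ne hz)
  have h := ((P.hasDerivAt_ζ hz.1).const_mul (P.u ^ 2)).fun_mul (hd.hasDerivAt.fun_pow 2)
  have h1 : HasDerivAt (fun y => P.u ^ 2 * P.ζ y * P.zetaRate j y ^ 2) 0 z :=
    (hasDerivAt_const z (1 : ℂ)).congr_of_eventuallyEq
      ((P.eventually_mem_slit hz).mono fun y hy => P.zetaRate_sq hy)
  have h2 := h.unique h1
  refine hd.hasDerivAt.congr_deriv ?_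
  have := P.slit_ζ_ne hz
  have hr := P.zetaRate_ne hz
  have hu := P.u_ne_zero
  have h3 : P.zetaRate j z * P.u ^ 2 * (deriv P.ζ z * P.zetaRate j z + 2 * P.ζ z * deriv (P.zetaRate j) z) = 0 := by
    simp at h2
    linear_combination h2
  have h4 : deriv P.ζ z * P.zetaRate j z + 2 * P.ζ z * deriv (P.zetaRate j) z = 0 := by
    simpa [hr, hu] using h3
  field_simp
  linear_combination h4

theorem hasDerivAt_ampFactor (hz : z ∈ P.slit j) :
    HasDerivAt (fun z => exp (P.expo j z) / P.zetaInvQuarter j z)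
      (exp (P.expo j z) / P.zetaInvQuarter j z * (P.dexpo j z + deriv P.ζ z / (4 * P.ζ z))) z := by
  have h0 := P.zetaInvQuarter_ne hz
  refine ((P.hasDerivAt_expo hz).cexp.fun_div (P.hasDerivAt_zetaInvQuarter hz) h0).congr_deriv ?_
  have := P.slit_ζ_ne hz
  field_simp
  ring

theorem IsSolution.hasDerivAt {W : ℂ → ℂ} (hW : P.IsSolution W) (hz : z ∈ P.D) :
    HasDerivAt W (deriv P.ζ z * P.dzeta W z) z := by
  refine (hW.1 z hz).differentiableAt.hasDerivAt.congr_deriv ?_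
  rw [dzeta, mul_div_cancel₀ _ (P.deriv_ζ_ne_zero hz)]

theorem IsSolution.hasDerivAt_dzeta {W : ℂ → ℂ} (hW : P.IsSolution W) (hz : z ∈ P.D) :
    HasDerivAt (P.dzeta W) (deriv P.ζ z * ((P.u ^ 2 * P.ζ z + P.psi z) * W z)) z := by
  have hd : DifferentiableAt ℂ (P.dzeta W) z :=
    (hW.1 z hz).deriv.differentiableAt.fun_div (P.analytic_ζ z hz).deriv.differentiableAt
      (P.deriv_ζ_ne_zero hz)
  refine hd.hasDerivAt.congr_deriv ?_
  rw [← hW.2 z hz, dzeta, mul_div_cancel₀ _ (P.deriv_ζ_ne_zero hz)]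

theorem IsSolution.hasDerivAt_amp {W : ℂ → ℂ} (hW : P.IsSolution W) (hz : z ∈ P.slit j) :
    HasDerivAt (P.amp j W) (P.dexpo j z * P.ampRate j W z) z := by
  refine ((P.hasDerivAt_ampFactor hz).fun_mul (IsSolution.hasDerivAt P hW hz.1)).congr_deriv ?_
  have h1 := P.dexpo_ne hz
  have h2 := P.slit_ζ_ne hz
  have h3 := P.zetaInvQuarter_ne hz
  rw [ampRate, zetaRate]
  field_simp
  ring

/-- With x as independent variable this is a'' = 2a' + (Φ/u²) a. The term 5/(16 ζ²) of ψ is what the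
differentiation of the factor ζ^{1/4} produces, so only Φ survives. -/
theorem IsSolution.hasDerivAt_ampRate {W : ℂ → ℂ} (hW : P.IsSolution W) (hz : z ∈ P.slit j) :
    HasDerivAt (P.ampRate j W)
      (P.dexpo j z * (2 * P.ampRate j W z + P.Phi z / P.u ^ 2 * P.amp j W z)) z := by
  have h2 := P.slit_ζ_ne hz
  have hr := P.hasDerivAt_zetaRate hz
  have hW1 := IsSolution.hasDerivAt P hW hz.1
  have hW2 := IsSolution.hasDerivAt_dzeta P hW hz.1
  refine ((P.hasDerivAt_ampFactor hz).fun_mul (((hW2.fun_mul hr).fun_add hW1).fun_add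
    ((hr.fun_mul hW1).fun_div ((P.hasDerivAt_ζ hz.1).const_mul 4) (by simp [h2])))).congr_deriv ?_
  have hpsi : P.psi z = 5 / 16 * (P.ζ z ^ 2)⁻¹ + P.ζ z * P.Phi z := by
    rw [P.psi_eq hz.1, P.psiReg_eq hz.1 (P.slit_ne hz)]
  have h1 : P.dexpo j z * P.zetaRate j z = deriv P.ζ z := by
    rw [zetaRate, mul_div_cancel₀ _ (P.dexpo_ne hz)]
  have h4 := P.zetaRate_sq hz
  have hd : P.dexpo j z = P.u ^ 2 * P.ζ z * P.zetaRate j z * deriv P.ζ z := by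
    linear_combination (-P.dexpo j z) * h4 + (P.u ^ 2 * P.ζ z * P.zetaRate j z) * h1
  rw [hpsi, ampRate, amp, ← h1]
  generalize exp (P.expo j z) / P.zetaInvQuarter j z = K
  generalize P.zetaRate j z = r at *
  have hu := P.u_ne_zero
  field_simp
  have h5 : P.ζ z * r ^ 2 * P.u ^ 2 = 1 := by linear_combination h4
  linear_combination K * P.dexpo j z * 512 * P.ζ z ^ 2 * W z * (P.u ^ 2 + P.Phi z) * h5

end LiouvilleGreen.TurningPointProblem

end

/-! ### The coefficients as primitives, and the equation for the relative error -/

noncomputable section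

namespace LiouvilleGreen.TurningPointProblem

variable (P : TurningPointProblem) {j : SignType} {z : ℂ}

theorem analyticAt_F (s : ℕ) (hz : z ∈ P.slit j) : AnalyticAt ℂ (P.F j s) z := by
  induction s using Nat.strong_induction_on with
  | _ s ih =>
    match s with
    | 0 =>
      have : P.F j 0 = fun _ => 0 := by rw [F]; rfl
      rw [this]; exact analyticAt_const
    | 1 =>
      have : P.F j 1 = fun z => 1 / 2 * P.Phi z := by rw [F]
      rw [this]; exact analyticAt_const.mul (P.analyticAt_Phi hz)
    | s + 2 =>
      have h1 := (P.analyticAt_fsqrt hz).inv (P.fsqrt_ne hz)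
      have h2 := (ih (s + 1) (by omega)).deriv
      have h3 : AnalyticAt ℂ (fun z => ∑ i : Fin s, P.F j (i + 1) z * P.F j (s - i) z) z :=
        Finset.analyticAt_fun_sum _ fun i _ => (ih (i + 1) (by omega)).mul (ih (s - i) (by omega))
      have : P.F j (s + 2) = fun z => -(1 / 2) * (P.fsqrt j z)⁻¹ * deriv (P.F j (s + 1)) z
          - 1 / 2 * ∑ i : Fin s, P.F j (i + 1) z * P.F j (s - i) z := by
        funext y; rw [F]
      rw [this]
      exact ((analyticAt_const.mul h1).mul h2).sub (analyticAt_const.mul h3)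

/-- The derivative `dF̂_s/dξ`. -/
def dF (j : SignType) (s : ℕ) (z : ℂ) : ℂ := deriv (P.F j s) z / P.fsqrt j z

theorem hasDerivAt_F (s : ℕ) (hz : z ∈ P.slit j) :
    HasDerivAt (P.F j s) (P.fsqrt j z * P.dF j s z) z := by
  refine (P.analyticAt_F s hz).differentiableAt.hasDerivAt.congr_deriv ?_
  rw [dF, mul_div_cancel₀ _ (P.fsqrt_ne hz)]

theorem dF_succ (j : SignType) (z : ℂ) (s : ℕ) : P.dF j (s + 1) z = -2 * P.F j (s + 2) z -
    ∑ i ∈ Finset.range s, P.F j (i + 1) z * P.F j (s - i) z := by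
  rw [F, dF, Finset.sum_range fun i => P.F j (i + 1) z * P.F j (s - i) z]
  rw [div_eq_mul_inv]
  ring

/-- By `riccati_odd_even` the generating series satisfy (odd part)' = -2 f^{1/2} · (even part) · (1
+ odd part). Hence -1/2 times the logarithm of 1 + odd part has the even part times f^{1/2} as
derivative. -/
theorem hasDerivAt_evenCoeff (k : ℕ) (hz : z ∈ P.slit j) :
    HasDerivAt (P.evenCoeff j (k + 1)) (P.F j (2 * (k + 1)) z * P.fsqrt j z) z := by
  have key := PowerSeries.hasDerivAt_coeff_logOf
    (Y := fun z => PowerSeries.X * PowerSeries.mk fun s => P.F j (2 * s + 1) z)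
    (Y' := PowerSeries.X * PowerSeries.mk fun s => P.fsqrt j z * P.dF j (2 * s + 1) z)
    (G := PowerSeries.C (-2 * P.fsqrt j z) *
      (PowerSeries.X * PowerSeries.mk fun s => P.F j (2 * s + 2) z)) (z := z)
    (fun _ => by simp) (by simp) (fun k => ?_) ?_ (k + 1)
  · have h := key.const_mul (-1 / 2)
    have : P.evenCoeff j (k + 1) = fun z => -1 / 2 * PowerSeries.coeff (k + 1) (PowerSeries.logOf
        (1 + PowerSeries.X * PowerSeries.mk fun s => P.F j (2 * s + 1) z)) := by
      funext y; rw [evenCoeff, PowerSeries.coeff_C_mul]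
    rw [this]
    refine h.congr_deriv ?_
    rw [PowerSeries.coeff_C_mul, PowerSeries.coeff_succ_X_mul, PowerSeries.coeff_mk]
    rw [show 2 * (k + 1) = 2 * k + 2 by ring]
    ring
  · cases k with
    | zero => simpa using hasDerivAt_const z (0 : ℂ)
    | succ k => simpa only [PowerSeries.coeff_succ_X_mul, PowerSeries.coeff_mk] using P.hasDerivAt_F _ hz
  · have h : (PowerSeries.mk fun s => P.fsqrt j z * P.dF j (2 * s + 1) z) =
        PowerSeries.C (-2 * P.fsqrt j z) * ((PowerSeries.mk fun s => P.F j (2 * s + 2) z) *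
          (1 + PowerSeries.X * PowerSeries.mk fun s => P.F j (2 * s + 1) z)) := by
      ext m
      rw [PowerSeries.coeff_mk, riccati_odd_even (fun s => P.F j s z) (fun s => P.dF j s z)
        (P.dF_succ j z), PowerSeries.coeff_C_mul,
        mul_add (PowerSeries.mk fun s => P.F j (2 * s + 2) z), mul_one, map_add, PowerSeries.coeff_mk,
        mul_left_comm _ PowerSeries.X]
      cases m with
      | zero => simp; ring
      | succ m =>
        rw [PowerSeries.coeff_succ_X_mul, PowerSeries.coeff_mul,
          Finset.Nat.sum_antidiagonal_eq_sum_range_succ_mk]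
        simp only [PowerSeries.coeff_mk, Nat.add_sub_cancel]
        ring
    rw [h]; ring

variable {P}

/-- This is the only property of Ê_s that is needed from here on: odd and even indices now look
alike, and the additive constants drop out of Ê_s(z) - Ê_s(z^{(j)}). -/
theorem IsEhat.hasDerivAt {E : ℕ → ℂ → ℂ} (hE : P.IsEhat j E) {s : ℕ} (hs : 1 ≤ s)
    (hz : z ∈ P.slit j) : HasDerivAt (E s) (P.F j s z * P.fsqrt j z) z := by
  rcases Nat.even_or_odd' s with ⟨k, rfl | rfl⟩
  · obtain ⟨α, hα⟩ := hE.even_eq k (by omega)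
    obtain ⟨m, rfl⟩ : ∃ m, k = m + 1 := ⟨k - 1, by omega⟩
    exact ((P.hasDerivAt_evenCoeff m hz).add_const α).congr_of_eventuallyEq
      ((P.eventually_mem_slit hz).mono hα)
  · exact hE.odd_deriv k z hz

variable (P)

/-- The series `∑_{1 ≤ s < n} (±1)^s (Ê_s(z) - e_s) / u^s`. -/
def lgSum (j : SignType) (E : ℕ → ℂ → ℂ) (e : ℕ → ℂ) (n : ℕ) (z : ℂ) : ℂ :=
  ∑ s ∈ Finset.Icc 1 (n - 1), sgn j ^ s * (E s z - e s) / P.u ^ s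

/-- The derivative of `lgSum` with respect to `expo j`. -/
def lgRate (j : SignType) (n : ℕ) (z : ℂ) : ℂ :=
  -∑ s ∈ Finset.Icc 1 (n - 1), (sgn j / P.u) ^ (s + 1) * P.F j s z

/-- The residual of the truncated expansion. -/
def lgResidual (j : SignType) (n : ℕ) (z : ℂ) : ℂ :=
  -2 * (sgn j / P.u) ^ (n + 1) * P.F j n z + ∑ s ∈ Finset.Icc 1 (n - 1), (sgn j / P.u) ^ (s + n + 1) *
    ∑ k ∈ Finset.Icc s (n - 1), P.F j k z * P.F j (s + n - k - 1) z

/-- The relative error of the truncated expansion. -/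
def relErr (j : SignType) (E : ℕ → ℂ → ℂ) (e : ℕ → ℂ) (n : ℕ) (W : ℂ → ℂ) (z : ℂ) : ℂ :=
  P.amp j W z * exp (-P.lgSum j E e n z) - 1

/-- The derivative of the relative error with respect to `expo j`. -/
def relErrRate (j : SignType) (E : ℕ → ℂ → ℂ) (e : ℕ → ℂ) (n : ℕ) (W : ℂ → ℂ) (z : ℂ) : ℂ :=
  (P.ampRate j W z - P.lgRate j n z * P.amp j W z) * exp (-P.lgSum j E e n z)

theorem lgApprox_mul_relErr (E : ℕ → ℂ → ℂ) (e : ℕ → ℂ) (n : ℕ) (W : ℂ → ℂ) (hz : z ∈ P.slit j) :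
    W z = P.lgApprox j E e n z * (1 + P.relErr j E e n W z) := by
  have h0 := P.zetaInvQuarter_ne hz
  have h1 : lgApprox P j E e n z = P.zetaInvQuarter j z * (exp (P.lgSum j E e n z) / exp (P.expo j z)) := by
    rw [lgApprox, ← exp_sub]
    congr 2
    have := P.expo_eq j z
    rw [lgSum]
    linear_combination -this
  rw [relErr, amp, h1, exp_neg]
  have h2 := exp_ne_zero (P.lgSum j E e n z)
  have h3 := exp_ne_zero (P.expo j z)
  field_simp
  ring

variable {P} {E : ℕ → ℂ → ℂ} (hE : P.IsEhat j E) (e : ℕ → ℂ) {n : ℕ}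

include hE in
theorem hasDerivAt_lgSum (n : ℕ) (hz : z ∈ P.slit j) :
    HasDerivAt (P.lgSum j E e n) (P.dexpo j z * P.lgRate j n z) z := by
  have : HasDerivAt (P.lgSum j E e n) (∑ s ∈ Finset.Icc 1 (n - 1),
      sgn j ^ s * (P.F j s z * P.fsqrt j z) / P.u ^ s) z :=
    HasDerivAt.fun_sum fun s hs =>
      (((hE.hasDerivAt (Finset.mem_Icc.1 hs).1 hz).sub_const _).const_mul _).div_const _
  refine this.congr_deriv ?_
  rw [lgRate, mul_neg, Finset.mul_sum, ← Finset.sum_neg_distrib]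
  refine Finset.sum_congr rfl fun s _ => ?_
  rw [P.dexpo_eq hz]
  have hu := P.u_ne_zero
  rw [div_pow]
  field_simp
  linear_combination (-(sgn j) ^ s * P.F j s z * P.fsqrt j z * P.u * P.u ^ s) * sgn_sq j

theorem hasDerivAt_lgRate (n : ℕ) (hz : z ∈ P.slit j) :
    HasDerivAt (P.lgRate j n) (P.dexpo j z *
      ∑ s ∈ Finset.Icc 1 (n - 1), (sgn j / P.u) ^ (s + 2) * P.dF j s z) z := by
  have : HasDerivAt (P.lgRate j n) (-∑ s ∈ Finset.Icc 1 (n - 1),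
      (sgn j / P.u) ^ (s + 1) * (P.fsqrt j z * P.dF j s z)) z :=
    (HasDerivAt.fun_sum fun s _ => (P.hasDerivAt_F s hz).const_mul _).neg
  refine this.congr_deriv ?_
  rw [Finset.mul_sum, ← Finset.sum_neg_distrib]
  refine Finset.sum_congr rfl fun s _ => ?_
  rw [P.dexpo_eq hz]
  have hu := P.u_ne_zero
  rw [div_pow, div_pow]
  field_simp
  linear_combination ((sgn j) ^ (s + 1) * P.dF j s z * P.fsqrt j z * P.u ^ 2 * P.u ^ s) * sgn_sq j

include hE in
theorem hasDerivAt_relErr {W : ℂ → ℂ} (hW : P.IsSolution W) (n : ℕ) (hz : z ∈ P.slit j) :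
    HasDerivAt (P.relErr j E e n W) (P.dexpo j z * P.relErrRate j E e n W z) z := by
  refine (((IsSolution.hasDerivAt_amp P hW hz).fun_mul
    (hasDerivAt_lgSum hE e n hz).neg.cexp).sub_const 1).congr_deriv ?_
  rw [relErrRate]
  simp only [Pi.neg_apply]
  ring

include hE in
-- Writing a = e^S (1 + η) in the amplitude equation leaves the coefficient R = λ' + λ² - 2λ - Φ/u²
-- in front of 1 + η. `riccati_residual` with v = sgn j / u identifies it with `lgResidual`.
theorem hasDerivAt_relErrRate {W : ℂ → ℂ} (hW : P.IsSolution W) (hn : 1 ≤ n) (hz : z ∈ P.slit j) :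
    HasDerivAt (P.relErrRate j E e n W) (P.dexpo j z *
      ((2 - 2 * P.lgRate j n z) * P.relErrRate j E e n W z -
        P.lgResidual j n z * (1 + P.relErr j E e n W z))) z := by
  refine (((IsSolution.hasDerivAt_ampRate P hW hz).fun_sub ((hasDerivAt_lgRate n hz).fun_mul
    (IsSolution.hasDerivAt_amp P hW hz))).fun_mul
    (hasDerivAt_lgSum hE e n hz).neg.cexp).congr_deriv ?_
  have key := riccati_residual (fun s => P.F j s z) (fun s => P.dF j s z) (P.dF_succ j z)
    (sgn j / P.u) hn
  have hΦ : P.Phi z / P.u ^ 2 = 2 * (sgn j / P.u) ^ 2 * P.F j 1 z := by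
    have hu := P.u_ne_zero
    rw [F, div_pow, sgn_sq]
    ring
  rw [lgResidual, ← key, relErrRate, relErr, hΦ]
  simp only [Pi.neg_apply]
  have hl : ∑ s ∈ Finset.Icc 1 (n - 1), (sgn j / P.u) ^ (s + 1) * P.F j s z = -P.lgRate j n z := by
    rw [lgRate, neg_neg]
  rw [hl]
  ring

end LiouvilleGreen.TurningPointProblem

end

/-! ### Chains of arcs, and the error bound on a progressive path -/

noncomputable section

open MeasureTheory

section Chain

variable {c : ℝ → ℂ} {N : ℕ} {τ : ℕ → ℝ}

theorem exists_piece {t : ℝ} {n : ℕ} (h0 : τ 0 ≤ t) (hn : t < τ n) : ∃ i < n, τ i ≤ t ∧ t < τ (i + 1) := by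
  induction n with
  | zero => exact absurd hn (not_lt.2 h0)
  | succ n ih =>
    by_cases h : t < τ n
    · obtain ⟨i, hi, h'⟩ := ih h
      exact ⟨i, by omega, h'⟩
    · exact ⟨n, by omega, not_lt.1 h, hn⟩

variable (h0 : τ 0 = 0) (hN : τ N = 1)
  (hτ : ∀ i < N, τ i < τ (i + 1) ∧ ContDiffOn ℝ 2 c (Icc (τ i) (τ (i + 1)) ∩ Ioi 0))

include h0 hτ in
theorem chain_nonneg {i : ℕ} (hi : i ≤ N) : 0 ≤ τ i := by
  induction i with
  | zero => exact h0.ge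
  | succ i ih => exact (ih (by omega)).trans (hτ i (by omega)).1.le

include hN hτ in
theorem chain_continuousOn {δ : ℝ} (hδ : 0 < δ) (h0 : τ 0 = 0) : ContinuousOn c (Icc δ 1) := by
  have : ∀ n ≤ N, ContinuousOn c (Icc δ (τ n)) := by
    intro n hn
    induction n with
    | zero => rw [h0, Icc_eq_empty (by linarith)]; exact continuousOn_empty _
    | succ n ih =>
      have h1 : ContinuousOn c (Icc (max δ (τ n)) (τ (n + 1))) :=
        (hτ n (by omega)).2.continuousOn.mono fun t ht =>
          ⟨⟨(le_max_right _ _).trans ht.1, ht.2⟩, hδ.trans_le ((le_max_left _ _).trans ht.1)⟩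
      refine ((ih (by omega)).union_of_isClosed h1 isClosed_Icc isClosed_Icc).mono fun t ht => ?_
      rcases le_total t (τ n) with h | h
      · exact Or.inl ⟨ht.1, h⟩
      · exact Or.inr ⟨max_le ht.1 h, ht.2⟩
  rw [← hN]; exact this N le_rfl

include h0 hN hτ in
-- Breakpoints are only finitely many, so they fit into the countable exceptional set allowed in
-- `error_bound`.
theorem chain_regular {t : ℝ} (ht : t ∈ Ioo (0 : ℝ) 1) (hS : t ∉ τ '' Iic N) :
    DifferentiableAt ℝ c t ∧ ContinuousAt (deriv c) t := by
  obtain ⟨i, hi, h1, h2⟩ := exists_piece (h0.trans_le ht.1.le) (ht.2.trans_eq hN.symm)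
  have h1' : τ i < t := lt_of_le_of_ne h1 fun h => hS ⟨i, hi.le, h⟩
  have hc : ContDiffOn ℝ 2 c (Ioo (τ i) (τ (i + 1))) := (hτ i hi).2.mono fun s hs =>
    ⟨Ioo_subset_Icc_self hs, (chain_nonneg h0 hτ hi.le).trans_lt hs.1⟩
  have hm : Ioo (τ i) (τ (i + 1)) ∈ 𝓝 t := Ioo_mem_nhds h1' h2
  exact ⟨(hc.contDiffAt hm).differentiableAt (by norm_num),
    (hc.continuousOn_deriv_of_isOpen isOpen_Ioo (by norm_num)).continuousAt hm⟩

include h0 hN hτ in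
-- On each compact piece away from 0 the one-sided derivative is continuous, hence bounded. Nothing
-- of the kind is known at the end `t = 0`.
theorem chain_deriv_bounded {δ : ℝ} (hδ : 0 < δ) :
    ∃ C, ∀ t ∈ Ioo δ 1, t ∉ τ '' Iic N → ‖deriv c t‖ ≤ C := by
  have hb : ∀ i < N, ∃ C, ∀ t ∈ Ioo (τ i) (τ (i + 1)), δ < t → ‖deriv c t‖ ≤ C := by
    intro i hi
    have hu : UniqueDiffOn ℝ (Icc (τ i) (τ (i + 1)) ∩ Ioi 0) :=
      (uniqueDiffOn_Icc (hτ i hi).1).inter isOpen_Ioi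
    have hcont := (hτ i hi).2.continuousOn_derivWithin hu (by norm_num)
    obtain ⟨C, hC⟩ := (isCompact_Icc (a := max δ (τ i)) (b := τ (i + 1))).exists_bound_of_continuousOn
      (hcont.mono fun t ht =>
        ⟨⟨(le_max_right _ _).trans ht.1, ht.2⟩, hδ.trans_le ((le_max_left _ _).trans ht.1)⟩)
    refine ⟨C, fun t ht hδt => ?_⟩
    have := hC t ⟨max_le hδt.le ht.1.le, ht.2.le⟩
    rwa [derivWithin_of_mem_nhds] at this
    exact inter_mem (Icc_mem_nhds ht.1 ht.2) (Ioi_mem_nhds (hδ.trans hδt))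
  choose! C hC using hb
  refine ⟨∑ i ∈ Finset.range N, |C i|, fun t ht hS => ?_⟩
  obtain ⟨i, hi, h1, h2⟩ := exists_piece (h0.trans_le (hδ.trans ht.1).le) (ht.2.trans_eq hN.symm)
  have h1' : τ i < t := lt_of_le_of_ne h1 fun h => hS ⟨i, hi.le, h⟩
  exact (hC i hi t ⟨h1', h2⟩ ht.1).trans ((le_abs_self _).trans
    (Finset.single_le_sum (f := fun i => |C i|) (fun _ _ => abs_nonneg _) (Finset.mem_range.2 hi)))

theorem countable_image_Iic (τ : ℕ → ℝ) (N : ℕ) : (τ '' Iic N).Countable :=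
  ((Set.finite_Iic N).image τ).countable

include h0 hN hτ in
theorem chain_intervalIntegrable {δ : ℝ} (hδ : 0 < δ) (hδ1 : δ ≤ 1) :
    IntervalIntegrable (deriv c) volume δ 1 := by
  obtain ⟨C, hC⟩ := chain_deriv_bounded h0 hN hτ hδ
  rw [intervalIntegrable_iff_integrableOn_Ioo_of_le hδ1]
  refine Measure.integrableOn_of_bounded (M := C) (by simp) (measurable_deriv c).aestronglyMeasurable ?_
  have h1 : ∀ᵐ t ∂(volume.restrict (Ioo δ 1)), t ∉ τ '' Iic N :=
    ae_restrict_of_ae ((countable_image_Iic τ N).ae_notMem volume)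
  filter_upwards [h1, ae_restrict_mem measurableSet_Ioo] with t h2 h3
  exact hC t h3 h2

end Chain

namespace LiouvilleGreen.TurningPointProblem

variable {P : TurningPointProblem} {j : SignType} {r : P.RefPoint j} {c : ℝ → ℂ} {z : ℂ}

theorem RefPoint.IsProgressivePath.continuousOn (hc : r.IsProgressivePath c z) :
    ContinuousOn c (Ioc 0 1) := by
  obtain ⟨N, τ, h0, hN, hτ⟩ := hc.chain
  intro t ht
  have := chain_continuousOn hN (fun i hi => ⟨(hτ i hi).1, (hτ i hi).2.1⟩) (half_pos ht.1) h0 t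
    ⟨by linarith [ht.1], ht.2⟩
  refine this.mono_of_mem_nhdsWithin ?_
  rw [mem_nhdsWithin]
  exact ⟨Ioi (t / 2), isOpen_Ioi, by simpa using ht.1, fun s hs => ⟨le_of_lt hs.1, hs.2.2⟩⟩

theorem antitone_expo (hc : r.IsProgressivePath c z) :
    AntitoneOn (fun t => (P.expo j (c t)).re) (Ioc 0 1) := by
  have := hc.progressive
  simpa only [P.expo_eq] using this

theorem aemeasurable_comp_mul_deriv {h : ℂ → ℂ} (hc : r.IsProgressivePath c z)
    (hh : ContinuousOn h (P.slit j)) :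
    AEStronglyMeasurable (fun t => h (c t) * deriv c t) (volume.restrict (Ioc (0 : ℝ) 1)) :=
  ((hh.comp hc.continuousOn hc.mem).aestronglyMeasurable measurableSet_Ioc).mul
    (measurable_deriv c).aestronglyMeasurable

variable (P j) in
theorem continuousOn_F (s : ℕ) : ContinuousOn (P.F j s) (P.slit j) := fun _ hy =>
  (P.analyticAt_F s hy).continuousAt.continuousWithinAt

variable (P j) in
theorem continuousOn_fsqrt : ContinuousOn (P.fsqrt j) (P.slit j) := fun _ hy =>
  (P.analyticAt_fsqrt hy).continuousAt.continuousWithinAt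

variable (P j) in
theorem continuousOn_dexpo : ContinuousOn (P.dexpo j) (P.slit j) := fun _ hy =>
  (P.analyticAt_dexpo hy).continuousAt.continuousWithinAt

variable (P j) in
theorem continuousOn_lgResidual (n : ℕ) : ContinuousOn (P.lgResidual j n) (P.slit j) := by
  have := P.continuousOn_F j
  unfold lgResidual
  exact (continuousOn_const.mul (this n)).add (continuousOn_finsetSum _ fun s _ =>
    continuousOn_const.mul (continuousOn_finsetSum _ fun k _ => (this k).mul (this _)))

variable (P j) in
theorem continuousOn_lgRate (n : ℕ) : ContinuousOn (P.lgRate j n) (P.slit j) := by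
  have := P.continuousOn_F j
  unfold lgRate
  exact (continuousOn_finsetSum _ fun s _ => continuousOn_const.mul (this s)).neg

/-- Passing from dx to dξ = f^{1/2} dz multiplies by -sgn j · u, which cancels one of the `m + 1`
powers of 1/u. -/
theorem enorm_coeff (P : TurningPointProblem) (j : SignType) (m : ℕ) :
    ‖(sgn j / P.u) ^ (m + 1) * (-sgn j * P.u)‖ₑ = ‖P.u‖ₑ⁻¹ ^ m := by
  have h : ‖(sgn j / P.u) ^ (m + 1) * (-sgn j * P.u)‖ = ‖P.u⁻¹ ^ m‖ := by
    have := norm_ne_zero_iff.2 P.u_ne_zero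
    rw [norm_mul, norm_pow, norm_div, norm_mul, norm_neg, norm_sgn, norm_pow, norm_inv, pow_succ,
      one_div]
    field_simp
  rw [← enorm_norm, h, enorm_norm, enorm_pow, enorm_inv P.u_ne_zero]

/-- The residual, integrated term by term against dx, gives the terms of ω with their powers of u.
Splitting the integral of the sum uses measurability along the path. -/
theorem lintegral_residual_le (hc : r.IsProgressivePath c z) (n : ℕ) :
    ∫⁻ t in Ioc (0 : ℝ) 1, ‖P.lgResidual j n (c t) * (P.dexpo j (c t) * deriv c t)‖ₑ ≤
      ‖P.u‖ₑ⁻¹ ^ n * P.omega j n c := by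
  have hF := P.continuousOn_F j
  have hq := P.continuousOn_fsqrt j
  have hm1 : ∀ s, ContinuousOn (fun t => (∑ k ∈ Finset.Icc s (n - 1),
      P.F j k t * P.F j (s + n - k - 1) t) * P.fsqrt j t) (P.slit j) := fun s =>
    (continuousOn_finsetSum _ fun k _ => (hF k).mul (hF _)).mul hq
  calc _ ≤ ∫⁻ t in Ioc (0 : ℝ) 1, ‖P.u‖ₑ⁻¹ ^ n * (2 * ‖(P.F j n (c t) * P.fsqrt j (c t)) * deriv c t‖ₑ +
        ∑ s ∈ Finset.Icc 1 (n - 1), ‖P.u‖ₑ⁻¹ ^ s *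
          ‖((∑ k ∈ Finset.Icc s (n - 1), P.F j k (c t) * P.F j (s + n - k - 1) (c t)) *
            P.fsqrt j (c t)) * deriv c t‖ₑ) := by
        refine setLIntegral_mono' measurableSet_Ioc fun t ht => ?_
        rw [P.dexpo_eq (hc.mem t ht), lgResidual]
        have e : ((-2 * (sgn j / P.u) ^ (n + 1) * P.F j n (c t) +
            ∑ s ∈ Finset.Icc 1 (n - 1), (sgn j / P.u) ^ (s + n + 1) *
              ∑ k ∈ Finset.Icc s (n - 1), P.F j k (c t) * P.F j (s + n - k - 1) (c t)) *
            (-sgn j * P.u * P.fsqrt j (c t) * deriv c t)) =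
            ((sgn j / P.u) ^ (n + 1) * (-sgn j * P.u)) * ((-2) *
              ((P.F j n (c t) * P.fsqrt j (c t)) * deriv c t)) +
            ∑ s ∈ Finset.Icc 1 (n - 1), ((sgn j / P.u) ^ (s + n + 1) * (-sgn j * P.u)) *
              (((∑ k ∈ Finset.Icc s (n - 1), P.F j k (c t) * P.F j (s + n - k - 1) (c t)) *
            P.fsqrt j (c t)) * deriv c t) := by
          rw [add_mul, Finset.sum_mul]
          congr 1
          · ring
          · refine Finset.sum_congr rfl fun s _ => by ring
        rw [e, mul_add, Finset.mul_sum]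
        refine (enorm_add_le _ _).trans (add_le_add ?_ ((enorm_sum_le _ _).trans
          (Finset.sum_le_sum fun s _ => ?_)))
        · rw [enorm_mul, enorm_coeff, enorm_mul (-2 : ℂ)]
          have : ‖(-2 : ℂ)‖ₑ = 2 := by
            rw [enorm_neg]
            simp [enorm_eq_nnnorm]
          rw [this]
        · rw [enorm_mul, enorm_coeff, pow_add, ← mul_assoc, mul_comm (‖P.u‖ₑ⁻¹ ^ s)]
    _ = _ := by
        have hu : ‖P.u‖ₑ⁻¹ ^ n ≠ ∞ := ENNReal.pow_ne_top (by simp [P.u_ne_zero])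
        rw [lintegral_const_mul' _ _ hu, omega, lintegral_add_left', lintegral_const_mul' _ _ (by simp),
          lintegral_finsetSum']
        · congr 1
          congr 1
          refine Finset.sum_congr rfl fun s _ => ?_
          rw [lintegral_const_mul', ENNReal.inv_pow, pathInt]
          exact ENNReal.pow_ne_top (by simp [P.u_ne_zero])
        · intro s _
          exact ((aemeasurable_comp_mul_deriv hc (hm1 s)).enorm).const_mul _
        · exact ((aemeasurable_comp_mul_deriv hc ((hF n).mul hq)).enorm).const_mul _

theorem lintegral_lgRate_le (hc : r.IsProgressivePath c z) (n : ℕ) :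
    4 * ∫⁻ t in Ioc (0 : ℝ) 1, ‖P.lgRate j n (c t) * (P.dexpo j (c t) * deriv c t)‖ₑ ≤
      ‖P.u‖ₑ⁻¹ * P.varpi j n c := by
  have hF := P.continuousOn_F j
  have hq := P.continuousOn_fsqrt j
  have : ∫⁻ t in Ioc (0 : ℝ) 1, ‖P.lgRate j n (c t) * (P.dexpo j (c t) * deriv c t)‖ₑ ≤
      ‖P.u‖ₑ⁻¹ * ∑ s ∈ Finset.range (n - 1), (‖P.u‖ₑ ^ s)⁻¹ *
        pathInt (fun t => P.F j (s + 1) t * P.fsqrt j t) c := by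
    calc _ ≤ ∫⁻ t in Ioc (0 : ℝ) 1, ∑ s ∈ Finset.range (n - 1), ‖P.u‖ₑ⁻¹ ^ (s + 1) *
          ‖(P.F j (s + 1) (c t) * P.fsqrt j (c t)) * deriv c t‖ₑ := by
          refine setLIntegral_mono' measurableSet_Ioc fun t ht => ?_
          rw [P.dexpo_eq (hc.mem t ht), lgRate]
          have e : ∑ s ∈ Finset.Icc 1 (n - 1), (sgn j / P.u) ^ (s + 1) * P.F j s (c t) =
              ∑ s ∈ Finset.range (n - 1), (sgn j / P.u) ^ (s + 1 + 1) * P.F j (s + 1) (c t) := by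
            refine Finset.sum_nbij' (fun k => k - 1) (fun i => i + 1) ?_ ?_ ?_ ?_ ?_
            · intro i hi; simp at hi ⊢; omega
            · intro i hi; simp at hi ⊢; omega
            · intro i hi; simp at hi ⊢; omega
            · intro i hi; simp
            · intro i hi; simp at hi; rw [Nat.sub_add_cancel hi.1]
          rw [e, neg_mul, enorm_neg, Finset.sum_mul]
          refine (enorm_sum_le _ _).trans (Finset.sum_le_sum fun s _ => ?_)
          rw [show (sgn j / P.u) ^ (s + 1 + 1) * P.F j (s + 1) (c t) *
            (-sgn j * P.u * P.fsqrt j (c t) * deriv c t) =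
            ((sgn j / P.u) ^ (s + 1 + 1) * (-sgn j * P.u)) * ((P.F j (s + 1) (c t) *
              P.fsqrt j (c t)) * deriv c t) by ring, enorm_mul, enorm_coeff]
      _ = _ := by
          rw [lintegral_finsetSum', Finset.mul_sum]
          · refine Finset.sum_congr rfl fun s _ => ?_
            rw [lintegral_const_mul', ENNReal.inv_pow, pathInt, pow_succ', mul_assoc]
            exact ENNReal.pow_ne_top (by simp [P.u_ne_zero])
          · intro s _
            exact ((aemeasurable_comp_mul_deriv hc ((hF _).mul hq)).enorm).const_mul _
  rw [varpi, mul_left_comm]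
  exact mul_le_mul_right this 4

theorem integral_norm_le_toReal {f : ℝ → ℂ} (hf : AEStronglyMeasurable f (volume.restrict (Ioc (0 : ℝ) 1)))
    {K : ℝ≥0∞} (hK : K ≠ ∞) (h : ∫⁻ t in Ioc (0 : ℝ) 1, ‖f t‖ₑ ≤ K) {δ : ℝ} (hδ : 0 ≤ δ) (hδ1 : δ ≤ 1) :
    ∫ t in δ..1, ‖f t‖ ≤ K.toReal := by
  have hsub : Ioc δ 1 ⊆ Ioc (0 : ℝ) 1 := Ioc_subset_Ioc_left hδ
  rw [intervalIntegral.integral_of_le hδ1, integral_norm_eq_lintegral_enorm (hf.mono_set hsub)]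
  exact ENNReal.toReal_mono hK ((lintegral_mono_set hsub).trans h)

variable {E : ℕ → ℂ → ℂ} {e : ℕ → ℂ} {W : ℂ → ℂ} {n : ℕ}

/-- `error_bound` is applied on `[δ, 1]`, where everything is continuous. As δ → 0 the initial
values of η and η' vanish in the limit, while the integrals stay below ω and ϖ. -/
theorem relErr_bound (hE : P.IsEhat j E) (hW : P.IsSolution W) (hc : r.IsProgressivePath c z)
    (ha : Tendsto (fun t => P.amp j W (c t)) (𝓝[>] 0) (𝓝 1))
    (hb : Tendsto (fun t => P.ampRate j W (c t)) (𝓝[>] 0) (𝓝 0))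
    (hEe : ∀ s, 1 ≤ s → Tendsto (E s ∘ c) (𝓝[>] 0) (𝓝 (e s)))
    (hF : ∀ s, 1 ≤ s → Tendsto (fun t => P.F j s (c t)) (𝓝[>] 0) (𝓝 0))
    (hn : 1 ≤ n) (hω : P.omega j n c < ∞) (hϖ : P.varpi j n c < ∞) :
    ‖P.relErr j E e n W z‖ ≤ (‖P.u‖ ^ n)⁻¹ * (P.omega j n c).toReal *
            Real.exp (‖P.u‖⁻¹ * (P.varpi j n c).toReal +
              (‖P.u‖ ^ n)⁻¹ * (P.omega j n c).toReal) := by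
  obtain ⟨N, τ, h0, hN, hτ'⟩ := hc.chain
  have hτ : ∀ i < N, τ i < τ (i + 1) ∧ ContDiffOn ℝ 2 c (Icc (τ i) (τ (i + 1)) ∩ Ioi 0) :=
    fun i hi => ⟨(hτ' i hi).1, (hτ' i hi).2.1⟩
  set A := (‖P.u‖ ^ n)⁻¹ * (P.omega j n c).toReal with hA
  set B := ‖P.u‖⁻¹ * (P.varpi j n c).toReal with hB
  have hlgS : Tendsto (fun t => P.lgSum j E e n (c t)) (𝓝[>] 0) (𝓝 0) := by
    have : Tendsto (fun t => P.lgSum j E e n (c t)) (𝓝[>] 0)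
        (𝓝 (∑ s ∈ Finset.Icc 1 (n - 1), sgn j ^ s * (e s - e s) / P.u ^ s)) :=
      tendsto_finsetSum _ fun s hs => (((hEe s (Finset.mem_Icc.1 hs).1).sub_const _).const_mul _).div_const _
    simpa using this
  have hlgR : Tendsto (fun t => P.lgRate j n (c t)) (𝓝[>] 0) (𝓝 0) := by
    have : Tendsto (fun t => P.lgRate j n (c t)) (𝓝[>] 0)
        (𝓝 (-∑ s ∈ Finset.Icc 1 (n - 1), (sgn j / P.u) ^ (s + 1) * 0)) :=
      (tendsto_finsetSum _ fun s hs => (hF s (Finset.mem_Icc.1 hs).1).const_mul _).neg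
    simpa using this
  have hη0 : Tendsto (fun t => P.relErr j E e n W (c t)) (𝓝[>] 0) (𝓝 0) := by
    simpa [relErr] using (ha.mul hlgS.neg.cexp).sub_const 1
  have hβ0 : Tendsto (fun t => P.relErrRate j E e n W (c t)) (𝓝[>] 0) (𝓝 0) := by
    simpa [relErrRate] using (hb.sub (hlgR.mul ha)).mul hlgS.neg.cexp
  have hRm := aemeasurable_comp_mul_deriv hc (((P.continuousOn_lgResidual j n).mul (P.continuousOn_dexpo j)))
  have hhm := aemeasurable_comp_mul_deriv hc (((P.continuousOn_lgRate j n).mul (P.continuousOn_dexpo j)))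
  simp only [mul_assoc, Pi.mul_apply] at hRm hhm
  have hu0 := P.u_ne_zero
  have hinv : ‖P.u‖ₑ⁻¹ ≠ ∞ := by simp [hu0]
  have bR : ∀ δ : ℝ, 0 < δ → δ ≤ 1 →
      ∫ t in δ..1, ‖P.lgResidual j n (c t) * (P.dexpo j (c t) * deriv c t)‖ ≤ A := by
    intro δ hδ hδ1
    refine (integral_norm_le_toReal hRm ?_ (lintegral_residual_le hc n) hδ.le hδ1).trans_eq ?_
    · exact ENNReal.mul_ne_top (ENNReal.pow_ne_top hinv) hω.ne
    · simp [hA, ENNReal.toReal_mul]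
  have bh : ∀ δ : ℝ, 0 < δ → δ ≤ 1 →
      4 * ∫ t in δ..1, ‖P.lgRate j n (c t) * (P.dexpo j (c t) * deriv c t)‖ ≤ B := by
    intro δ hδ hδ1
    have h4 := lintegral_lgRate_le hc n
    have hK : ‖P.u‖ₑ⁻¹ * P.varpi j n c ≠ ∞ := ENNReal.mul_ne_top hinv hϖ.ne
    have h5 : ∫⁻ t in Ioc (0 : ℝ) 1, ‖P.lgRate j n (c t) * (P.dexpo j (c t) * deriv c t)‖ₑ ≤
        (‖P.u‖ₑ⁻¹ * P.varpi j n c) / 4 := by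
      rw [ENNReal.le_div_iff_mul_le (by simp) (by simp), mul_comm]; exact h4
    have h6 := integral_norm_le_toReal hhm (ENNReal.div_ne_top hK (by simp)) h5 hδ.le hδ1
    rw [ENNReal.toReal_div, ENNReal.toReal_mul] at h6
    simp only [ENNReal.toReal_inv, toReal_enorm, ENNReal.toReal_ofNat] at h6
    linarith
  have hmain : ∀ δ : ℝ, 0 < δ → δ < 1 → ‖P.relErr j E e n W z‖ ≤
      (‖P.relErr j E e n W (c δ)‖ + ‖P.relErrRate j E e n W (c δ)‖ + A) * Real.exp (B + A) := by
    intro δ hδ hδ1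
    have hsub : Icc δ 1 ⊆ Ioc (0 : ℝ) 1 := fun t ht => ⟨hδ.trans_le ht.1, ht.2⟩
    have hsubo : Ioo δ 1 ⊆ Ioo (0 : ℝ) 1 := Ioo_subset_Ioo_left hδ.le
    have hmem : ∀ t ∈ Icc δ 1, c t ∈ P.slit j := fun t ht => hc.mem t (hsub ht)
    have hcc : ContinuousOn c (Icc δ 1) := hc.continuousOn.mono hsub
    have hco : ∀ {f : ℂ → ℂ}, (∀ y ∈ P.slit j, ContinuousAt f y) →
        ContinuousOn (fun t => f (c t)) (Icc δ 1) := fun {f} hf =>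
      ContinuousOn.comp (g := f) (t := P.slit j) (fun y hy => (hf y hy).continuousWithinAt) hcc hmem
    have hder : ∀ {f f' : ℂ → ℂ}, (∀ y ∈ P.slit j, HasDerivAt f (f' y) y) →
        ∀ t ∈ Ioo δ 1 \ τ '' Iic N, HasDerivAt (fun t => f (c t)) (f' (c t) * deriv c t) t :=
      fun hf t ht => ((hf (c t) (hmem t (Ioo_subset_Icc_self ht.1))).scomp t
        (chain_regular h0 hN hτ (hsubo ht.1) ht.2).1.hasDerivAt).congr_deriv
          (by rw [smul_eq_mul, mul_comm])
    have hx'i : IntervalIntegrable (fun t => P.dexpo j (c t) * deriv c t) volume δ 1 :=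
      (chain_intervalIntegrable h0 hN hτ hδ hδ1.le).continuousOn_mul (by
        rw [uIcc_of_le hδ1.le]
        exact hco fun y hy => (P.analyticAt_dexpo hy).continuousAt)
    have hRc : ContinuousOn (fun t => P.lgResidual j n (c t)) (Icc δ 1) :=
      hco fun y hy => (P.continuousOn_lgResidual j n).continuousAt (P.isOpen_slit.mem_nhds hy)
    have hhc : ContinuousOn (fun t => P.lgRate j n (c t)) (Icc δ 1) :=
      hco fun y hy => (P.continuousOn_lgRate j n).continuousAt (P.isOpen_slit.mem_nhds hy)
    have := (error_bound hδ1.le (countable_image_Iic τ N)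
      (x := fun t => P.expo j (c t)) (x' := fun t => P.dexpo j (c t) * deriv c t)
      (η := fun t => P.relErr j E e n W (c t)) (b := fun t => P.relErrRate j E e n W (c t))
      (h := fun t => P.lgRate j n (c t)) (R := fun t => P.lgResidual j n (c t))
      (hco fun y hy => (P.hasDerivAt_expo hy).continuousAt)
      (hco fun y hy => (hasDerivAt_relErr hE e hW n hy).continuousAt)
      (hco fun y hy => (hasDerivAt_relErrRate hE e hW hn hy).continuousAt)
      hhc hRc
      (fun t ht => ((P.analyticAt_dexpo (hmem t (Ioo_subset_Icc_self ht.1))).continuousAt.comp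
        (chain_regular h0 hN hτ (hsubo ht.1) ht.2).1.continuousAt).mul
        (chain_regular h0 hN hτ (hsubo ht.1) ht.2).2)
      hx'i
      (hder fun y hy => P.hasDerivAt_expo hy)
      (fun t ht => (hder (fun y hy => hasDerivAt_relErr hE e hW n hy) t ht).congr_deriv (by ring))
      (fun t ht => (hder (fun y hy => hasDerivAt_relErrRate hE e hW hn hy) t ht).congr_deriv (by ring))
      ((antitone_expo hc).mono hsub)).1
    simp only [hc.endpoint] at this
    have hRi : IntervalIntegrable (fun t => ‖P.lgResidual j n (c t) * (P.dexpo j (c t) * deriv c t)‖)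
        volume δ 1 := (hx'i.continuousOn_mul (by rwa [uIcc_of_le hδ1.le])).norm
    have hhi : IntervalIntegrable (fun t => ‖P.lgRate j n (c t) * (P.dexpo j (c t) * deriv c t)‖)
        volume δ 1 := (hx'i.continuousOn_mul (by rwa [uIcc_of_le hδ1.le])).norm
    have hsplit : ∫ t in δ..1, (2 * ‖P.lgRate j n (c t)‖ + ‖P.lgResidual j n (c t)‖) *
        ‖P.dexpo j (c t) * deriv c t‖ =
        2 * (∫ t in δ..1, ‖P.lgRate j n (c t) * (P.dexpo j (c t) * deriv c t)‖) +
        ∫ t in δ..1, ‖P.lgResidual j n (c t) * (P.dexpo j (c t) * deriv c t)‖ := by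
      rw [← intervalIntegral.integral_const_mul, ← intervalIntegral.integral_add (hhi.const_mul 2) hRi]
      refine intervalIntegral.integral_congr fun t _ => ?_
      simp only [norm_mul]; ring
    rw [hsplit] at this
    refine this.trans ?_
    -- The exponent contains twice this integral, whereas `B` bounds four times the integral;
    -- nonnegativity makes the cruder bound usable.
    have hnn : 0 ≤ ∫ t in δ..1, ‖P.lgRate j n (c t) * (P.dexpo j (c t) * deriv c t)‖ :=
      intervalIntegral.integral_nonneg hδ1.le fun t _ => norm_nonneg _
    gcongr
    · exact bR δ hδ hδ1.le
    · linarith [bh δ hδ hδ1.le]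
    · exact bR δ hδ hδ1.le
  have hlim : Tendsto (fun δ => (‖P.relErr j E e n W (c δ)‖ + ‖P.relErrRate j E e n W (c δ)‖ + A) *
      Real.exp (B + A)) (𝓝[>] 0) (𝓝 (A * Real.exp (B + A))) := by
    simpa using (((hη0.norm).add hβ0.norm).add_const A).mul_const (Real.exp (B + A))
  refine ge_of_tendsto hlim ?_
  filter_upwards [Ioo_mem_nhdsGT (zero_lt_one' ℝ)] with δ hδ
  exact hmain δ hδ.1 hδ.2

end LiouvilleGreen.TurningPointProblem

end

/-! ### Normal forms of f and Φ at admissible points -/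

noncomputable section

namespace LiouvilleGreen.TurningPointProblem

/-- A local coordinate `t = coord z` at a point of the Riemann sphere (`z - w` or `1/z`), in which
`f = t^{2κ - μ} a(t)` and `Φ = t^l h(t)` with `2 l > μ`. -/
structure LocalForm (P : TurningPointProblem) (pt : OnePoint ℂ) where
  coord : ℂ → ℂ
  param : ℂ → ℂ
  coord_eq : (pt = OnePoint.infty ∧ coord = fun z => z⁻¹) ∨
    ∃ w : ℂ, pt = (w : OnePoint ℂ) ∧ coord = fun z => z - w
  κ : ℤ
  ε : ℂ
  ε_sq : ε ^ 2 = 1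
  ρ : ℝ
  ρ_pos : 0 < ρ
  μ : ℕ
  l : ℕ
  μ_lt : μ < 2 * l
  a : ℂ → ℂ
  h : ℂ → ℂ
  differentiableOn_a : DifferentiableOn ℂ a (Metric.ball 0 ρ)
  differentiableOn_h : DifferentiableOn ℂ h (Metric.ball 0 ρ)
  a_ne : ∀ t ∈ Metric.ball (0 : ℂ) ρ, a t ≠ 0
  eventually_small : ∀ δ > 0, ∀ᶠ z in sphereNhds pt, z ∈ P.D → coord z ≠ 0 ∧ ‖coord z‖ < δ
  param_coord : ∀ z, coord z ≠ 0 → param (coord z) = z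
  coord_param : ∀ t, t ≠ 0 → coord (param t) = t
  hasDerivAt_coord : ∀ z, coord z ≠ 0 → HasDerivAt coord (ε * coord z ^ (1 + κ)) z
  hasDerivAt_param : ∀ t, t ≠ 0 → HasDerivAt param (ε * t ^ (1 + κ))⁻¹ t
  f_eq : ∀ z ∈ P.D, coord z ≠ 0 → ‖coord z‖ < ρ → P.f z = coord z ^ (2 * κ - μ) * a (coord z)
  Phi_eq : ∀ z ∈ P.D, coord z ≠ 0 → ‖coord z‖ < ρ → P.Phi z = coord z ^ l * h (coord z)

variable (P : TurningPointProblem)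

/-- Differentiation of `t^k a(t)` with respect to `z`. -/
theorem hasDerivAt_zpow_mul_comp {τ : ℂ → ℂ} {κ : ℤ} {ε z : ℂ} (h0 : τ z ≠ 0)
    (hτ : HasDerivAt τ (ε * τ z ^ (1 + κ)) z) {a : ℂ → ℂ} (ha : DifferentiableAt ℂ a (τ z)) (k : ℤ) :
    HasDerivAt (fun z => τ z ^ k * a (τ z))
      (ε * τ z ^ (κ + k) * (k * a (τ z) + τ z * deriv a (τ z))) z := by
  have h1 := ((hasDerivAt_zpow k (τ z) (Or.inl h0)).comp z hτ).fun_mul (ha.hasDerivAt.comp z hτ)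
  refine h1.congr_deriv ?_
  simp only [Function.comp_apply]
  rw [zpow_add₀ h0, zpow_add₀ h0, zpow_one, zpow_sub₀ h0, zpow_one]
  field_simp

/-- Each d/dz shifts the exponent of t by κ, so Φ = t^{m+2κ} G(t) + t^{m-p} b(t)/a(t) with G
analytic. With μ = m + 2κ, the inequalities in the generic case put both exponents above μ/2. In the
double-pole case both exponents are 0, and the value of b(0) makes the constant term vanish. -/
theorem exists_localData {τ : ℂ → ℂ} {κ : ℤ} {ε : ℂ} (hε : ε ^ 2 = 1) (hκ : κ ^ 2 = 1)
    (hτ : ∀ z, τ z ≠ 0 → HasDerivAt τ (ε * τ z ^ (1 + κ)) z)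
    {m p : ℤ} {a b : ℂ → ℂ} (ha : AnalyticAt ℂ a 0) (hb : AnalyticAt ℂ b 0) (ha0 : a 0 ≠ 0)
    {ρ₀ : ℝ} (hρ₀ : 0 < ρ₀) (hfg : ∀ z ∈ P.D, τ z ≠ 0 → ‖τ z‖ < ρ₀ →
      P.f z = τ z ^ (-m) * a (τ z) ∧ P.g z = τ z ^ (-p) * b (τ z))
    (hcase : (0 < m + 2 * κ ∧ m + 2 * κ < 2 * (m - p)) ∨
      (m = -2 * κ ∧ p = -2 * κ ∧ b 0 = -1 / 4)) :
    ∃ (ρ : ℝ) (μ l : ℕ) (h : ℂ → ℂ), 0 < ρ ∧ μ < 2 * l ∧ DifferentiableOn ℂ a (Metric.ball 0 ρ) ∧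
      DifferentiableOn ℂ h (Metric.ball 0 ρ) ∧ (∀ t ∈ Metric.ball (0 : ℂ) ρ, a t ≠ 0) ∧
      ∀ z ∈ P.D, τ z ≠ 0 → ‖τ z‖ < ρ → P.f z = τ z ^ (2 * κ - μ) * a (τ z) ∧
        P.Phi z = τ z ^ l * h (τ z) := by
  obtain ⟨ρ₁, hρ₁, hball⟩ := Metric.eventually_nhds_iff_ball.1
    ((ha.eventually_analyticAt.and hb.eventually_analyticAt).and (ha.continuousAt.eventually_ne ha0))
  set ρ := min ρ₀ ρ₁ with hρ
  have hρ0 : 0 < ρ := lt_min hρ₀ hρ₁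
  have hsub : Metric.ball (0 : ℂ) ρ ⊆ Metric.ball 0 ρ₁ := Metric.ball_subset_ball (min_le_right _ _)
  have hbl : ∀ t ∈ Metric.ball (0 : ℂ) ρ, AnalyticAt ℂ a t ∧ AnalyticAt ℂ b t ∧ a t ≠ 0 := fun t ht =>
    ⟨(hball t (hsub ht)).1.1, (hball t (hsub ht)).1.2, (hball t (hsub ht)).2⟩
  set a₁ : ℂ → ℂ := fun t => ((-m : ℤ) : ℂ) * a t + t * deriv a t with ha₁
  set a₂ : ℂ → ℂ := fun t => ((κ + -m : ℤ) : ℂ) * a₁ t + t * deriv a₁ t with ha₂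
  have A1 : ∀ t ∈ Metric.ball (0 : ℂ) ρ, AnalyticAt ℂ a₁ t := fun t ht =>
    (analyticAt_const.mul (hbl t ht).1).add (analyticAt_id.mul (hbl t ht).1.deriv)
  have A2 : ∀ t ∈ Metric.ball (0 : ℂ) ρ, AnalyticAt ℂ a₂ t := fun t ht =>
    (analyticAt_const.mul (A1 t ht)).add (analyticAt_id.mul (A1 t ht).deriv)
  set G : ℂ → ℂ := fun t => (4 * a t * a₂ t - 5 * a₁ t ^ 2) / (16 * a t ^ 3) with hG
  have AG : ∀ t ∈ Metric.ball (0 : ℂ) ρ, AnalyticAt ℂ G t := fun t ht =>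
    (((analyticAt_const.mul (hbl t ht).1).mul (A2 t ht)).sub
      (analyticAt_const.mul ((A1 t ht).pow 2))).div (analyticAt_const.mul ((hbl t ht).1.pow 3))
      (by simp [(hbl t ht).2.2])
  have Aba : ∀ t ∈ Metric.ball (0 : ℂ) ρ, AnalyticAt ℂ (fun t => b t / a t) t := fun t ht =>
    (hbl t ht).2.1.div (hbl t ht).1 (hbl t ht).2.2
  have hev : ∀ z ∈ P.D, τ z ≠ 0 → ‖τ z‖ < ρ →
      ∀ᶠ y in 𝓝 z, y ∈ P.D ∧ τ y ≠ 0 ∧ ‖τ y‖ < ρ := fun z hz h0 hlt =>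
    (P.eventually_mem_D hz).and (((hτ z h0).continuousAt.eventually_ne h0).and
      ((hτ z h0).continuousAt.norm.eventually (gt_mem_nhds hlt)))
  have hf : ∀ z ∈ P.D, τ z ≠ 0 → ‖τ z‖ < ρ → P.f z = τ z ^ (-m) * a (τ z) := fun z hz h0 hlt =>
    (hfg z hz h0 (hlt.trans_le (min_le_left _ _))).1
  have hmem : ∀ {z}, ‖τ z‖ < ρ → τ z ∈ Metric.ball (0 : ℂ) ρ := fun h => by simpa using h
  have hf1 : ∀ z ∈ P.D, τ z ≠ 0 → ‖τ z‖ < ρ →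
      deriv P.f z = ε * (τ z ^ (κ + -m) * a₁ (τ z)) := fun z hz h0 hlt => by
    have e : P.f =ᶠ[𝓝 z] fun z => τ z ^ (-m) * a (τ z) :=
      (hev z hz h0 hlt).mono fun y hy => hf y hy.1 hy.2.1 hy.2.2
    rw [e.deriv_eq, (hasDerivAt_zpow_mul_comp h0 (hτ z h0)
      (hbl _ (hmem hlt)).1.differentiableAt (-m)).deriv]
    ring
  have hf2 : ∀ z ∈ P.D, τ z ≠ 0 → ‖τ z‖ < ρ →
      deriv (deriv P.f) z = τ z ^ (κ + (κ + -m)) * a₂ (τ z) := fun z hz h0 hlt => by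
    have e : deriv P.f =ᶠ[𝓝 z] fun z => ε * (τ z ^ (κ + -m) * a₁ (τ z)) :=
      (hev z hz h0 hlt).mono fun y hy => hf1 y hy.1 hy.2.1 hy.2.2
    rw [e.deriv_eq, ((hasDerivAt_zpow_mul_comp h0 (hτ z h0)
      (A1 _ (hmem hlt)).differentiableAt (κ + -m)).const_mul ε).deriv]
    simp only [ha₂]
    linear_combination (τ z ^ (κ + (κ + -m)) * (((κ + -m : ℤ) : ℂ) * a₁ (τ z) + τ z * deriv a₁ (τ z))) * hε
  have hΦ : ∀ z ∈ P.D, τ z ≠ 0 → ‖τ z‖ < ρ →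
      P.Phi z = τ z ^ (m + 2 * κ) * G (τ z) + τ z ^ (m - p) * (b (τ z) / a (τ z)) := by
    intro z hz h0 hlt
    have h1 := (hbl _ (hmem hlt)).2.2
    rw [Phi, hf z hz h0 hlt, hf1 z hz h0 hlt, hf2 z hz h0 hlt,
      (hfg z hz h0 (hlt.trans_le (min_le_left _ _))).2]
    simp only [hG]
    congr 1
    · have e1 : τ z ^ (κ + (κ + -m)) = τ z ^ (2 * κ) * (τ z ^ m)⁻¹ := by
        rw [← zpow_neg, ← zpow_add₀ h0]; congr 1; ring
      have e2 : τ z ^ (κ + -m) = τ z ^ κ * (τ z ^ m)⁻¹ := by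
        rw [← zpow_neg, ← zpow_add₀ h0]
      have e3 : τ z ^ (2 * κ) = (τ z ^ κ) ^ 2 := by
        rw [← zpow_natCast, ← zpow_mul]; congr 1; ring
      have e4 : τ z ^ (m + 2 * κ) = τ z ^ m * (τ z ^ κ) ^ 2 := by rw [zpow_add₀ h0, e3]
      rw [e1, e2, e3, e4, zpow_neg]
      have hm := zpow_ne_zero m h0
      field_simp
      rw [hε]
      ring
    · rw [zpow_neg, zpow_neg, zpow_sub₀ h0]
      have hm := zpow_ne_zero m h0
      have hp := zpow_ne_zero p h0
      field_simp
  have hdiff : ∀ {q : ℂ → ℂ}, (∀ t ∈ Metric.ball (0 : ℂ) ρ, AnalyticAt ℂ q t) →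
      DifferentiableOn ℂ q (Metric.ball 0 ρ) := fun hq t ht =>
    (hq t ht).differentiableAt.differentiableWithinAt
  rcases hcase with ⟨h1, h2⟩ | ⟨h1, h2, h3⟩
  · obtain ⟨μ, hμ⟩ : ∃ μ : ℕ, (μ : ℤ) = m + 2 * κ := ⟨(m + 2 * κ).toNat, Int.toNat_of_nonneg h1.le⟩
    -- The choice `l = ⌊μ/2⌋ + 1` is the least one with `2 l > μ`. Both exponents reach it because
    -- they are integers exceeding μ/2, and `μ ≥ 1`.
    have hl1 : μ / 2 + 1 ≤ μ := by omega
    obtain ⟨ν, hν⟩ : ∃ ν : ℕ, m - p = (μ / 2 + 1 : ℕ) + (ν : ℤ) :=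
      ⟨(m - p - (μ / 2 + 1 : ℕ)).toNat, by omega⟩
    refine ⟨ρ, μ, μ / 2 + 1, fun t => t ^ (μ - (μ / 2 + 1)) * G t + t ^ ν * (b t / a t), hρ0, by omega,
      hdiff fun t ht => (hbl t ht).1,
      hdiff fun t ht => ((analyticAt_id.pow _).mul (AG t ht)).add ((analyticAt_id.pow _).mul (Aba t ht)),
      fun t ht => (hbl t ht).2.2, fun z hz h0 hlt => ⟨?_, ?_⟩⟩
    · rw [hf z hz h0 hlt, hμ]; congr 2; ring
    · rw [hΦ z hz h0 hlt, ← hμ, hν, zpow_natCast, zpow_add₀ h0, zpow_natCast, zpow_natCast,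
        show τ z ^ μ = τ z ^ (μ / 2 + 1) * τ z ^ (μ - (μ / 2 + 1)) by rw [← pow_add]; congr 1; omega]
      ring
  · have hGb : G 0 + b 0 / a 0 = 0 := by
      simp only [hG, ha₁, ha₂, h3, h1]
      push_cast
      have hκ' : (κ : ℂ) ^ 2 = 1 := by exact_mod_cast hκ
      field_simp
      linear_combination 16 * a 0 ^ 2 * hκ'
    have A0 : AnalyticOnNhd ℂ (fun t => G t + b t / a t) (Metric.ball 0 ρ) :=
      fun t ht => (AG t ht).add (Aba t ht)
    refine ⟨ρ, 0, 1, dslope (fun t => G t + b t / a t) 0, hρ0, by norm_num,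
      hdiff fun t ht => (hbl t ht).1,
      (differentiableOn_dslope (Metric.ball_mem_nhds _ hρ0)).2 A0.differentiableOn,
      fun t ht => (hbl t ht).2.2, fun z hz h0 hlt => ⟨?_, ?_⟩⟩
    · rw [hf z hz h0 hlt]; congr 2; rw [h1]; push_cast; ring
    · have := sub_smul_dslope (fun t => G t + b t / a t) 0 (τ z)
      rw [hΦ z hz h0 hlt, show m + 2 * κ = 0 by omega, show m - p = 0 by omega, pow_one]
      simp only [sub_zero, smul_eq_mul, hGb] at this
      rw [this]; simp

theorem exists_localForm_pole {w : ℂ} (hw : w ∈ P.Z) (hp : IsPole P.f P.g w) :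
    Nonempty (LocalForm P (w : OnePoint ℂ)) := by
  have hτ : ∀ z : ℂ, z - w ≠ 0 → HasDerivAt (fun z => z - w) (1 * (z - w) ^ (1 + (-1) : ℤ)) z :=
    fun z _ => by simpa using (hasDerivAt_id z).sub_const w
  have hfm := P.meromorphic_f w hw
  have hgm := P.meromorphic_g w hw
  have hwD : w ∉ P.D := fun h => (P.D_subset h).2 hp
  obtain ⟨m, p, a, b, ha, hb, ha0, hf, hg, hcase⟩ : ∃ (m p : ℤ) (a b : ℂ → ℂ), AnalyticAt ℂ a w ∧
      AnalyticAt ℂ b w ∧ a w ≠ 0 ∧ (∀ᶠ z in 𝓝[≠] w, P.f z = (z - w) ^ (-m) * a z) ∧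
      (∀ᶠ z in 𝓝[≠] w, P.g z = (z - w) ^ (-p) * b z) ∧
      ((0 < m + 2 * (-1) ∧ m + 2 * (-1) < 2 * (m - p)) ∨
        (m = -2 * (-1) ∧ p = -2 * (-1) ∧ b w = -1 / 4)) := by
    rcases P.admissible_poles w hw hp with ⟨m, hm, hfo, -, hgo⟩ | ⟨hfo, hgo, hlim⟩
    · obtain ⟨a, ha, ha0, hf⟩ := (meromorphicOrderAt_eq_int_iff hfm).1 hfo
      -- If `g` vanishes identically near `w` it has no finite order; `p = 0` with `b = 0` then
      -- serves.
      by_cases htop : meromorphicOrderAt P.g w = ⊤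
      · refine ⟨m, 0, a, fun _ => 0, ha, analyticAt_const, ha0, hf, ?_, Or.inl ⟨by omega, by omega⟩⟩
        simpa using meromorphicOrderAt_eq_top_iff.1 htop
      · obtain ⟨n, hn⟩ := WithTop.ne_top_iff_exists.1 htop
        obtain ⟨b, hb, -, hg⟩ := (meromorphicOrderAt_eq_int_iff hgm).1 hn.symm
        have := hgo (-n) (by rw [neg_neg]; exact hn.symm)
        refine ⟨m, -n, a, b, ha, hb, ha0, hf, ?_, Or.inl ⟨by omega, by omega⟩⟩
        simpa using hg
    · obtain ⟨a, ha, ha0, hf⟩ := (meromorphicOrderAt_eq_int_iff hfm).1 hfo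
      obtain ⟨b, hb, hb0, hg⟩ := (meromorphicOrderAt_eq_int_iff hgm).1 hgo
      refine ⟨2, 2, a, b, ha, hb, ha0, hf, hg, Or.inr ⟨by norm_num, by norm_num, ?_⟩⟩
      have h1 : Tendsto (fun z => (z - w) ^ 2 * P.g z) (𝓝[≠] w) (𝓝 (b w)) := by
        refine (hb.continuousAt.tendsto.mono_left nhdsWithin_le_nhds).congr' ?_
        filter_upwards [hg, self_mem_nhdsWithin] with z hz hzw
        have : z - w ≠ 0 := sub_ne_zero.2 hzw
        rw [hz, smul_eq_mul, zpow_neg]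
        field_simp
      exact tendsto_nhds_unique h1 hlim
  obtain ⟨ρ₀, hρ₀, hfg⟩ := Metric.eventually_nhds_iff_ball.1
    ((eventually_nhdsWithin_iff.1 (hf.and hg)))
  have htr : AnalyticAt ℂ (fun t => w + t) 0 := analyticAt_const.add analyticAt_id
  obtain ⟨ρ, μ, l, h, hρ, hμ, h1, h2, h3, h4⟩ := P.exists_localData (τ := fun z => z - w) (κ := -1)
    (ε := 1) (by norm_num) (by norm_num) hτ (m := m) (p := p) (a := fun t => a (w + t))
    (b := fun t => b (w + t)) (AnalyticAt.fun_comp (by simpa using ha) htr)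
    (AnalyticAt.fun_comp (by simpa using hb) htr) (by simpa using ha0) hρ₀
    (fun z _ h0 hlt => by
      have := hfg z (by simpa [dist_eq_norm] using hlt) (sub_ne_zero.1 h0)
      simpa using this) (by simpa using hcase)
  refine ⟨⟨fun z => z - w, fun t => w + t, Or.inr ⟨w, rfl, rfl⟩, -1, 1, by norm_num, ρ, hρ, μ, l, hμ, _, h,
    h1, h2, h3, ?_, fun z _ => by simp, fun t _ => by simp, hτ, fun t _ => ?_,
    fun z hz h0 hlt => (h4 z hz h0 hlt).1, fun z hz h0 hlt => (h4 z hz h0 hlt).2⟩⟩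
  · intro δ hδ
    rw [sphereNhds, OnePoint.comap_coe_nhds]
    filter_upwards [Metric.ball_mem_nhds w hδ] with z hz hzD
    exact ⟨sub_ne_zero.2 fun h => hwD (h ▸ hzD), by simpa [dist_eq_norm] using hz⟩
  · simpa using (hasDerivAt_id t).const_add w

/-- For t = 1/z one has dt/dz = -t², which means κ = 1, ε = -1, in place of κ = -1, ε = 1 at a
finite pole. The exponents m and p then play the role of pole orders in t. -/
theorem exists_localForm_infty (hinf : AdmissibleAtInfinity P.f P.g P.Z) :
    Nonempty (LocalForm P OnePoint.infty) := by
  obtain ⟨m, p, A, B, hA, hB, hA0, hfg, hcase⟩ := hinf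
  have hτ : ∀ z : ℂ, z⁻¹ ≠ 0 → HasDerivAt (fun z => z⁻¹) (-1 * z⁻¹ ^ (1 + 1 : ℤ)) z := fun z hz => by
    refine (hasDerivAt_inv (by simpa using hz)).congr_deriv ?_
    norm_cast
    simp
  rw [eventually_inf_principal] at hfg
  obtain ⟨R, -, hR⟩ := (Metric.hasBasis_cobounded_compl_closedBall (0 : ℂ)).eventually_iff.1 hfg
  have hR1 : (0 : ℝ) < (max R 1)⁻¹ := by positivity
  obtain ⟨ρ, μ, l, h, hρ, hμ, h1, h2, h3, h4⟩ := P.exists_localData (τ := fun z => z⁻¹) (κ := 1)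
    (ε := -1) (by norm_num) (by norm_num) hτ (m := m) (p := p) hA hB hA0 hR1
    (fun z hz h0 hlt => by
      have hz0 : z ≠ 0 := by simpa using h0
      have h5 : z ∈ (Metric.closedBall (0 : ℂ) R)ᶜ := by
        rw [norm_inv] at hlt
        have := (inv_lt_inv₀ (norm_pos_iff.2 hz0) (by positivity)).1 hlt
        simp only [mem_compl_iff, Metric.mem_closedBall, dist_zero_right, not_le]
        exact (le_max_left _ _).trans_lt this
      have := hR h5 (P.D_subset hz).1
      simpa using this) (by
      rcases hcase with ⟨h1, h2⟩ | ⟨h1, h2, h3⟩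
      · exact Or.inl ⟨by omega, by omega⟩
      · exact Or.inr ⟨by omega, by omega, h3⟩)
  refine ⟨⟨fun z => z⁻¹, fun t => t⁻¹, Or.inl ⟨rfl, rfl⟩, 1, -1, by norm_num, ρ, hρ, μ, l, hμ, _, h,
    h1, h2, h3, ?_, fun z _ => by simp, fun t _ => by simp, hτ, fun t ht => ?_,
    fun z hz h0 hlt => (h4 z hz h0 hlt).1, fun z hz h0 hlt => (h4 z hz h0 hlt).2⟩⟩
  · intro δ hδ
    rw [sphereNhds, OnePoint.comap_coe_nhds_infty, coclosedCompact_eq_cocompact,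
      ← Metric.cobounded_eq_cocompact]
    have : ∀ᶠ z in Bornology.cobounded ℂ, z ∈ (Metric.closedBall (0 : ℂ) δ⁻¹)ᶜ :=
      (Metric.hasBasis_cobounded_compl_closedBall (0 : ℂ)).mem_of_mem trivial
    filter_upwards [this] with z hz _
    simp only [mem_compl_iff, Metric.mem_closedBall, dist_zero_right, not_le] at hz
    have hz0 : z ≠ 0 := norm_pos_iff.1 ((inv_pos.2 hδ).trans hz)
    refine ⟨inv_ne_zero hz0, ?_⟩
    rw [norm_inv]
    exact inv_lt_of_inv_lt₀ hδ hz
  · refine (hasDerivAt_inv ht).congr_deriv ?_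
    norm_cast
    simp

variable {P} in
theorem RefPoint.exists_localForm {j : SignType} (r : P.RefPoint j) : Nonempty (LocalForm P r.pt) := by
  rcases r.admissible with ⟨h1, h2⟩ | ⟨w, hw, h1, h2⟩
  · rw [h1]; exact P.exists_localForm_infty h2
  · rw [h1]; exact P.exists_localForm_pole hw h2

end LiouvilleGreen.TurningPointProblem

end

/-! ### The form of the coefficients near the end of a path -/

noncomputable section

/-- The Euler equation `t L' + σ L = h` has an analytic solution if `σ > 0`. -/
theorem exists_euler_solution {h : ℂ → ℂ} {ρ : ℝ} (hh : DifferentiableOn ℂ h (Metric.ball 0 ρ)) {σ : ℝ}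
    (hσ : 0 < σ) : ∃ L : ℂ → ℂ, DifferentiableOn ℂ L (Metric.ball 0 ρ) ∧
      ∀ t ∈ Metric.ball (0 : ℂ) ρ, t * deriv L t + σ * L t = h t := by
  set d : ℕ → ℂ := fun k => (k.factorial : ℂ)⁻¹ * iteratedDeriv k h 0 with hd
  have hsum : ∀ t ∈ Metric.ball (0 : ℂ) ρ, HasSum (fun k => d k * t ^ k) (h t) := fun t ht => by
    have := Complex.hasSum_taylorSeries_on_ball hh ht
    simp only [sub_zero, smul_eq_mul] at this
    refine this.congr_fun fun k => ?_
    simp only [hd]; ring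
  have hne : ∀ k : ℕ, ((k : ℂ) + σ) ≠ 0 := fun k => by
    have : (0 : ℝ) < k + σ := by positivity
    exact_mod_cast this.ne'
  have hle : ∀ k : ℕ, ‖((k : ℂ) + σ)⁻¹‖ ≤ σ⁻¹ := fun k => by
    have h1 : ‖((k : ℂ) + σ)‖ = k + σ := by
      rw [← Complex.ofReal_natCast, ← Complex.ofReal_add, Complex.norm_real, Real.norm_eq_abs,
        abs_of_nonneg (by positivity)]
    rw [norm_inv, h1]
    gcongr
    linarith [(Nat.cast_nonneg k : (0 : ℝ) ≤ k)]
  -- Comparison of Taylor coefficients in `t L' + σ L = h`. The divisors `k + σ` are at least `σ >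
  -- 0` in modulus, so convergence is inherited from `h`.
  set F : ℕ → ℂ → ℂ := fun k t => d k * ((k : ℂ) + σ)⁻¹ * t ^ k with hF
  have hFd : ∀ k t, deriv (F k) t = d k * ((k : ℂ) + σ)⁻¹ * (k * t ^ (k - 1)) := fun k t =>
    ((hasDerivAt_pow k t).const_mul _).deriv
  have loc : ∀ t ∈ Metric.ball (0 : ℂ) ρ, ∃ r, t ∈ Metric.ball (0 : ℂ) r ∧
      DifferentiableOn ℂ (fun w => ∑' k, F k w) (Metric.ball 0 r) ∧
      HasSum (fun k => deriv (F k) t) (deriv (fun w => ∑' k, F k w) t) := by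
    intro t ht
    obtain ⟨r, hr1, hr2⟩ := exists_between (show ‖t‖ < ρ by simpa using ht)
    have hr0 : 0 < r := (norm_nonneg _).trans_lt hr1
    have hs : Summable fun k => ‖d k * (r : ℂ) ^ k‖ :=
      (hsum (r : ℂ) (by simpa [abs_of_pos hr0] using hr2)).summable.norm
    have hb : ∀ k (w : ℂ), w ∈ Metric.ball (0 : ℂ) r → ‖F k w‖ ≤ ‖d k * (r : ℂ) ^ k‖ * σ⁻¹ := by
      intro k w hw
      have hw' : ‖w‖ ≤ r := by simpa using (Metric.mem_ball.1 hw).le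
      simp only [hF, norm_mul, norm_pow, Complex.norm_real, Real.norm_eq_abs, abs_of_pos hr0]
      calc ‖d k‖ * ‖((k : ℂ) + σ)⁻¹‖ * ‖w‖ ^ k ≤ ‖d k‖ * σ⁻¹ * r ^ k := by
            gcongr
            exact hle k
        _ = _ := by ring
    have hFdiff : ∀ k, DifferentiableOn ℂ (F k) (Metric.ball 0 r) := fun k =>
      ((differentiable_id.pow k).const_mul _).differentiableOn
    exact ⟨r, by simpa using hr1,
      differentiableOn_tsum_of_summable_norm (hs.mul_right _) hFdiff Metric.isOpen_ball hb,
      hasSum_deriv_of_summable_norm (hs.mul_right _) hFdiff Metric.isOpen_ball hb (by simpa using hr1)⟩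
  refine ⟨fun w => ∑' k, F k w, fun t ht => ?_, fun t ht => ?_⟩
  · obtain ⟨r, h1, h2, -⟩ := loc t ht
    exact (h2.differentiableAt (Metric.isOpen_ball.mem_nhds h1)).differentiableWithinAt
  · obtain ⟨r, -, -, h3⟩ := loc t ht
    have h4 : Summable fun k => F k t := by
      refine Summable.of_norm_bounded ((hsum t ht).summable.norm.mul_right σ⁻¹) fun k => ?_
      simp only [hF]
      rw [mul_right_comm, norm_mul _ (_⁻¹)]
      gcongr
      exact hle k
    refine ((h3.mul_left t).add (h4.hasSum.mul_left (σ : ℂ))).unique ((hsum t ht).congr_fun fun k => ?_)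
    rw [hFd]
    have := hne k
    simp only [hF]
    rcases k with _ | k
    · have h5 : (σ : ℂ) ≠ 0 := by exact_mod_cast hσ.ne'
      simp only [Nat.cast_zero, zero_mul, mul_zero, zero_add, pow_zero, mul_one]
      field_simp
    · simp only [Nat.add_sub_cancel, pow_succ] at this ⊢
      field_simp

/-- A zero-free analytic function on a disc has an analytic square root. -/
theorem exists_analytic_sqrt {a : ℂ → ℂ} {ρ : ℝ} (ha : DifferentiableOn ℂ a (Metric.ball 0 ρ))
    (h0 : ∀ t ∈ Metric.ball (0 : ℂ) ρ, a t ≠ 0) : ∃ b : ℂ → ℂ, DifferentiableOn ℂ b (Metric.ball 0 ρ) ∧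
      (∀ t ∈ Metric.ball (0 : ℂ) ρ, b t ^ 2 = a t) ∧ ∀ t ∈ Metric.ball (0 : ℂ) ρ, b t ≠ 0 := by
  rcases le_or_gt ρ 0 with hρ | hρ
  · rw [Metric.ball_eq_empty.2 hρ]
    exact ⟨a, differentiableOn_empty, by simp, by simp⟩
  have hd : DifferentiableOn ℂ (fun t => deriv a t / (2 * a t)) (Metric.ball 0 ρ) :=
    (ha.deriv Metric.isOpen_ball).div (ha.const_mul 2) fun t ht => by simp [h0 t ht]
  -- `Q` is half a logarithm of `a`, obtained as a primitive of a'/(2a); the square root is `exp Q`.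
  obtain ⟨Q, hQ0, hQ⟩ := hd.isExactOn_ball.with_val_at 0 (log (a 0) / 2)
  have hb : ∀ t ∈ Metric.ball (0 : ℂ) ρ, HasDerivAt (fun t => a t * exp (-(2 * Q t))) 0 t := fun t ht => by
    refine ((ha.differentiableAt (Metric.isOpen_ball.mem_nhds ht)).hasDerivAt.fun_mul
      ((hQ t ht).const_mul 2).fun_neg.cexp).congr_deriv ?_
    have := h0 t ht
    field_simp
    ring
  have h00 : (0 : ℂ) ∈ Metric.ball (0 : ℂ) ρ := by simpa using hρ
  refine ⟨fun t => exp (Q t), fun t ht => (hQ t ht).cexp.differentiableAt.differentiableWithinAt,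
    fun t ht => ?_, fun t _ => exp_ne_zero _⟩
  have := Metric.isOpen_ball.is_const_of_deriv_eq_zero (convex_ball (0 : ℂ) ρ).isPreconnected
    (fun t ht => (hb t ht).differentiableAt.differentiableWithinAt) (fun t ht => (hb t ht).deriv) ht h00
  simp only [hQ0] at this
  rw [mul_div_cancel₀ _ (two_ne_zero), exp_neg, exp_neg,
    exp_log (h0 0 h00), mul_inv_cancel₀ (h0 0 h00)] at this
  have h1 := exp_ne_zero (2 * Q t)
  field_simp at this
  rw [← exp_nat_mul, this]
  norm_num

namespace LiouvilleGreen.TurningPointProblem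

namespace LocalForm

variable {P : TurningPointProblem} {pt : OnePoint ℂ} (L : LocalForm P pt) (j : SignType) {z : ℂ}

/-- The part of the slit domain which is covered by the local coordinate. -/
def dom (δ : ℝ) : Set ℂ := {z | z ∈ P.slit j ∧ L.coord z ≠ 0 ∧ ‖L.coord z‖ < δ}

variable {j}

theorem dom_mono {δ δ' : ℝ} (h : δ ≤ δ') : L.dom j δ ⊆ L.dom j δ' := fun _ hz =>
  ⟨hz.1, hz.2.1, hz.2.2.trans_le h⟩

theorem isOpen_dom (δ : ℝ) : IsOpen (L.dom j δ) := by
  rw [isOpen_iff_mem_nhds]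
  intro z hz
  have hc := (L.hasDerivAt_coord z hz.2.1).continuousAt
  filter_upwards [P.eventually_mem_slit hz.1, hc.eventually_ne hz.2.1,
    hc.norm.eventually (gt_mem_nhds hz.2.2)] with y h1 h2 h3
  exact ⟨h1, h2, h3⟩

theorem coord_mem_ball {δ : ℝ} (hz : z ∈ L.dom j δ) : L.coord z ∈ Metric.ball (0 : ℂ) δ := by
  simpa using hz.2.2

variable (j) in
/-- `t^κ / f^{1/2}`, a square root of `t^μ / a`. -/
def root (z : ℂ) : ℂ := L.coord z ^ L.κ / P.fsqrt j z

theorem fsqrt_sq (hz : z ∈ L.dom j L.ρ) :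
    P.fsqrt j z ^ 2 = L.coord z ^ (2 * L.κ - L.μ) * L.a (L.coord z) := by
  rw [P.fsqrt_sq hz.1, L.f_eq z hz.1.1 hz.2.1 hz.2.2]

theorem root_sq (hz : z ∈ L.dom j L.ρ) :
    L.root j z ^ 2 = L.coord z ^ L.μ * (L.a (L.coord z))⁻¹ := by
  rw [root, div_pow, L.fsqrt_sq hz, zpow_sub₀ hz.2.1, zpow_natCast, ← zpow_natCast, ← zpow_mul,
    mul_comm (L.κ) _]
  have h1 := zpow_ne_zero (2 * L.κ) hz.2.1
  have h2 := L.a_ne _ (L.coord_mem_ball hz)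
  have h3 := pow_ne_zero L.μ hz.2.1
  push_cast
  field_simp

theorem differentiableAt_of_mem {A : ℂ → ℂ} (hA : DifferentiableOn ℂ A (Metric.ball 0 L.ρ))
    (hz : z ∈ L.dom j L.ρ) : DifferentiableAt ℂ A (L.coord z) :=
  hA.differentiableAt (Metric.isOpen_ball.mem_nhds (L.coord_mem_ball hz))

theorem hasDerivAt_comp_coord {A : ℂ → ℂ} (hA : DifferentiableOn ℂ A (Metric.ball 0 L.ρ))
    (k : ℤ) (hz : z ∈ L.dom j L.ρ) : HasDerivAt (fun z => L.coord z ^ k * A (L.coord z))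
      (L.ε * L.coord z ^ (L.κ + k) * (k * A (L.coord z) + L.coord z * deriv A (L.coord z))) z :=
  hasDerivAt_zpow_mul_comp hz.2.1 (L.hasDerivAt_coord z hz.2.1) (L.differentiableAt_of_mem hA hz) k

theorem hasDerivAt_fsqrt (hz : z ∈ L.dom j L.ρ) : HasDerivAt (P.fsqrt j)
    (L.ε * L.coord z ^ L.κ * P.fsqrt j z * (L.κ - L.μ / 2 +
      L.coord z * deriv L.a (L.coord z) / (2 * L.a (L.coord z)))) z := by
  have h0 := P.fsqrt_ne hz.1
  have hd := (P.analyticAt_fsqrt hz.1).differentiableAt.hasDerivAt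
  refine hd.congr_deriv ?_
  have h1 : HasDerivAt (fun z => P.fsqrt j z ^ 2) (L.ε * L.coord z ^ (L.κ + (2 * L.κ - L.μ)) *
      ((2 * L.κ - L.μ : ℤ) * L.a (L.coord z) + L.coord z * deriv L.a (L.coord z))) z :=
    (L.hasDerivAt_comp_coord L.differentiableOn_a (2 * L.κ - L.μ) hz).congr_of_eventuallyEq
      (eventually_of_mem ((L.isOpen_dom L.ρ).mem_nhds hz) fun y hy => L.fsqrt_sq hy)
  have h2 := (hd.fun_pow 2).unique h1
  have h3 := L.fsqrt_sq hz
  have h4 := L.a_ne _ (L.coord_mem_ball hz)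
  refine mul_left_cancel₀ (mul_ne_zero two_ne_zero h0) ?_
  have h5 : 2 * P.fsqrt j z * deriv (P.fsqrt j) z = L.ε * L.coord z ^ (L.κ + (2 * L.κ - L.μ)) *
      ((2 * L.κ - L.μ : ℤ) * L.a (L.coord z) + L.coord z * deriv L.a (L.coord z)) := by
    rw [← h2]; simp
  rw [h5, zpow_add₀ hz.2.1]
  have h6 : P.fsqrt j z ^ 2 / L.a (L.coord z) = L.coord z ^ (2 * L.κ - L.μ) := by
    rw [h3]; field_simp
  rw [← h6]
  push_cast
  field_simp

theorem hasDerivAt_root (hz : z ∈ L.dom j L.ρ) : HasDerivAt (L.root j)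
    (L.ε * L.coord z ^ L.κ * L.root j z * (L.μ / 2 -
      L.coord z * deriv L.a (L.coord z) / (2 * L.a (L.coord z)))) z := by
  have h0 := P.fsqrt_ne hz.1
  have h1 := L.hasDerivAt_comp_coord (differentiableOn_const 1) L.κ hz
  simp only [mul_one, deriv_const, mul_zero, add_zero] at h1
  refine (h1.fun_div (L.hasDerivAt_fsqrt hz) h0).congr_deriv ?_
  have h4 := L.a_ne _ (L.coord_mem_ball hz)
  rw [root, zpow_add₀ hz.2.1]
  field_simp
  ring

variable (j) in
/-- Functions of the form `t^l (A(t) + ρ B(t))`, where `ρ² = t^μ / a`, with analytic `A`, `B`. -/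
def Regular (H : ℂ → ℂ) : Prop := ∃ A B : ℂ → ℂ, DifferentiableOn ℂ A (Metric.ball 0 L.ρ) ∧
  DifferentiableOn ℂ B (Metric.ball 0 L.ρ) ∧ ∀ z ∈ L.dom j L.ρ,
    H z = L.coord z ^ L.l * (A (L.coord z) + L.root j z * B (L.coord z))

variable {L} {H H₁ H₂ : ℂ → ℂ}

theorem Regular.zero : L.Regular j fun _ => 0 :=
  ⟨fun _ => 0, fun _ => 0, differentiableOn_const 0, differentiableOn_const 0, fun _ _ => by simp⟩

theorem Regular.add (h₁ : L.Regular j H₁) (h₂ : L.Regular j H₂) :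
    L.Regular j fun z => H₁ z + H₂ z := by
  obtain ⟨A, B, hA, hB, h⟩ := h₁
  obtain ⟨A', B', hA', hB', h'⟩ := h₂
  exact ⟨fun t => A t + A' t, fun t => B t + B' t, hA.add hA', hB.add hB', fun z hz => by
    beta_reduce; rw [h z hz, h' z hz]; ring⟩

theorem Regular.const_mul (h₁ : L.Regular j H) (c : ℂ) : L.Regular j fun z => c * H z := by
  obtain ⟨A, B, hA, hB, h⟩ := h₁
  exact ⟨fun t => c * A t, fun t => c * B t, hA.const_mul c, hB.const_mul c, fun z hz => by
    beta_reduce; rw [h z hz]; ring⟩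

/-- The square of `root` is analytic in t, so A + root · B is an algebra. The second factor t^l is
kept inside the new A and B. -/
theorem Regular.mul (h₁ : L.Regular j H₁) (h₂ : L.Regular j H₂) :
    L.Regular j fun z => H₁ z * H₂ z := by
  obtain ⟨A, B, hA, hB, h⟩ := h₁
  obtain ⟨A', B', hA', hB', h'⟩ := h₂
  have hp : ∀ n : ℕ, DifferentiableOn ℂ (fun t : ℂ => t ^ n) (Metric.ball 0 L.ρ) := fun n =>
    (differentiable_id.pow n).differentiableOn
  refine ⟨fun t => t ^ L.l * (A t * A' t + t ^ L.μ * (L.a t)⁻¹ * (B t * B' t)),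
    fun t => t ^ L.l * (A t * B' t + B t * A' t),
    (hp _).mul ((hA.mul hA').add (((hp _).mul (L.differentiableOn_a.inv L.a_ne)).mul (hB.mul hB'))),
    (hp _).mul ((hA.mul hB').add (hB.mul hA')), fun z hz => ?_⟩
  beta_reduce
  rw [h z hz, h' z hz]
  linear_combination (L.coord z ^ L.l) ^ 2 * B (L.coord z) * B' (L.coord z) * L.root_sq hz

theorem Regular.sum {ι : Type*} {H : ι → ℂ → ℂ} {s : Finset ι} (h : ∀ i ∈ s, L.Regular j (H i)) :
    L.Regular j fun z => ∑ i ∈ s, H i z := by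
  classical
  induction s using Finset.induction_on with
  | empty => simpa using Regular.zero
  | insert i s hi ih =>
    simp only [Finset.sum_insert hi]
    exact (h i (by simp)).add (ih fun k hk => h k (by simp [hk]))

/-- In the coordinate t the operator f^{-1/2} d/dz is ε · root · t d/dt. The operator t d/dt keeps
the power t^l, and the factor `root` exchanges the two components. -/
theorem Regular.deriv_div (h₁ : L.Regular j H) :
    L.Regular j fun z => (P.fsqrt j z)⁻¹ * deriv H z := by
  obtain ⟨A, B, hA, hB, h⟩ := h₁
  have hid : DifferentiableOn ℂ (fun t : ℂ => t) (Metric.ball 0 L.ρ) := differentiableOn_id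
  have hp : DifferentiableOn ℂ (fun t : ℂ => t ^ L.μ) (Metric.ball 0 L.ρ) :=
    (differentiable_id.pow _).differentiableOn
  have ho := Metric.isOpen_ball (x := (0 : ℂ)) (ε := L.ρ)
  have ha := L.differentiableOn_a
  refine ⟨fun t => L.ε * (t ^ L.μ * (L.a t)⁻¹) * ((L.l + L.μ / 2 - t * deriv L.a t * (L.a t)⁻¹ / 2) * B t +
      t * deriv B t), fun t => L.ε * (L.l * A t + t * deriv A t),
    ((hp.mul (ha.inv L.a_ne)).const_mul _).mul ((((((hid.mul (ha.deriv ho)).mul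
      (ha.inv L.a_ne)).div_const _).const_sub _).mul hB).add (hid.mul (hB.deriv ho))),
    ((hA.const_mul _).add (hid.mul (hA.deriv ho))).const_mul _, fun z hz => ?_⟩
  have h1 := (L.hasDerivAt_comp_coord hA L.l hz).fun_add
    ((L.hasDerivAt_root hz).fun_mul (L.hasDerivAt_comp_coord hB L.l hz))
  have h2 : H =ᶠ[𝓝 z] fun z => L.coord z ^ (L.l : ℤ) * A (L.coord z) +
      L.root j z * (L.coord z ^ (L.l : ℤ) * B (L.coord z)) :=
    eventually_of_mem ((L.isOpen_dom L.ρ).mem_nhds hz) fun y hy => by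
      beta_reduce; rw [h y hy, zpow_natCast]; ring
  beta_reduce
  rw [(h1.congr_of_eventuallyEq h2).deriv, zpow_add₀ hz.2.1]
  simp only [zpow_natCast, Int.cast_natCast]
  have h0 := P.fsqrt_ne hz.1
  have h4 := L.a_ne _ (L.coord_mem_ball hz)
  have h5 : L.coord z ^ L.κ = L.root j z * P.fsqrt j z := by rw [root]; field_simp
  rw [h5]
  have h6 := L.root_sq hz
  rw [← h6]
  field_simp
  ring

variable (L) in
-- F̂_1 = t^l h/2, and the recursion uses only sums, products and f^{-1/2} d/dz.
theorem regular_F {s : ℕ} (hs : 1 ≤ s) : L.Regular j (P.F j s) := by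
  induction s using Nat.strong_induction_on with
  | _ s ih =>
    match s with
    | 1 =>
      refine ⟨fun t => 1 / 2 * L.h t, fun _ => 0, L.differentiableOn_h.const_mul _,
        differentiableOn_const 0, fun z hz => ?_⟩
      rw [F]
      beta_reduce
      rw [L.Phi_eq z hz.1.1 hz.2.1 hz.2.2]
      ring
    | s + 2 =>
      have h1 := (ih (s + 1) (by omega) (by omega)).deriv_div.const_mul (-(1 / 2))
      have h2 : L.Regular j fun z => ∑ i : Fin s, P.F j (i + 1) z * P.F j (s - i) z :=
        Regular.sum fun i _ => (ih _ (by omega) (by omega)).mul (ih _ (by omega) (by omega))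
      have h3 := h1.add (h2.const_mul (-(1 / 2)))
      have : P.F j (s + 2) = fun z => -(1 / 2) * ((P.fsqrt j z)⁻¹ * deriv (P.F j (s + 1)) z)
          + -(1 / 2) * ∑ i : Fin s, P.F j (i + 1) z * P.F j (s - i) z := by
        funext y; rw [F]; ring
      rwa [this]

end LocalForm

end LiouvilleGreen.TurningPointProblem

end

/-! ### Limits of F̂ and Ê at the reference point -/

noncomputable section

theorem IsOpen.eq_of_joinedIn {U : Set ℂ} (hU : IsOpen U) {H : ℂ → ℂ} (hH : ∀ z ∈ U, HasDerivAt H 0 z)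
    {x y : ℂ} (h : JoinedIn U x y) : H x = H y := by
  obtain ⟨γ, hγ⟩ := h
  have hx : x ∈ U := by simpa using hγ 0
  have hsub : range γ ⊆ connectedComponentIn U x :=
    (isPreconnected_range γ.continuous).subset_connectedComponentIn ⟨0, by simp⟩ (by rintro _ ⟨t, rfl⟩; exact hγ t)
  have hm : ∀ z ∈ connectedComponentIn U x, HasDerivAt H 0 z := fun z hz =>
    hH z (connectedComponentIn_subset U x hz)
  exact hU.connectedComponentIn.is_const_of_deriv_eq_zero isPreconnected_connectedComponentIn
    (fun z hz => (hm z hz).differentiableAt.differentiableWithinAt) (fun z hz => (hm z hz).deriv)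
    (mem_connectedComponentIn hx) (hsub ⟨1, by simp⟩)

theorem tendsto_zero_of_sq {α : Type*} {l : Filter α} {f : α → ℂ}
    (h : Tendsto (fun x => f x ^ 2) l (𝓝 0)) : Tendsto f l (𝓝 0) := by
  rw [tendsto_zero_iff_norm_tendsto_zero] at h ⊢
  simpa [norm_pow, Real.sqrt_sq] using h.sqrt

namespace LiouvilleGreen.TurningPointProblem

variable {P : TurningPointProblem} {j : SignType} {r : P.RefPoint j} {c c' : ℝ → ℂ} {z : ℂ}

/-- Both curves are joined to the reference arc, and so to each other. -/
theorem RefPoint.Reaches.joined (h : r.Reaches c) (h' : r.Reaches c') {N : Set ℂ}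
    (hN : N ∈ sphereNhds r.pt) :
    ∀ᶠ q : ℝ × ℝ in 𝓝[>] 0 ×ˢ 𝓝[>] 0, JoinedIn (N ∩ P.T j) (c q.1) (c' q.2) := by
  obtain ⟨pa, hpa, pb, hpb, hp⟩ := eventually_prod_iff.1 (h.2 N hN)
  obtain ⟨pa', hpa', pb', hpb', hp'⟩ := eventually_prod_iff.1 (h'.2 N hN)
  obtain ⟨t, ht⟩ := (hpb.and hpb').exists
  exact eventually_prod_iff.2 ⟨pa, hpa, pa', hpa', fun hx _ hy => (hp hx ht.1).trans (hp' hy ht.2).symm⟩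

theorem RefPoint.Reaches.eventually_mem (h : r.Reaches c) {N : Set ℂ} (hN : N ∈ sphereNhds r.pt) :
    ∀ᶠ t in 𝓝[>] (0 : ℝ), c t ∈ N ∩ P.T j :=
  (h.2 N hN).curry.mono fun _ ht => ht.exists.choose_spec.source_mem

namespace LocalForm

variable {pt : OnePoint ℂ} (L : LocalForm P pt)

variable (j) in
-- `T j` contains the turning point (the argument of 0 being 0 by convention), but the slit domain
-- does not. The neighbourhood is therefore shrunk until it leaves out z₀.
theorem mem_sphereNhds {δ : ℝ} (hδ : 0 < δ) : {z | z ∈ P.T j → z ∈ L.dom j δ} ∈ sphereNhds pt := by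
  obtain ⟨δ', hδ', hle, hz₀⟩ : ∃ δ' > 0, δ' ≤ δ ∧ (L.coord P.z₀ ≠ 0 → δ' ≤ ‖L.coord P.z₀‖) := by
    by_cases h : L.coord P.z₀ = 0
    · exact ⟨δ, hδ, le_rfl, fun h' => absurd h h'⟩
    · exact ⟨min δ ‖L.coord P.z₀‖, lt_min hδ (norm_pos_iff.2 h), min_le_left _ _, fun _ => min_le_right _ _⟩
  filter_upwards [L.eventually_small δ' hδ'] with z hz hT
  obtain ⟨h1, h2⟩ := hz hT.1
  refine ⟨P.T_subset_slit hT ?_, h1, h2.trans_le hle⟩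
  rintro rfl
  exact absurd h2 (not_lt.2 (hz₀ h1))

variable (j) in
/-- Approach to the centre of the local coordinate within the slit domain. -/
def near : Filter ℂ := comap L.coord (𝓝 0) ⊓ 𝓟 (L.dom j L.ρ)

theorem tendsto_near {L : LocalForm P r.pt} (h : r.Reaches c) : Tendsto c (𝓝[>] 0) (L.near j) := by
  have hm : ∀ δ > 0, ∀ᶠ t in 𝓝[>] (0 : ℝ), c t ∈ L.dom j δ := fun δ hδ =>
    (h.eventually_mem (L.mem_sphereNhds j hδ)).mono fun t ht => ht.1 ht.2
  refine tendsto_inf.2 ⟨tendsto_comap_iff.2 ?_, tendsto_principal.2 (hm _ L.ρ_pos)⟩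
  rw [Metric.tendsto_nhds]
  intro δ hδ
  filter_upwards [hm δ hδ] with t ht
  simpa using ht.2.2

theorem tendsto_comp_coord {A : ℂ → ℂ} (hA : DifferentiableOn ℂ A (Metric.ball 0 L.ρ)) :
    Tendsto (fun z => A (L.coord z)) (L.near j) (𝓝 (A 0)) :=
  (hA.differentiableAt (Metric.ball_mem_nhds 0 L.ρ_pos)).continuousAt.tendsto.comp
    (tendsto_comap.mono_left inf_le_left)

theorem eventually_near : ∀ᶠ z in L.near j, z ∈ L.dom j L.ρ :=
  mem_inf_of_right (mem_principal_self _)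

variable {L} {H : ℂ → ℂ}

/-- As `l ≥ 1`, both parts vanish with t. The part containing `root` is squared so that only
integral powers of t occur. -/
theorem Regular.tendsto (h : L.Regular j H) : Tendsto H (L.near j) (𝓝 0) := by
  obtain ⟨A, B, hA, hB, h⟩ := h
  have hl : L.l ≠ 0 := by have := L.μ_lt; omega
  have hp : ∀ n : ℕ, DifferentiableOn ℂ (fun t : ℂ => t ^ n) (Metric.ball 0 L.ρ) := fun n =>
    (differentiable_id.pow n).differentiableOn
  have h1 : Tendsto (fun z => L.coord z ^ L.l * A (L.coord z)) (L.near j) (𝓝 0) := by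
    simpa [hl] using L.tendsto_comp_coord (j := j) ((hp L.l).mul hA)
  have h2 : Tendsto (fun z => L.coord z ^ L.l * (L.root j z * B (L.coord z))) (L.near j) (𝓝 0) := by
    refine tendsto_zero_of_sq ?_
    have : Tendsto (fun z => (L.coord z ^ (2 * L.l + L.μ) * ((L.a (L.coord z))⁻¹ * B (L.coord z) ^ 2)))
        (L.near j) (𝓝 0) := by
      simpa [hl] using L.tendsto_comp_coord (j := j)
        ((hp (2 * L.l + L.μ)).mul ((L.differentiableOn_a.inv L.a_ne).mul (hB.pow 2)))
    refine this.congr' (L.eventually_near.mono fun z hz => ?_)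
    have := L.root_sq hz
    beta_reduce
    rw [mul_pow, mul_pow, this, pow_add, pow_mul']
    ring
  have := h1.add h2
  rw [add_zero] at this
  exact this.congr' (L.eventually_near.mono fun z hz => by rw [h z hz]; ring)

/-- The function `H f^{1/2}` has a primitive that vanishes at the centre of the local coordinate. -/
theorem Regular.exists_primitive (h : L.Regular j H) : ∃ G : ℂ → ℂ,
    (∀ z ∈ L.dom j L.ρ, HasDerivAt G (H z * P.fsqrt j z) z) ∧ Tendsto G (L.near j) (𝓝 0) := by
  obtain ⟨A, B, hA, hB, h⟩ := h
  have hl : L.l ≠ 0 := by have := L.μ_lt; omega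
  have hp : ∀ n : ℕ, DifferentiableOn ℂ (fun t : ℂ => t ^ n) (Metric.ball 0 L.ρ) := fun n =>
    (differentiable_id.pow n).differentiableOn
  -- Formally f^{1/2} = t^{κ-μ/2} q. The part with A integrates to t^{l-κ} (M/q) f^{1/2}, where M
  -- solves an Euler equation with σ = l - μ/2. The part with `root` · B, which times f^{1/2} is
  -- t^{l+κ} B, integrates to ε t^l L₂ with σ = l. Both values of σ are positive because 2l > μ.
  obtain ⟨q, hq, hqa, hq0⟩ := exists_analytic_sqrt L.differentiableOn_a L.a_ne
  obtain ⟨M, hM, hMe⟩ := exists_euler_solution (σ := L.l - L.μ / 2) ((hA.mul hq).const_mul L.ε) (by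
    have : (L.μ : ℝ) < 2 * L.l := by exact_mod_cast L.μ_lt
    linarith)
  obtain ⟨L₂, hL₂, hLe⟩ := exists_euler_solution (σ := L.l) hB (by exact_mod_cast Nat.pos_of_ne_zero hl)
  have hL₁ : DifferentiableOn ℂ (fun t => M t * (q t)⁻¹) (Metric.ball 0 L.ρ) := hM.mul (hq.inv hq0)
  refine ⟨fun z => L.coord z ^ ((L.l : ℤ) - L.κ) * (M (L.coord z) * (q (L.coord z))⁻¹) * P.fsqrt j z +
    L.ε * (L.coord z ^ (L.l : ℤ) * L₂ (L.coord z)), fun z hz => ?_, ?_⟩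
  · have hm := L.coord_mem_ball hz
    have hmn := Metric.isOpen_ball.mem_nhds hm
    refine (((L.hasDerivAt_comp_coord hL₁ (L.l - L.κ) hz).fun_mul (L.hasDerivAt_fsqrt hz)).fun_add
      ((L.hasDerivAt_comp_coord hL₂ L.l hz).const_mul L.ε)).congr_deriv ?_
    have hd : deriv (fun t => M t * (q t)⁻¹) (L.coord z) = deriv M (L.coord z) * (q (L.coord z))⁻¹ +
        M (L.coord z) * (-deriv q (L.coord z) / q (L.coord z) ^ 2) :=
      ((hM.differentiableAt hmn).hasDerivAt.fun_mul
        ((hq.differentiableAt hmn).hasDerivAt.fun_inv (hq0 _ hm))).deriv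
    have ha : deriv L.a (L.coord z) = 2 * q (L.coord z) * deriv q (L.coord z) := by
      have : L.a =ᶠ[𝓝 (L.coord z)] fun t => q t ^ 2 :=
        eventually_of_mem hmn fun t ht => (hqa t ht).symm
      rw [this.deriv_eq, ((hq.differentiableAt hmn).hasDerivAt.fun_pow 2).deriv]
      simp
    have e1 := hMe _ hm
    have e2 := hLe _ hm
    have hq1 := hq0 _ hm
    have h0 := P.fsqrt_ne hz.1
    have hε := L.ε_sq
    have h5 : L.coord z ^ L.κ = L.root j z * P.fsqrt j z := by rw [root]; field_simp
    have h6 := zpow_ne_zero L.κ hz.2.1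
    rw [hd, ha, ← hqa _ hm, h z hz, add_sub_cancel, zpow_add₀ hz.2.1, zpow_sub₀ hz.2.1, zpow_natCast]
    rw [Pi.mul_apply] at e1
    push_cast at e1 e2 ⊢
    have e3 : L.coord z * deriv M (L.coord z) = L.ε * (A (L.coord z) * q (L.coord z)) -
      (L.l - L.μ / 2) * M (L.coord z) := by linear_combination e1
    have e4 : L.coord z * deriv L₂ (L.coord z) = B (L.coord z) - L.l * L₂ (L.coord z) := by
      linear_combination e2
    rw [e4]
    have e5 : L.root j z = L.coord z ^ L.κ / P.fsqrt j z := rfl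
    rw [e5]
    field_simp
    linear_combination (2 * q (L.coord z) * P.fsqrt j z * L.ε * L.coord z ^ L.l) * e3 +
      (2 * q (L.coord z) ^ 2 * L.coord z ^ L.l * (A (L.coord z) * P.fsqrt j z +
        L.coord z ^ L.κ * B (L.coord z))) * hε
  · have h1 : Tendsto (fun z => L.ε * (L.coord z ^ (L.l : ℤ) * L₂ (L.coord z))) (L.near j) (𝓝 0) := by
      have := (L.tendsto_comp_coord (j := j) ((hp L.l).mul hL₂)).const_mul L.ε
      simpa [hl] using this
    have h2 : Tendsto (fun z => L.coord z ^ ((L.l : ℤ) - L.κ) * (M (L.coord z) * (q (L.coord z))⁻¹) *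
        P.fsqrt j z) (L.near j) (𝓝 0) := by
      refine tendsto_zero_of_sq ?_
      have hn : 2 * L.l - L.μ ≠ 0 := by have := L.μ_lt; omega
      have : Tendsto (fun z => L.coord z ^ (2 * L.l - L.μ) * M (L.coord z) ^ 2) (L.near j) (𝓝 0) := by
        simpa [hn] using L.tendsto_comp_coord (j := j) ((hp (2 * L.l - L.μ)).mul (hM.pow 2))
      refine this.congr' (L.eventually_near.mono fun z hz => ?_)
      have hm := L.coord_mem_ball hz
      have hq1 := hq0 _ hm
      have e : (L.coord z ^ ((L.l : ℤ) - L.κ)) ^ 2 * L.coord z ^ (2 * L.κ - L.μ) =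
          L.coord z ^ (2 * L.l - L.μ) := by
        rw [← zpow_natCast, ← zpow_mul, ← zpow_add₀ hz.2.1, ← zpow_natCast]
        congr 1
        have := L.μ_lt
        push_cast [this.le]
        ring
      beta_reduce
      rw [mul_pow, mul_pow, L.fsqrt_sq hz, ← hqa _ hm, ← e]
      field_simp
    simpa using h2.add h1

end LocalForm

theorem RefPoint.tendsto_F (h : r.Reaches c) {s : ℕ} (hs : 1 ≤ s) :
    Tendsto (fun t => P.F j s (c t)) (𝓝[>] 0) (𝓝 0) := by
  obtain ⟨L⟩ := r.exists_localForm
  exact ((L.regular_F hs).tendsto).comp (LocalForm.tendsto_near h)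

/-- The limits `Ê_s(z^{(j)})` exist and do not depend on the curve. -/
theorem RefPoint.exists_tendsto_E (r : P.RefPoint j) {E : ℕ → ℂ → ℂ} (hE : P.IsEhat j E) :
    ∃ e : ℕ → ℂ, ∀ s, 1 ≤ s → ∀ c, r.Reaches c → Tendsto (E s ∘ c) (𝓝[>] 0) (𝓝 (e s)) := by
  obtain ⟨L⟩ := r.exists_localForm
  have : ∀ s, ∃ e : ℂ, 1 ≤ s → ∀ c, r.Reaches c → Tendsto (E s ∘ c) (𝓝[>] 0) (𝓝 e) := by
    intro s
    by_cases hex : 1 ≤ s ∧ ∃ c₀, r.Reaches c₀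
    swap
    · exact ⟨0, fun hs c hc => absurd ⟨hs, c, hc⟩ hex⟩
    obtain ⟨hs, c₀, hc₀⟩ := hex
    obtain ⟨G, hG, hG0⟩ := (L.regular_F (j := j) hs).exists_primitive
    have hN := L.mem_sphereNhds j L.ρ_pos
    -- E_s differs from the primitive `G`, which vanishes at the end, by a locally constant
    -- function. Curves that can be joined near the end see the same constant, and this constant is
    -- the limit of E_s.
    have hd : ∀ z ∈ L.dom j L.ρ, HasDerivAt (fun z => E s z - G z) 0 z := fun z hz =>
      ((hE.hasDerivAt hs hz.1).fun_sub (hG z hz)).congr_deriv (sub_self _)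
    have hj : ∀ c c', r.Reaches c → r.Reaches c' → ∀ᶠ q : ℝ × ℝ in 𝓝[>] 0 ×ˢ 𝓝[>] 0,
        E s (c q.1) - G (c q.1) = E s (c' q.2) - G (c' q.2) := fun c c' h h' =>
      (h.joined h' hN).mono fun q hq =>
        (L.isOpen_dom L.ρ).eq_of_joinedIn hd (hq.mono fun z hz => hz.1 hz.2)
    obtain ⟨pa, hpa, pb, hpb, hp⟩ := eventually_prod_iff.1 (hj c₀ c₀ hc₀ hc₀)
    obtain ⟨t₀, ht₀⟩ := hpa.exists
    refine ⟨E s (c₀ t₀) - G (c₀ t₀), fun _ c hc => ?_⟩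
    obtain ⟨pa', hpa', pb', hpb', hp'⟩ := eventually_prod_iff.1 (hj c c₀ hc hc₀)
    obtain ⟨t₁, ht₁⟩ := (hpb.and hpb').exists
    have h1 : Tendsto (fun t => E s (c₀ t₀) - G (c₀ t₀) + G (c t)) (𝓝[>] 0)
        (𝓝 (E s (c₀ t₀) - G (c₀ t₀) + 0)) := (hG0.comp (LocalForm.tendsto_near hc)).const_add _
    rw [add_zero] at h1
    refine h1.congr' (hpa'.mono fun t ht => ?_)
    have e1 := hp ht₀ ht₁.1
    have e2 := hp' ht ht₁.2
    simp only [Function.comp_apply] at *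
    rw [e1, ← e2]; ring
  choose e he using this
  exact ⟨e, fun s hs => he s hs⟩

end LiouvilleGreen.TurningPointProblem

end

/-! ### Convergence of the integrals -/

noncomputable section

open MeasureTheory

namespace LiouvilleGreen.TurningPointProblem

variable {P : TurningPointProblem} {j : SignType} {r : P.RefPoint j} {c : ℝ → ℂ} {z : ℂ}

namespace LocalForm

variable {pt : OnePoint ℂ} (L : LocalForm P pt)

theorem exists_norm_le {A : ℂ → ℂ} (hA : DifferentiableOn ℂ A (Metric.ball 0 L.ρ)) :
    ∃ C, 0 ≤ C ∧ ∀ t ∈ Metric.ball (0 : ℂ) (min (L.ρ / 2) 1), ‖A t‖ ≤ C := by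
  have hsub : Metric.closedBall (0 : ℂ) (L.ρ / 2) ⊆ Metric.ball 0 L.ρ :=
    Metric.closedBall_subset_ball (half_lt_self L.ρ_pos)
  obtain ⟨C, hC⟩ := (isCompact_closedBall (0 : ℂ) (L.ρ / 2)).exists_bound_of_continuousOn
    (hA.continuousOn.mono hsub)
  refine ⟨|C|, abs_nonneg C, fun t ht => (hC t ?_).trans (le_abs_self C)⟩
  exact Metric.ball_subset_closedBall (Metric.ball_subset_ball (min_le_left _ _) ht)

theorem dom_min_subset : L.dom j (min (L.ρ / 2) 1) ⊆ L.dom j L.ρ :=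
  L.dom_mono ((min_le_left _ _).trans (half_le_self L.ρ_pos.le))

variable {L} {H : ℂ → ℂ}

/-- Squaring turns f into an integral power of t and avoids its branches; `root` is bounded because
|t| ≤ 1. -/
theorem Regular.norm_sq_le (h : L.Regular j H) : ∃ C, 0 ≤ C ∧ ∀ z ∈ L.dom j (min (L.ρ / 2) 1),
    ‖H z * P.fsqrt j z‖ ^ 2 ≤ C * ‖L.coord z‖ ^ (2 * (L.l : ℤ) + 2 * L.κ - L.μ) := by
  obtain ⟨A, B, hA, hB, h⟩ := h
  obtain ⟨CA, hCA0, hCA⟩ := L.exists_norm_le hA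
  obtain ⟨CB, hCB0, hCB⟩ := L.exists_norm_le hB
  obtain ⟨Ca, hCa0, hCa⟩ := L.exists_norm_le L.differentiableOn_a
  obtain ⟨Ci, hCi0, hCi⟩ := L.exists_norm_le (L.differentiableOn_a.inv L.a_ne)
  refine ⟨Ca * (CA + (1 + Ci) * CB) ^ 2, by positivity, fun z hz => ?_⟩
  have hm := L.coord_mem_ball hz
  have hz' := L.dom_min_subset hz
  have hroot : ‖L.root j z‖ ≤ 1 + Ci := by
    have h1 : ‖L.root j z‖ ^ 2 ≤ Ci := by
      rw [← norm_pow, L.root_sq hz', norm_mul, norm_pow]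
      have : ‖L.coord z‖ ^ L.μ ≤ 1 := pow_le_one₀ (norm_nonneg _) (hz.2.2.le.trans (min_le_right _ _))
      calc _ ≤ 1 * Ci := mul_le_mul this (hCi _ hm) (norm_nonneg _) zero_le_one
        _ = Ci := one_mul _
    nlinarith [norm_nonneg (L.root j z)]
  have hAB : ‖A (L.coord z) + L.root j z * B (L.coord z)‖ ≤ CA + (1 + Ci) * CB := by
    refine (norm_add_le _ _).trans (add_le_add (hCA _ hm) ?_)
    rw [norm_mul]
    exact mul_le_mul hroot (hCB _ hm) (norm_nonneg _) (by positivity)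
  have e : ‖H z * P.fsqrt j z‖ ^ 2 = ‖L.coord z‖ ^ (2 * (L.l : ℤ) + 2 * L.κ - L.μ) *
      (‖L.a (L.coord z)‖ * ‖A (L.coord z) + L.root j z * B (L.coord z)‖ ^ 2) := by
    rw [h z hz', ← norm_pow, mul_pow, L.fsqrt_sq hz', mul_pow, add_sub_assoc,
      zpow_add₀ (norm_ne_zero_iff.2 hz.2.1), ← norm_zpow, ← norm_zpow, ← norm_pow, ← norm_mul, ← norm_mul,
      ← norm_mul, ← pow_mul, mul_comm L.l 2, ← zpow_natCast (L.coord z) (2 * L.l)]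
    congr 1
    push_cast
    ring
  rw [e, mul_comm]
  gcongr
  exact hCa _ hm

end LocalForm

/-- The integrals converge for paths that are regular up to their initial point. -/
theorem pathInt_lt_top {L : LocalForm P r.pt} {H : ℂ → ℂ} (hH : L.Regular j H)
    (hHc : ContinuousOn H (P.slit j)) (hc : r.IsProgressivePath c z) (hs : r.RegularAtStart c) :
    pathInt (fun t => H t * P.fsqrt j t) c < ∞ := by
  obtain ⟨C, hC0, hC⟩ := hH.norm_sq_le
  obtain ⟨δ, b, hδ, hb, hb0, hbd, hbc⟩ := hs
  have hbc' : ∀ t ∈ Ioc 0 δ, b t = L.coord (c t) := by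
    rcases hbc with ⟨h1, h2⟩ | ⟨w, h1, h2⟩
    · rcases L.coord_eq with ⟨-, h3⟩ | ⟨w', h3, -⟩
      · intro t ht; rw [h2 t ht, h3]
      · rw [h1] at h3; exact absurd h3.symm (OnePoint.coe_ne_infty _)
    · rcases L.coord_eq with ⟨h3, -⟩ | ⟨w', h3, h4⟩
      · rw [h1] at h3; exact absurd h3 (OnePoint.coe_ne_infty _)
      · have : w = w' := OnePoint.coe_injective (h1.symm.trans h3)
        intro t ht; rw [h2 t ht, h4, this]
  set d := derivWithin b (Icc 0 δ) 0 with hd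
  have hdn : 0 < ‖d‖ := norm_pos_iff.2 hbd
  have hder0 : HasDerivWithinAt b d (Icc 0 δ) 0 :=
    (hb.differentiableOn (by norm_num) 0 ⟨le_rfl, hδ.le⟩).hasDerivWithinAt
  -- The nonzero initial derivative makes the local coordinate comparable with the parameter of the
  -- path.
  have hlow : ∀ᶠ t in 𝓝[>] (0 : ℝ), ‖d‖ / 2 * t ≤ ‖b t‖ := by
    have h1 := hder0.isLittleO.bound (half_pos hdn)
    have h2 : 𝓝[>] (0 : ℝ) ≤ 𝓝[Icc 0 δ] 0 := by
      rw [← nhdsWithin_Ioc_eq_nhdsGT hδ]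
      exact nhdsWithin_mono _ Ioc_subset_Icc_self
    filter_upwards [h2 h1, self_mem_nhdsWithin] with t ht ht0
    have ht0' : 0 < t := ht0
    simp only [hb0, sub_zero, Real.norm_eq_abs, abs_of_pos ht0', real_smul] at ht
    have h3 : ‖(t : ℂ) * d‖ = t * ‖d‖ := by rw [norm_mul, Complex.norm_real, Real.norm_eq_abs, abs_of_pos ht0']
    have h4 := norm_sub_norm_le ((t : ℂ) * d) (b t)
    rw [norm_sub_rev] at h4
    linarith
  have hdom : ∀ᶠ t in 𝓝[>] (0 : ℝ), c t ∈ L.dom j (min (L.ρ / 2) 1) :=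
    (hc.reaches.eventually_mem (L.mem_sphereNhds j (by have := L.ρ_pos; positivity))).mono
      fun t ht => ht.1 ht.2
  obtain ⟨δ₁, hδ₁, h₁⟩ := mem_nhdsGT_iff_exists_Ioo_subset.1 (hlow.and hdom)
  obtain ⟨K, hK⟩ := (isCompact_Icc (a := 0) (b := δ)).exists_bound_of_continuousOn
    (hb.continuousOn_derivWithin (uniqueDiffOn_Icc hδ) (by norm_num))
  set δ₂ := min (min δ δ₁) 1 with hδ₂
  have hδ₂0 : 0 < δ₂ := lt_min (lt_min hδ hδ₁) one_pos
  have hδ₂1 : δ₂ ≤ 1 := min_le_right _ _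
  -- In the local coordinate y = `b t` the integrand is of order |y|^{l-μ/2-1}. Since 2l - μ ≥ 1
  -- this is O(|y|^{-1/2}), hence O(t^{-1/2}), which is integrable.
  have hnear : ∀ t ∈ Ioo 0 δ₂, ‖(H (c t) * P.fsqrt j (c t)) * deriv c t‖ ≤
      Real.sqrt (C * (K ^ 2 * (2 / ‖d‖))) * t ^ (-(1 / 2) : ℝ) := by
    intro t ht
    have htδ : t < δ := ht.2.trans_le ((min_le_left _ _).trans (min_le_left _ _))
    obtain ⟨hl, hm⟩ := h₁ ⟨ht.1, ht.2.trans_le ((min_le_left _ _).trans (min_le_right _ _))⟩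
    have hne := hm.2.1
    have hbt := hbc' t ⟨ht.1, htδ.le⟩
    have hbD : HasDerivAt b (derivWithin b (Icc 0 δ) t) t :=
      (hb.differentiableOn (by norm_num) t ⟨ht.1.le, htδ.le⟩).hasDerivWithinAt.hasDerivAt
        (Icc_mem_nhds ht.1 htδ)
    have hcD : HasDerivAt c (derivWithin b (Icc 0 δ) t * (L.ε * L.coord (c t) ^ (1 + L.κ))⁻¹) t := by
      have h0 : HasDerivAt L.param (L.ε * L.coord (c t) ^ (1 + L.κ))⁻¹ (b t) := by
        rw [hbt]; exact L.hasDerivAt_param (L.coord (c t)) hne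
      have h1 := h0.scomp t hbD
      rw [smul_eq_mul] at h1
      refine h1.congr_of_eventuallyEq ?_
      have h2 : ∀ᶠ s in 𝓝 t, s ∈ Ioo 0 δ₂ := isOpen_Ioo.mem_nhds ht
      filter_upwards [h2] with s hs
      have hsδ : s < δ := hs.2.trans_le ((min_le_left _ _).trans (min_le_left _ _))
      obtain ⟨-, hm'⟩ := h₁ ⟨hs.1, hs.2.trans_le ((min_le_left _ _).trans (min_le_right _ _))⟩
      rw [Function.comp_apply, hbc' s ⟨hs.1, hsδ.le⟩, L.param_coord _ hm'.2.1]
    have hε : ‖L.ε‖ = 1 := by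
      have : ‖L.ε‖ ^ 2 = 1 := by rw [← norm_pow, L.ε_sq, norm_one]
      exact (pow_eq_one_iff_of_nonneg (norm_nonneg _) two_ne_zero).1 this
    have hbpos : 0 < ‖L.coord (c t)‖ := norm_pos_iff.2 hne
    have hlt1 : ‖L.coord (c t)‖ ≤ 1 := hm.2.2.le.trans (min_le_right _ _)
    have hμ := L.μ_lt
    have hsq : ‖(H (c t) * P.fsqrt j (c t)) * deriv c t‖ ^ 2 ≤ (C * (K ^ 2 * (2 / ‖d‖))) * t⁻¹ := by
      rw [hcD.deriv, norm_mul, mul_pow, norm_mul (derivWithin _ _ _), norm_inv, norm_mul L.ε, hε, one_mul,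
        norm_zpow, mul_pow]
      have e1 : (‖L.coord (c t)‖ ^ (1 + L.κ))⁻¹ ^ 2 = ‖L.coord (c t)‖ ^ (-2 - 2 * L.κ) := by
        rw [← zpow_neg, ← zpow_natCast, ← zpow_mul]; congr 1; push_cast; ring
      have e2 : ‖L.coord (c t)‖ ^ (2 * (L.l : ℤ) + 2 * L.κ - L.μ) * ‖L.coord (c t)‖ ^ (-2 - 2 * L.κ) =
          ‖L.coord (c t)‖ ^ (2 * L.l - L.μ - 1) * ‖L.coord (c t)‖⁻¹ := by
        rw [← zpow_add₀ hbpos.ne', ← zpow_neg_one, ← zpow_natCast, ← zpow_add₀ hbpos.ne']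
        congr 1
        omega
      rw [e1]
      calc _ ≤ (C * ‖L.coord (c t)‖ ^ (2 * (L.l : ℤ) + 2 * L.κ - L.μ)) *
            (K ^ 2 * ‖L.coord (c t)‖ ^ (-2 - 2 * L.κ)) := by
              gcongr
              · exact hC _ hm
              · exact hK t ⟨ht.1.le, htδ.le⟩
        _ = C * K ^ 2 * (‖L.coord (c t)‖ ^ (2 * L.l - L.μ - 1) * ‖L.coord (c t)‖⁻¹) := by rw [← e2]; ring
        _ ≤ C * K ^ 2 * (1 * (‖d‖ / 2 * t)⁻¹) := by
              rw [← hbt] at hlt1 ⊢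
              have := ht.1
              gcongr
              exact pow_le_one₀ (norm_nonneg _) hlt1
        _ = _ := by field_simp
    have h3 : t ^ (-(1 / 2) : ℝ) = Real.sqrt t⁻¹ := by
      rw [Real.sqrt_eq_rpow, Real.inv_rpow ht.1.le, Real.rpow_neg ht.1.le]
    rw [h3, ← Real.sqrt_mul (by positivity)]
    exact Real.le_sqrt_of_sq_le hsq
  have hm : AEStronglyMeasurable (fun t => H (c t) * P.fsqrt j (c t) * deriv c t)
      (volume.restrict (Ioc (0 : ℝ) 1)) :=
    aemeasurable_comp_mul_deriv (h := fun t => H t * P.fsqrt j t) hc (hHc.mul (P.continuousOn_fsqrt j))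
  have hI1 : IntegrableOn (fun t => H (c t) * P.fsqrt j (c t) * deriv c t) (Ioo 0 δ₂) volume := by
    have hI : IntervalIntegrable (fun t : ℝ => Real.sqrt (C * (K ^ 2 * (2 / ‖d‖))) * t ^ (-(1 / 2) : ℝ))
        volume 0 δ₂ := (intervalIntegral.intervalIntegrable_rpow' (by norm_num)).const_mul _
    rw [intervalIntegrable_iff_integrableOn_Ioo_of_le hδ₂0.le] at hI
    have hsub : Ioo 0 δ₂ ⊆ Ioc (0 : ℝ) 1 := fun t ht => ⟨ht.1, ht.2.le.trans hδ₂1⟩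
    refine Integrable.mono' hI (hm.mono_set hsub) ?_
    filter_upwards [ae_restrict_mem measurableSet_Ioo] with t ht
    exact hnear t ht
  obtain ⟨N, τ, h0, hN, hτ'⟩ := hc.chain
  have hI2 : IntervalIntegrable (fun t => H (c t) * P.fsqrt j (c t) * deriv c t) volume δ₂ 1 := by
    have hsub : Icc δ₂ 1 ⊆ Ioc (0 : ℝ) 1 := fun t ht => ⟨hδ₂0.trans_le ht.1, ht.2⟩
    refine (chain_intervalIntegrable h0 hN (fun i hi => ⟨(hτ' i hi).1, (hτ' i hi).2.1⟩)
      hδ₂0 hδ₂1).continuousOn_mul ?_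
    rw [uIcc_of_le hδ₂1]
    have hcc := hc.continuousOn.mono hsub
    have hm : MapsTo c (Icc δ₂ 1) (P.slit j) := fun t ht => hc.mem t (hsub ht)
    exact (hHc.comp hcc hm).mul ((P.continuousOn_fsqrt j).comp hcc hm)
  have hI : IntegrableOn (fun t => H (c t) * P.fsqrt j (c t) * deriv c t) (Ioc 0 1) volume := by
    rw [← Ioc_union_Ioc_eq_Ioc hδ₂0.le hδ₂1]
    exact ((integrableOn_Ioc_iff_integrableOn_Ioo).2 hI1).union
      ((intervalIntegrable_iff_integrableOn_Ioc_of_le hδ₂1).1 hI2)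
  exact hI.2

theorem omega_varpi_lt_top (hc : r.IsProgressivePath c z) (hs : r.RegularAtStart c) {n : ℕ} (hn : 1 ≤ n) :
    P.omega j n c < ∞ ∧ P.varpi j n c < ∞ := by
  obtain ⟨L⟩ := r.exists_localForm
  have hu : ∀ s : ℕ, (‖P.u‖ₑ ^ s)⁻¹ < ∞ := fun s => by
    rw [ENNReal.inv_lt_top]
    exact ENNReal.pow_pos (by simp [P.u_ne_zero]) s
  have hF : ∀ s, 1 ≤ s → pathInt (fun t => P.F j s t * P.fsqrt j t) c < ∞ := fun s hs' =>
    pathInt_lt_top (L.regular_F hs') (P.continuousOn_F j s) hc hs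
  refine ⟨ENNReal.add_lt_top.2 ⟨ENNReal.mul_lt_top (by simp) (hF n hn), ENNReal.sum_lt_top.2 fun s hs' => ?_⟩,
    ENNReal.mul_lt_top (by simp) (ENNReal.sum_lt_top.2 fun s _ => ENNReal.mul_lt_top (hu s) (hF _ (by omega)))⟩
  rw [Finset.mem_Icc] at hs'
  refine ENNReal.mul_lt_top (hu s) (pathInt_lt_top (L := L)
    (H := fun t => ∑ k ∈ Finset.Icc s (n - 1), P.F j k t * P.F j (s + n - k - 1) t) ?_ ?_ hc hs)
  · refine LocalForm.Regular.sum fun k hk => ?_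
    rw [Finset.mem_Icc] at hk
    exact (L.regular_F (by omega)).mul (L.regular_F (by omega))
  · exact continuousOn_finsetSum _ fun k _ => (P.continuousOn_F j k).mul (P.continuousOn_F j _)

end LiouvilleGreen.TurningPointProblem

end

/-! ### Recessive solutions as limits of solutions normalized far away -/

noncomputable section

open MeasureTheory

section RelativeSystem

/-- The system `a' = q b`, `b' = q (2 b + φ a)` for the relative error `a` of a Liouville-Green
approximation with exponent `X`, `X' = q`. -/
def relSystem (q φ : ℂ → ℂ) (s : ℂ) : ℂ × ℂ →L[ℂ] ℂ × ℂ :=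
  q s • ((ContinuousLinearMap.inl ℂ ℂ ℂ).comp (ContinuousLinearMap.snd ℂ ℂ ℂ) +
    (ContinuousLinearMap.inr ℂ ℂ ℂ).comp ((2 : ℂ) • ContinuousLinearMap.snd ℂ ℂ ℂ +
      φ s • ContinuousLinearMap.fst ℂ ℂ ℂ))

theorem relSystem_apply (q φ : ℂ → ℂ) (s : ℂ) (v : ℂ × ℂ) :
    relSystem q φ s v = (q s * v.2, q s * (2 * v.2 + φ s * v.1)) := by
  simp [relSystem, mul_add]

variable {q φ X : ℂ → ℂ} {U : Set ℂ}

theorem differentiableOn_relSystem (hq : DifferentiableOn ℂ q U) (hφ : DifferentiableOn ℂ φ U) :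
    DifferentiableOn ℂ (relSystem q φ) U := by
  intro s hs
  have h1 : DifferentiableWithinAt ℂ (fun s => φ s • ContinuousLinearMap.fst ℂ ℂ ℂ) U s :=
    (hφ s hs).smul_const _
  have h2 : DifferentiableWithinAt ℂ (fun s => (ContinuousLinearMap.inr ℂ ℂ ℂ).comp
      ((2 : ℂ) • ContinuousLinearMap.snd ℂ ℂ ℂ + φ s • ContinuousLinearMap.fst ℂ ℂ ℂ)) U s :=
    (differentiableWithinAt_const _).clm_comp ((differentiableWithinAt_const _).add h1)
  exact (hq s hs).smul ((differentiableWithinAt_const _).add h2)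

/-- A path from `p` to `s` in `U` along which `Re X` does not increase, and on which the total
variation `∫ |φ dX|` is at most `g`. -/
def DescentPath (q φ : ℂ → ℂ) (U : Set ℂ) (p s : ℂ) (g : ℝ) : Prop :=
  ∃ (γ γ' : ℝ → ℂ) (K K' : ℝ → ℝ), γ 0 = p ∧ γ 1 = s ∧
    (∀ t ∈ Icc (0 : ℝ) 1, γ t ∈ U ∧ HasDerivAt γ (γ' t) t ∧ (q (γ t) * γ' t).re ≤ 0 ∧
      HasDerivAt K (K' t) t ∧ ‖φ (γ t) * (q (γ t) * γ' t)‖ ≤ K' t) ∧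
    ContinuousOn γ' (Icc 0 1) ∧ ContinuousOn K' (Icc 0 1) ∧ K 1 - K 0 ≤ g

/-- This is `error_bound` for the empty expansion (h = 0, R = -φ), with zero initial error at `p`.
-/
theorem DescentPath.bound (hq : DifferentiableOn ℂ q U) (hφ : DifferentiableOn ℂ φ U)
    (hX : ∀ s ∈ U, HasDerivAt X (q s) s) {V : ℂ → ℂ × ℂ} (hV : SolvesOn (relSystem q φ) V U)
    {p s : ℂ} {g : ℝ} (h : DescentPath q φ U p s g) (hp : V p = (1, 0)) :
    ‖V s - (1, 0)‖ ≤ g * Real.exp g := by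
  obtain ⟨γ, γ', K, K', h0, h1, hγ, hγ', hK', hg⟩ := h
  have hV1 : ∀ y ∈ U, HasDerivAt (fun z => (V z).1) (q y * (V y).2) y := fun y hy => by
    refine ((ContinuousLinearMap.fst ℂ ℂ ℂ).hasFDerivAt.comp_hasDerivAt y (hV y hy)).congr_deriv ?_
    simp [relSystem_apply]
  have hV2 : ∀ y ∈ U, HasDerivAt (fun z => (V z).2) (q y * (2 * (V y).2 + φ y * (V y).1)) y := fun y hy => by
    refine ((ContinuousLinearMap.snd ℂ ℂ ℂ).hasFDerivAt.comp_hasDerivAt y (hV y hy)).congr_deriv ?_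
    simp [relSystem_apply]
  have hder : ∀ {f f' : ℂ → ℂ}, (∀ y ∈ U, HasDerivAt f (f' y) y) →
      ∀ t ∈ Icc (0 : ℝ) 1, HasDerivAt (fun t => f (γ t)) (γ' t * f' (γ t)) t := fun hf t ht => by
    simpa [Function.comp_def] using (hf (γ t) (hγ t ht).1).scomp t (hγ t ht).2.1
  have hcγ : ContinuousOn γ (Icc 0 1) := fun t ht => (hγ t ht).2.1.continuousAt.continuousWithinAt
  have hm : MapsTo γ (Icc 0 1) U := fun t ht => (hγ t ht).1
  have hqc : ContinuousOn (fun t => q (γ t)) (Icc 0 1) := hq.continuousOn.comp hcγ hm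
  have hφc : ContinuousOn (fun t => φ (γ t)) (Icc 0 1) := hφ.continuousOn.comp hcγ hm
  have hc : ∀ {f f' : ℂ → ℂ}, (∀ y ∈ U, HasDerivAt f (f' y) y) → ContinuousOn (fun t => f (γ t)) (Icc 0 1) :=
    fun hf t ht => (hder hf t ht).continuousAt.continuousWithinAt
  have hqγ : ContinuousOn (fun t => q (γ t) * γ' t) (Icc 0 1) := hqc.mul hγ'
  have hqγi : IntervalIntegrable (fun t => q (γ t) * γ' t) volume 0 1 :=
    ContinuousOn.intervalIntegrable (by rwa [uIcc_of_le zero_le_one])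
  have hIc : ContinuousOn (fun t => ‖φ (γ t) * (q (γ t) * γ' t)‖) (Icc 0 1) := (hφc.mul hqγ).norm
  have hKI : ∫ t in (0 : ℝ)..1, ‖φ (γ t) * (q (γ t) * γ' t)‖ ≤ g := by
    calc _ ≤ ∫ t in (0 : ℝ)..1, K' t :=
          intervalIntegral.integral_mono_on zero_le_one
            (ContinuousOn.intervalIntegrable (by rwa [uIcc_of_le zero_le_one]))
            (ContinuousOn.intervalIntegrable (by rwa [uIcc_of_le zero_le_one]))
            fun t ht => (hγ t ht).2.2.2.2
      _ = K 1 - K 0 := intervalIntegral.integral_eq_sub_of_hasDerivAt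
            (fun t ht => (hγ t (by rwa [uIcc_of_le zero_le_one] at ht)).2.2.2.1)
            (ContinuousOn.intervalIntegrable (by rwa [uIcc_of_le zero_le_one]))
      _ ≤ g := hg
  have hI0 : 0 ≤ ∫ t in (0 : ℝ)..1, ‖φ (γ t) * (q (γ t) * γ' t)‖ :=
    intervalIntegral.integral_nonneg zero_le_one fun t _ => norm_nonneg _
  have hanti : AntitoneOn (fun t => (X (γ t)).re) (Icc 0 1) := by
    have hd : ∀ t ∈ Icc (0 : ℝ) 1, HasDerivAt (fun t => (X (γ t)).re) (q (γ t) * γ' t).re t := fun t ht => by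
      have := (Complex.reCLM.hasFDerivAt.comp_hasDerivAt t (hder hX t ht))
      exact this.congr_deriv (by simp [mul_comm (γ' t)])
    refine antitoneOn_of_deriv_nonpos (convex_Icc 0 1)
      (fun t ht => (hd t ht).continuousAt.continuousWithinAt)
      (fun t ht => (hd t (interior_subset ht)).differentiableAt.differentiableWithinAt) fun t ht => ?_
    rw [(hd t (interior_subset ht)).deriv]
    exact (hγ t (interior_subset ht)).2.2.1
  have hoc : Ioo (0 : ℝ) 1 \ ∅ ⊆ Icc 0 1 := fun t ht => Ioo_subset_Icc_self ht.1
  obtain ⟨e1, e2⟩ := error_bound zero_le_one countable_empty (x := fun t => X (γ t))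
    (x' := fun t => q (γ t) * γ' t) (η := fun t => (V (γ t)).1 - 1) (b := fun t => (V (γ t)).2)
    (h := fun _ => 0) (R := fun t => -φ (γ t)) (hc hX) ((hc hV1).sub continuousOn_const) (hc hV2)
    continuousOn_const hφc.neg
    (fun t ht => hqγ.continuousAt (Icc_mem_nhds ht.1.1 ht.1.2)) hqγi
    (fun t ht => (hder hX t (hoc ht)).congr_deriv (mul_comm _ _))
    (fun t ht => ((hder hV1 t (hoc ht)).sub_const 1).congr_deriv (by ring))
    (fun t ht => (hder hV2 t (hoc ht)).congr_deriv (by ring)) hanti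
  simp only [h0, h1, hp, sub_self, norm_zero, zero_add, mul_zero, neg_mul, norm_neg, ← norm_mul] at e1 e2
  have hle : (∫ t in (0 : ℝ)..1, ‖φ (γ t) * (q (γ t) * γ' t)‖) *
      Real.exp (∫ t in (0 : ℝ)..1, ‖φ (γ t) * (q (γ t) * γ' t)‖) ≤ g * Real.exp g := by
    gcongr
    exact hI0.trans hKI
  rw [Prod.norm_def, max_le_iff]
  exact ⟨e1.trans hle, by simpa using e2.trans hle⟩

/-- A solution with prescribed limit `(1, 0)`, obtained from solutions that take this value at far
away points. -/
theorem exists_recessive (hU : IsOpen U) (hUs : IsSimplyConnected U) (hq : DifferentiableOn ℂ q U)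
    (hφ : DifferentiableOn ℂ φ U) (hX : ∀ s ∈ U, HasDerivAt X (q s) s) {p : ℕ → ℂ} (hp : ∀ n, p n ∈ U)
    {S : Set ℂ} (hS : S ⊆ U) {g : ℂ → ℝ} (h : ∀ s ∈ S, ∀ᶠ n in atTop, DescentPath q φ U (p n) s (g s)) :
    ∃ V, SolvesOn (relSystem q φ) V U ∧ ∀ s ∈ S, ‖V s - (1, 0)‖ ≤ g s * Real.exp (g s) := by
  have hA := differentiableOn_relSystem hq hφ
  have hUc : IsPreconnected U := hUs.isPathConnected.isConnected.isPreconnected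
  have hex := fun {y : ℂ} (hy : y ∈ U) v => SolvesOn.exists_of_isSimplyConnected hU hUs hA hy v
  rcases S.eq_empty_or_nonempty with rfl | ⟨s₀, hs₀⟩
  · obtain ⟨V, hV, -⟩ := hex (hp 0) 0
    exact ⟨V, hV, by simp⟩
  choose V hV hVp using fun n => hex (hp n) (1, 0)
  obtain ⟨Y₁, hY₁, hY₁0⟩ := hex (hS hs₀) (1, 0)
  obtain ⟨Y₂, hY₂, hY₂0⟩ := hex (hS hs₀) (0, 1)
  have hb : ∀ s ∈ S, ∀ᶠ n in atTop, ‖V n s - (1, 0)‖ ≤ g s * Real.exp (g s) := fun s hs =>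
    (h s hs).mono fun n hn => hn.bound hq hφ hX (hV n) (hVp n)
  have hfreq : ∃ᶠ n in atTop, V n s₀ ∈ Metric.closedBall ((1 : ℂ), (0 : ℂ)) (g s₀ * Real.exp (g s₀)) :=
    ((hb s₀ hs₀).mono fun n hn => by simpa [dist_eq_norm] using hn).frequently
  -- The values at one point `s₀` stay bounded, so a subsequence of them converges. In a fundamental
  -- system normalized at `s₀` these values are the coordinates of `V n`; hence the solutions
  -- converge at every point, and the bounds pass to the limit.
  obtain ⟨v, -, ψ, hψ, hlim⟩ := tendsto_subseq_of_frequently_bounded Metric.isBounded_closedBall hfreq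
  have hcomb : ∀ w : ℂ × ℂ, SolvesOn (relSystem q φ) (fun z => w.1 • Y₁ z + w.2 • Y₂ z) U := fun w =>
    (hY₁.const_smul w.1).add (hY₂.const_smul w.2)
  refine ⟨fun z => v.1 • Y₁ z + v.2 • Y₂ z, hcomb v, fun s hs => ?_⟩
  have e : ∀ n, V n s = (V n s₀).1 • Y₁ s + (V n s₀).2 • Y₂ s := fun n =>
    SolvesOn.eqOn hU hUc hA.continuousOn (hV n) (hcomb (V n s₀)) (hS hs₀)
      (by rw [hY₁0, hY₂0]; simp) (hS hs)
  have hl : Tendsto (fun k => ‖V (ψ k) s - (1, 0)‖) atTop (𝓝 ‖v.1 • Y₁ s + v.2 • Y₂ s - (1, 0)‖) := by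
    simp only [e]
    exact (((((continuous_fst.tendsto v).comp hlim).smul_const _).add
      (((continuous_snd.tendsto v).comp hlim).smul_const _)).sub_const _).norm
  exact le_of_tendsto hl (hψ.tendsto_atTop.eventually (hb s hs))

end RelativeSystem

theorem Convex.isSimplyConnected {E : Type*} [AddCommGroup E] [Module ℝ E] [TopologicalSpace E]
    [IsTopologicalAddGroup E] [ContinuousSMul ℝ E] {U : Set E} (hU : Convex ℝ U) (hne : U.Nonempty) : IsSimplyConnected U := by
  have := hU.contractibleSpace hne
  exact (inferInstance : SimplyConnectedSpace U)

/-- A holomorphic function on a simply connected open set has a primitive. -/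
theorem DifferentiableOn.exists_primitive {U : Set ℂ} (hU : IsOpen U) (hUs : IsSimplyConnected U)
    {q : ℂ → ℂ} (hq : DifferentiableOn ℂ q U) {p : ℂ} (hp : p ∈ U) (v : ℂ) :
    ∃ X : ℂ → ℂ, (∀ s ∈ U, HasDerivAt X (q s) s) ∧ X p = v := by
  -- Integration as a linear equation: the second component is the constant 1, the first has
  -- derivative `q`.
  set A : ℂ → ℂ × ℂ →L[ℂ] ℂ × ℂ := fun s =>
    q s • (ContinuousLinearMap.inl ℂ ℂ ℂ).comp (ContinuousLinearMap.snd ℂ ℂ ℂ) with hA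
  have hAd : DifferentiableOn ℂ A U := fun s hs => (hq s hs).smul_const _
  obtain ⟨V, hV, hVp⟩ := SolvesOn.exists_of_isSimplyConnected hU hUs hAd hp (v, 1)
  have h2 : ∀ s ∈ U, HasDerivAt (fun z => (V z).2) 0 s := fun s hs => by
    refine ((ContinuousLinearMap.snd ℂ ℂ ℂ).hasFDerivAt.comp_hasDerivAt s (hV s hs)).congr_deriv ?_
    simp [hA]
  have h1 : ∀ s ∈ U, (V s).2 = 1 := fun s hs => by
    have := hU.is_const_of_deriv_eq_zero hUs.isPathConnected.isConnected.isPreconnected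
      (fun s hs => (h2 s hs).differentiableAt.differentiableWithinAt) (fun s hs => (h2 s hs).deriv) hs hp
    rw [this, hVp]
  refine ⟨fun s => (V s).1, fun s hs => ?_, by simp [hVp]⟩
  refine ((ContinuousLinearMap.fst ℂ ℂ ℂ).hasFDerivAt.comp_hasDerivAt s (hV s hs)).congr_deriv ?_
  simp [hA, h1 s hs]

end

/-! ### Ends with μ = 0, where the exponent is logarithmic in t -/

noncomputable section

/-- The left half plane `Re s < R`. -/
def leftHalfPlane (R : ℝ) : Set ℂ := {s | s.re < R}

theorem isOpen_leftHalfPlane (R : ℝ) : IsOpen (leftHalfPlane R) :=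
  isOpen_lt continuous_re continuous_const

theorem convex_leftHalfPlane (R : ℝ) : Convex ℝ (leftHalfPlane R) := convex_halfSpace_re_lt R

theorem isSimplyConnected_leftHalfPlane (R : ℝ) : IsSimplyConnected (leftHalfPlane R) :=
  (convex_leftHalfPlane R).isSimplyConnected ⟨((R - 1 : ℝ) : ℂ), by simp [leftHalfPlane]⟩

theorem exists_forall_re_lt {p : ℂ → Prop} (hp : ∀ᶠ t in 𝓝 0, p t) :
    ∃ R : ℝ, ∀ s : ℂ, s.re < R → p (exp s) := by
  obtain ⟨δ, hδ, h⟩ := Metric.eventually_nhds_iff_ball.1 hp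
  refine ⟨Real.log δ, fun s hs => h _ ?_⟩
  rw [Metric.mem_ball, dist_zero_right, norm_exp]
  exact (Real.lt_log_iff_exp_lt hδ).1 hs

theorem exists_forall_mul_exp_lt (C : ℝ) {c ε : ℝ} (hc : 0 < c) (hε : 0 < ε) :
    ∃ R : ℝ, ∀ x < R, C * Real.exp (c * x) * Real.exp (C * Real.exp (c * x)) < ε := by
  have h1 : Tendsto (fun x : ℝ => C * Real.exp (c * x)) atBot (𝓝 0) := by
    simpa using (Real.tendsto_exp_atBot.comp (tendsto_id.const_mul_atBot hc)).const_mul C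
  have h2 : Tendsto (fun x : ℝ => C * Real.exp (c * x) * Real.exp (C * Real.exp (c * x))) atBot (𝓝 0) := by
    simpa using h1.mul ((Real.continuous_exp.tendsto 0).comp h1)
  obtain ⟨R, hR⟩ := eventually_atBot.1 (h2.eventually (gt_mem_nhds hε))
  exact ⟨R, fun x hx => hR x hx.le⟩

/-- `dX/ds` near the end `t = e^s → 0`. -/
def endRate (μ : ℕ) (B : ℂ → ℂ) (s : ℂ) : ℂ := exp (-(μ / 2 * s)) * B (exp s)

/-- The potential near the end `t = e^s → 0`. -/
def endPotential (l : ℕ) (h : ℂ → ℂ) (s : ℂ) : ℂ := exp (l * s) * h (exp s)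

variable {μ l : ℕ} {B h X : ℂ → ℂ} {ρ : ℝ}

theorem exp_mem_ball (hρ : 0 < ρ) {s : ℂ} (hs : s ∈ leftHalfPlane (Real.log ρ)) :
    exp s ∈ Metric.ball (0 : ℂ) ρ := by
  rw [Metric.mem_ball, dist_zero_right, norm_exp]
  exact (Real.lt_log_iff_exp_lt hρ).1 hs

theorem differentiableOn_comp_exp (hρ : 0 < ρ) (hB : DifferentiableOn ℂ B (Metric.ball 0 ρ)) :
    DifferentiableOn ℂ (fun s => B (exp s)) (leftHalfPlane (Real.log ρ)) :=
  hB.comp differentiable_exp.differentiableOn fun _ hs => exp_mem_ball hρ hs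

theorem differentiableOn_endRate (hρ : 0 < ρ) (hB : DifferentiableOn ℂ B (Metric.ball 0 ρ)) :
    DifferentiableOn ℂ (endRate μ B) (leftHalfPlane (Real.log ρ)) :=
  (by fun_prop : Differentiable ℂ fun s : ℂ => exp (-(μ / 2 * s))).differentiableOn.mul
    (differentiableOn_comp_exp hρ hB)

theorem differentiableOn_endPotential (hρ : 0 < ρ) (hh : DifferentiableOn ℂ h (Metric.ball 0 ρ)) :
    DifferentiableOn ℂ (endPotential l h) (leftHalfPlane (Real.log ρ)) :=
  (by fun_prop : Differentiable ℂ fun s : ℂ => exp (l * s)).differentiableOn.mul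
    (differentiableOn_comp_exp hρ hh)

/-- Moving far to the left in the direction d has to increase Re(βs). This is possible at some slope
unless β is a positive number. -/
theorem exists_direction {β : ℂ} (h0 : β ≠ 0) (h : ¬ (0 < β.re ∧ β.im = 0)) :
    ∃ d : ℂ, d.re = -1 ∧ 0 < (β * d).re := by
  by_cases him : β.im = 0
  · have hre : β.re ≠ 0 := fun hre => h0 (Complex.ext hre him)
    have : β.re < 0 := lt_of_le_of_ne (not_lt.1 fun hlt => h ⟨hlt, him⟩) hre
    exact ⟨-1, by simp, by simpa using this⟩
  · refine ⟨⟨-1, -(|β.re| + 1) / β.im⟩, rfl, ?_⟩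
    rw [mul_re]
    have : β.im * (-(|β.re| + 1) / β.im) = -(|β.re| + 1) := by field_simp
    rw [this]
    linarith [le_abs_self β.re]

/-- In the logarithmic case the exponent is `β s + O(1)`. -/
theorem exists_norm_sub_le_of_log_end (hρ : 0 < ρ) (hB : DifferentiableOn ℂ B (Metric.ball 0 ρ))
    (hX : ∀ s ∈ leftHalfPlane (Real.log ρ), HasDerivAt X (endRate 0 B s) s) :
    ∃ C R : ℝ, ∀ s : ℂ, s.re < R → ‖X s - B 0 * s‖ ≤ C := by
  have hd : DifferentiableOn ℂ (dslope B 0) (Metric.ball 0 ρ) :=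
    (differentiableOn_dslope (Metric.ball_mem_nhds _ hρ)).2 hB
  -- `Q` is a primitive of (B(t) - B(0))/t, so that Q(e^s) is a primitive of B(e^s) - B(0) and stays
  -- bounded to the left.
  obtain ⟨Q, hQ⟩ := hd.isExactOn_ball
  have hQc : ContinuousAt Q 0 := (hQ 0 (Metric.mem_ball_self hρ)).continuousAt
  set H : ℂ → ℂ := fun s => X s - B 0 * s - Q (exp s) with hH
  have hder : ∀ s ∈ leftHalfPlane (Real.log ρ), HasDerivAt H 0 s := fun s hs => by
    have h1 := (hQ _ (exp_mem_ball hρ hs)).comp s (hasDerivAt_exp s)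
    refine (((hX s hs).fun_sub ((hasDerivAt_id s).const_mul (B 0))).fun_sub h1).congr_deriv ?_
    have := sub_smul_dslope B 0 (exp s)
    simp only [sub_zero, smul_eq_mul] at this
    rw [mul_comm (dslope B 0 _), this]
    simp [endRate]
  obtain ⟨R₁, hR₁⟩ := exists_forall_re_lt (hQc.norm.eventually (gt_mem_nhds (lt_add_one ‖Q 0‖)))
  obtain ⟨k, hk⟩ := (isOpen_leftHalfPlane _).exists_is_const_of_deriv_eq_zero
    (convex_leftHalfPlane (Real.log ρ)).isPreconnected
    (fun s hs => (hder s hs).differentiableAt.differentiableWithinAt) (fun s hs => (hder s hs).deriv)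
  refine ⟨‖k‖ + (‖Q 0‖ + 1), min (Real.log ρ) R₁, fun s hs => ?_⟩
  have e : X s - B 0 * s = k + Q (exp s) := by
    rw [← hk s (hs.trans_le (min_le_left _ _)), hH]; ring
  rw [e]
  exact (norm_add_le _ _).trans (by gcongr; exact (hR₁ s (hs.trans_le (min_le_right _ _))).le)

/-- The path is the straight segment from n d to s. Along it dX is nearly β (s - n d), whose real
part is negative for large n. The potential is O(e^{Re s}), so that a multiple of the exponential of
the real part serves as majorant `K`. -/
theorem descentPath_log_end {β d : ℂ} (hβ : B 0 = β) (hd1 : d.re = -1) (hd2 : 0 < (β * d).re)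
    (hB : ContinuousAt B 0) (hh : ContinuousAt h 0) (hl : 1 ≤ l) (R : ℝ) :
    ∃ C R₂ : ℝ, 0 ≤ C ∧ R₂ ≤ R ∧ ∀ s : ℂ, s.re < R₂ → ∀ᶠ n : ℕ in atTop,
      DescentPath (endRate 0 B) (endPotential l h) (leftHalfPlane R) (n * d) s
        (C * Real.exp (1 * s.re)) := by
  have hdn : 0 < ‖d‖ := norm_pos_iff.2 fun h => by simp [h] at hd1
  -- With |B - β| < δ, the error in dX uses up only half of the decrease n Re(βd).
  set δ := (β * d).re / (2 * ‖d‖) with hδ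
  have hδ0 : 0 < δ := by positivity
  obtain ⟨R₁, hR₁⟩ := exists_forall_re_lt ((Metric.tendsto_nhds.1 hB.tendsto δ hδ0).and
    (hh.norm.eventually (gt_mem_nhds (lt_add_one ‖h 0‖))))
  set R₂ := min (min R R₁) 0 with hR₂
  set C := (‖h 0‖ + 1) * (‖β‖ + δ) * (‖d‖ + 1) with hC
  refine ⟨C, R₂, by positivity, (min_le_left _ _).trans (min_le_left _ _), fun s hs => ?_⟩
  have hn : ∀ᶠ n : ℕ in atTop, -R₂ < (n : ℝ) ∧ (‖β‖ * ‖s‖ + δ * ‖s‖) ≤ n * ((β * d).re / 2) ∧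
      ‖s‖ - (‖d‖ + 1) * s.re ≤ n := by
    have h1 : ∀ x : ℝ, ∀ᶠ n : ℕ in atTop, x ≤ n := fun x => tendsto_natCast_atTop_atTop.eventually_ge_atTop x
    have h2 : ∀ x : ℝ, ∀ᶠ n : ℕ in atTop, x < n := fun x => tendsto_natCast_atTop_atTop.eventually_gt_atTop x
    filter_upwards [h2 (-R₂), h1 ((‖β‖ * ‖s‖ + δ * ‖s‖) / ((β * d).re / 2)), h1 (‖s‖ - (‖d‖ + 1) * s.re)]
      with n h3 h4 h5
    exact ⟨h3, (div_le_iff₀ (by positivity)).1 h4, h5⟩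
  filter_upwards [hn] with n ⟨hn1, hn2, hn3⟩
  set p : ℂ := n * d with hp
  have hpre : p.re = -n := by simp [hp, hd1]
  have hre : ∀ t : ℝ, (p + t * (s - p)).re = -n + t * (s.re + n) := fun t => by
    simp [hpre]
  have hnorm : ‖s - p‖ ≤ ‖s‖ + n * ‖d‖ := by
    refine (norm_sub_le _ _).trans ?_
    simp [hp]
  have hspos : 0 ≤ s.re + n ∧ ‖s - p‖ ≤ (‖d‖ + 1) * (s.re + n) := by
    have := norm_nonneg s
    have h2 := Complex.abs_re_le_norm s
    have h3 := neg_abs_le s.re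
    constructor
    · nlinarith [(min_le_right _ _ : R₂ ≤ 0)]
    · nlinarith
  refine ⟨fun t => p + t * (s - p), fun _ => s - p, fun t => C * Real.exp (-n + t * (s.re + n)),
    fun t => C * (Real.exp (-n + t * (s.re + n)) * (s.re + n)), by simp, by simp, fun t ht => ?_,
    continuousOn_const, by fun_prop, ?_⟩
  · have hlt : (p + t * (s - p)).re < R₂ := by
      rw [hre]
      rcases eq_or_lt_of_le ht.2 with h1 | h1
      · rw [h1]; linarith
      · nlinarith [ht.1]
    have hR1 : (p + t * (s - p)).re < R₁ := hlt.trans_le ((min_le_left _ _).trans (min_le_right _ _))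
    obtain ⟨hB1, hh1⟩ := hR₁ _ hR1
    rw [dist_eq_norm, hβ] at hB1
    set w := exp (p + t * (s - p)) with hw
    have hrate : endRate 0 B (p + t * (s - p)) = B w := by simp [endRate, ← hw]
    have hBn : ‖B w‖ ≤ ‖β‖ + δ := by
      calc ‖B w‖ = ‖β + (B w - β)‖ := by ring_nf
        _ ≤ _ := (norm_add_le _ _).trans (by gcongr)
    refine ⟨hlt.trans_le ((min_le_left _ _).trans (min_le_left _ _)), ?_, ?_, ?_, ?_⟩
    · simpa using ((Complex.ofRealCLM.hasDerivAt (x := t)).mul_const (s - p)).const_add p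
    · rw [hrate]
      have e1 : (B w * (s - p)).re = (β * s).re - n * (β * d).re + ((B w - β) * (s - p)).re := by
        have : B w * (s - p) = β * s - (n : ℝ) * (β * d) + (B w - β) * (s - p) := by
          rw [hp]; push_cast; ring
        rw [this, add_re, sub_re, re_ofReal_mul]
      have e2 : (β * s).re ≤ ‖β‖ * ‖s‖ := (re_le_norm _).trans (norm_mul _ _).le
      have e3 : ((B w - β) * (s - p)).re ≤ δ * (‖s‖ + n * ‖d‖) := by
        refine (re_le_norm _).trans ?_
        rw [norm_mul]
        gcongr
      have e4 : δ * (n * ‖d‖) = n * ((β * d).re / 2) := by rw [hδ]; field_simp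
      rw [e1]
      linarith
    · have h1 : HasDerivAt (fun t : ℝ => -(n : ℝ) + t * (s.re + n)) (s.re + n) t := by
        simpa using ((hasDerivAt_id t).mul_const (s.re + n)).const_add (-(n : ℝ))
      exact h1.exp.const_mul C
    · have hφ : ‖endPotential l h (p + t * (s - p))‖ ≤
          (‖h 0‖ + 1) * Real.exp (-n + t * (s.re + n)) := by
        rw [endPotential, norm_mul, mul_comm, exp_nat_mul, norm_pow, norm_exp, hre]
        have h3 : Real.exp (-n + t * (s.re + n)) ≤ 1 := by
          rw [Real.exp_le_one_iff, ← hre]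
          exact hlt.le.trans (min_le_right _ _)
        gcongr
        exact pow_le_of_le_one (Real.exp_pos _).le h3 (by omega)
      rw [hrate, norm_mul, norm_mul]
      calc _ ≤ (‖h 0‖ + 1) * Real.exp (-n + t * (s.re + n)) * ((‖β‖ + δ) * ((‖d‖ + 1) * (s.re + n))) := by
            gcongr
            exact hspos.2
        _ = _ := by rw [hC]; ring
  · have : (0 : ℝ) ≤ C * Real.exp (-n + 0 * (s.re + n)) := by positivity
    have e : -(n : ℝ) + 1 * (s.re + n) = 1 * s.re := by ring
    simp only [e]
    linarith

/-- The recessive solution at a logarithmic end. -/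
theorem exists_recessive_log_end (hρ : 0 < ρ) (hB : DifferentiableOn ℂ B (Metric.ball 0 ρ))
    (hB0 : B 0 ≠ 0) (hh : DifferentiableOn ℂ h (Metric.ball 0 ρ)) (hl : 1 ≤ l)
    (hX : ∀ s ∈ leftHalfPlane (Real.log ρ), HasDerivAt X (endRate 0 B s) s) {σ : ℝ → ℂ}
    (hσ : Tendsto (fun t => (σ t).re) (𝓝[>] 0) atBot) (hpos : ∀ᶠ t in 𝓝[>] 0, 0 ≤ (X (σ t)).re) :
    ∃ V, SolvesOn (relSystem (endRate 0 B) (endPotential l h)) V (leftHalfPlane (Real.log ρ)) ∧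
      ∀ ε > 0, ∃ R : ℝ, ∀ s : ℂ, s.re < R → ‖V s - (1, 0)‖ < ε := by
  obtain ⟨C₀, R₀, hC₀⟩ := exists_norm_sub_le_of_log_end hρ hB hX
  -- For B(0) > 0 the bound X = B(0) s + O(1) would force Re X → -∞ along σ, against Re X ≥ 0.
  have hdir : ¬ (0 < (B 0).re ∧ (B 0).im = 0) := by
    rintro ⟨h1, h2⟩
    obtain ⟨t, ht1, ht2, ht3⟩ := (hpos.and ((hσ.eventually_lt_atBot R₀).and
      (hσ.eventually_lt_atBot (-C₀ / (B 0).re)))).exists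
    have h3 := (re_le_norm _).trans (hC₀ _ ht2)
    rw [sub_re, mul_re, h2, zero_mul, sub_zero] at h3
    rw [lt_div_iff₀ h1] at ht3
    nlinarith
  obtain ⟨d, hd1, hd2⟩ := exists_direction hB0 hdir
  obtain ⟨C, R₂, hC, hR₂, hpath⟩ := descentPath_log_end rfl hd1 hd2
    (hB.differentiableAt (Metric.ball_mem_nhds _ hρ)).continuousAt
    (hh.differentiableAt (Metric.ball_mem_nhds _ hρ)).continuousAt hl (Real.log ρ)
  obtain ⟨M, hM⟩ := exists_nat_gt (-Real.log ρ)
  obtain ⟨V, hV, hVb⟩ := exists_recessive (isOpen_leftHalfPlane _) (isSimplyConnected_leftHalfPlane _)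
    (differentiableOn_endRate hρ hB) (differentiableOn_endPotential (l := l) hρ hh) hX
    (p := fun n => ((n + M : ℕ) : ℂ) * d) (fun n => by
      change (((n + M : ℕ) : ℂ) * d).re < Real.log ρ
      have : (((n + M : ℕ) : ℂ) * d).re = -(n + M) := by
        rw [← ofReal_natCast, re_ofReal_mul, hd1]; push_cast; ring
      rw [this]
      linarith [(Nat.cast_nonneg n : (0 : ℝ) ≤ n)])
    (S := leftHalfPlane R₂) (fun s hs => lt_of_lt_of_le hs hR₂)
    (fun s hs => (tendsto_add_atTop_nat M).eventually (hpath s hs))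
  refine ⟨V, hV, fun ε hε => ?_⟩
  obtain ⟨R, hR⟩ := exists_forall_mul_exp_lt C one_pos hε
  exact ⟨min R R₂, fun s hs => (hVb s (hs.trans_le (min_le_right _ _))).trans_lt
    (hR _ (hs.trans_le (min_le_left _ _)))⟩

end

/-! ### Hills and valleys of a function close to e^w -/

noncomputable section

section Hill

variable {Y b : ℂ → ℂ} {Λ δ : ℝ}

/-- If `dY/dλ` is nearly `e^λ` then `Y` is nearly `e^λ`. -/
theorem norm_sub_exp_le (hδ : 0 ≤ δ) (hY : ∀ w : ℂ, Λ < w.re → HasDerivAt Y (exp w * b w) w)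
    (hb : ∀ w : ℂ, Λ < w.re → ‖b w - 1‖ ≤ δ) {w₁ w₂ : ℂ} (h₁ : Λ < w₁.re) (h₂ : Λ < w₂.re) :
    ‖Y w₂ - Y w₁ - (exp w₂ - exp w₁)‖ ≤
      δ * (Real.exp w₁.re + Real.exp w₂.re + Real.exp w₂.re * |w₂.im - w₁.im|) := by
  set D : ℂ → ℂ := fun w => Y w - exp w with hD
  have hd : ∀ w : ℂ, Λ < w.re → HasDerivAt D (exp w * (b w - 1)) w := fun w hw =>
    ((hY w hw).fun_sub (hasDerivAt_exp w)).congr_deriv (by ring)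
  have hdn : ∀ w : ℂ, Λ < w.re → ‖exp w * (b w - 1)‖ ≤ Real.exp w.re * δ := fun w hw => by
    rw [norm_mul, norm_exp]
    gcongr
    exact hb w hw
  -- From w₁ to w₂ first horizontally, then vertically. On the horizontal part r = e^{Re w} is taken
  -- as parameter, in which the derivative of Y - e^w is bounded by δ.
  set w₃ : ℂ := w₂.re + w₁.im * I with hw₃
  have h3re : w₃.re = w₂.re := by simp [hw₃]
  have h3im : w₃.im = w₁.im := by simp [hw₃]
  have hor : ‖D w₃ - D w₁‖ ≤ δ * (Real.exp w₁.re + Real.exp w₂.re) := by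
    have hder : ∀ r ∈ Ioi (Real.exp Λ), HasDerivWithinAt (fun r : ℝ => D ((Real.log r : ℝ) + w₁.im * I))
        (exp ((Real.log r : ℝ) + w₁.im * I) * (b ((Real.log r : ℝ) + w₁.im * I) - 1) * (r⁻¹ : ℝ))
        (Ioi (Real.exp Λ)) r := fun r hr => by
      have hr0 : 0 < r := (Real.exp_pos Λ).trans hr
      have h1 : HasDerivAt (fun r : ℝ => ((Real.log r : ℝ) : ℂ) + w₁.im * I) ((r⁻¹ : ℝ) : ℂ) r :=
        (Real.hasDerivAt_log hr0.ne').ofReal_comp.add_const _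
      have h2 := (hd ((Real.log r : ℝ) + w₁.im * I) (by
        simpa using (Real.lt_log_iff_exp_lt hr0).2 hr)).scomp r h1
      rw [smul_eq_mul] at h2
      exact (h2.congr_deriv (mul_comm _ _)).hasDerivWithinAt
    have hbd : ∀ r ∈ Ioi (Real.exp Λ), ‖exp ((Real.log r : ℝ) + w₁.im * I) *
        (b ((Real.log r : ℝ) + w₁.im * I) - 1) * (r⁻¹ : ℝ)‖ ≤ δ := fun r hr => by
      have hr0 : 0 < r := (Real.exp_pos Λ).trans hr
      have hre : ((Real.log r : ℝ) + w₁.im * I : ℂ).re = Real.log r := by simp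
      have h1 := hdn ((Real.log r : ℝ) + w₁.im * I) (by
        rw [hre]; exact (Real.lt_log_iff_exp_lt hr0).2 hr)
      rw [hre, Real.exp_log hr0] at h1
      rw [norm_mul, Complex.norm_real, Real.norm_eq_abs, abs_of_pos (inv_pos.2 hr0)]
      calc _ ≤ r * δ * r⁻¹ := by gcongr
        _ = δ := by field_simp
    have hlt : ∀ {x : ℝ}, Λ < x → Real.exp x ∈ Ioi (Real.exp Λ) := fun hx => Real.exp_lt_exp.2 hx
    have := (convex_Ioi (Real.exp Λ)).norm_image_sub_le_of_norm_hasDerivWithin_le hder hbd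
      (hlt h₁) (hlt h₂)
    simp only [Real.log_exp, re_add_im] at this
    refine this.trans (mul_le_mul_of_nonneg_left ?_ hδ)
    rw [Real.norm_eq_abs]
    refine (abs_sub _ _).trans_eq ?_
    rw [abs_of_pos (Real.exp_pos _), abs_of_pos (Real.exp_pos _), add_comm]
  have hver : ‖D w₂ - D w₃‖ ≤ δ * (Real.exp w₂.re * |w₂.im - w₁.im|) := by
    have hder : ∀ θ ∈ (univ : Set ℝ), HasDerivWithinAt (fun θ : ℝ => D (w₂.re + θ * I))
        (exp (w₂.re + θ * I) * (b (w₂.re + θ * I) - 1) * I) univ θ := fun θ _ => by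
      have h1 : HasDerivAt (fun θ : ℝ => (w₂.re : ℂ) + θ * I) I θ := by
        simpa using ((Complex.ofRealCLM.hasDerivAt (x := θ)).mul_const I).const_add (w₂.re : ℂ)
      have h2 := (hd (w₂.re + θ * I) (by simpa using h₂)).scomp θ h1
      rw [smul_eq_mul] at h2
      exact (h2.congr_deriv (mul_comm _ _)).hasDerivWithinAt
    have hbd : ∀ θ ∈ (univ : Set ℝ), ‖exp (w₂.re + θ * I) * (b (w₂.re + θ * I) - 1) * I‖ ≤
        Real.exp w₂.re * δ := fun θ _ => by
      have h1 := hdn (w₂.re + θ * I) (by simpa using h₂)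
      rw [norm_mul, norm_I, mul_one]
      simpa using h1
    have := convex_univ.norm_image_sub_le_of_norm_hasDerivWithin_le hder hbd (mem_univ w₁.im)
      (mem_univ w₂.im)
    rw [re_add_im] at this
    rw [Real.norm_eq_abs] at this
    linarith
  have e : Y w₂ - Y w₁ - (exp w₂ - exp w₁) = (D w₂ - D w₃) + (D w₃ - D w₁) := by
    simp only [hD]; ring
  rw [e]
  refine (norm_add_le _ _).trans ?_
  linarith

/-- In the valleys `Re Y` is negative sufficiently far out. -/
theorem exists_cos_of_re_nonneg (hδ : 0 ≤ δ) (hδ1 : δ ≤ 1 / 20)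
    (hY : ∀ w : ℂ, Λ < w.re → HasDerivAt Y (exp w * b w) w)
    (hb : ∀ w : ℂ, Λ < w.re → ‖b w - 1‖ ≤ δ) (θ : ℝ) :
    ∃ Λ', Λ ≤ Λ' ∧ ∀ w : ℂ, Λ' < w.re → |w.im - θ| ≤ Real.pi → 0 ≤ (Y w).re → -(1 / 2) < Real.cos w.im := by
  -- A base point at the height θ: the error in Y grows with the vertical distance. Hence `Λ'`
  -- depends on θ and does not serve all hills at once.
  set w₁ : ℂ := ((Λ + 1 : ℝ) : ℂ) + θ * I with hw₁
  have h1re : w₁.re = Λ + 1 := by simp [hw₁]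
  have h1im : w₁.im = θ := by simp [hw₁]
  set K := |(Y w₁).re| + 2 * Real.exp (Λ + 1) + 1 with hK
  have hK0 : 0 < K := by positivity
  refine ⟨max Λ (Real.log (4 * K)), le_max_left _ _, fun w hw hθ hpos => ?_⟩
  have hΛ : Λ < w.re := (le_max_left _ _).trans_lt hw
  have hbig : 4 * K < Real.exp w.re := (Real.log_lt_iff_lt_exp (by positivity)).1 ((le_max_right _ _).trans_lt hw)
  have hle := norm_sub_exp_le hδ hY hb (w₁ := w₁) (w₂ := w) (by rw [h1re]; linarith) hΛ
  rw [h1re, h1im] at hle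
  have h2 := (re_le_norm _).trans hle
  simp only [sub_re, exp_re, h1re, h1im] at h2
  by_contra hcos
  have hcos' := not_lt.1 hcos
  have hpi := Real.pi_lt_four
  -- The error is at most (1 + 4)/20 = 1/4 of e^{Re w} up to constants, and cos Im w ≤ -1/2 would
  -- contribute at least twice as much. The remaining quarter exceeds `K` by the choice of `Λ'`.
  have e1 : Real.exp w.re * |w.im - θ| ≤ Real.exp w.re * 4 := by gcongr; linarith
  have e2 : Real.exp w.re * Real.cos w.im ≤ Real.exp w.re * (-(1 / 2)) := by gcongr
  have e3 : Real.exp (Λ + 1) * Real.cos θ ≥ -Real.exp (Λ + 1) := by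
    nlinarith [Real.neg_one_le_cos θ, Real.exp_pos (Λ + 1)]
  have e4 : δ * (Real.exp (Λ + 1) + Real.exp w.re + Real.exp w.re * |w.im - θ|) ≤
      1 / 20 * (Real.exp (Λ + 1) + Real.exp w.re + Real.exp w.re * 4) := by gcongr
  have := le_abs_self (Y w₁).re
  linarith [Real.exp_pos (Λ + 1)]

/-- `Re Y` decreases from the centre of a hill to the centre of an adjacent valley. -/
theorem re_valley_lt_re_hill (hδ : 0 ≤ δ) (hδ1 : δ ≤ 1 / 20)
    (hY : ∀ w : ℂ, Λ < w.re → HasDerivAt Y (exp w * b w) w)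
    (hb : ∀ w : ℂ, Λ < w.re → ‖b w - 1‖ ≤ δ) {w₁ w₂ : ℂ} (h₁ : Λ < w₁.re) (h₂ : Λ < w₂.re) {k : ℤ}
    (hk : w₁.im = 2 * Real.pi * k) (h : |w₂.im - 2 * Real.pi * k| = Real.pi) : (Y w₂).re < (Y w₁).re := by
  have hle := (re_le_norm _).trans (norm_sub_exp_le hδ hY hb h₁ h₂)
  rw [hk, h] at hle
  have c1 : Real.cos (2 * Real.pi * k) = 1 := by rw [mul_comm]; exact Real.cos_int_mul_two_pi k
  have c2 : Real.cos w₂.im = -1 := by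
    have e : Real.cos w₂.im = Real.cos (w₂.im - 2 * Real.pi * k) := by
      rw [mul_comm (2 * Real.pi)]; exact (Real.cos_sub_int_mul_two_pi _ _).symm
    rw [e, ← Real.cos_abs, h, Real.cos_pi]
  simp only [sub_re, exp_re, hk, c1, c2] at hle
  have hpi := Real.pi_lt_four
  have e1 : Real.exp w₂.re * Real.pi ≤ Real.exp w₂.re * 4 := by gcongr
  have e4 : δ * (Real.exp w₁.re + Real.exp w₂.re + Real.exp w₂.re * Real.pi) ≤
      1 / 20 * (Real.exp w₁.re + Real.exp w₂.re + Real.exp w₂.re * 4) := by gcongr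
  linarith [Real.exp_pos w₁.re, Real.exp_pos w₂.re]

theorem exists_eq_of_mem_uIcc {f : ℝ → ℝ} {I : Set ℝ} (hI : I.OrdConnected) (hf : ContinuousOn f I)
    {x y v : ℝ} (hx : x ∈ I) (hy : y ∈ I) (hv : v ∈ uIcc (f x) (f y)) : ∃ t ∈ uIcc x y, f t = v :=
  intermediate_value_uIcc (hf.mono (hI.uIcc_subset hx hy)) hv

/-- A function that never goes, for decreasing argument, from an even multiple of `π` to an adjacent odd
one, and eventually avoids each single odd multiple, ends up between two adjacent odd multiples. -/
theorem exists_eventually_abs_sub_lt_pi {f : ℝ → ℝ} {a : ℝ} (ha : 0 < a) (hf : ContinuousOn f (Ioo 0 a))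
    (h1 : ∀ t₁ ∈ Ioo 0 a, ∀ t₂ ∈ Ioo 0 a, t₁ < t₂ → ∀ k : ℤ, f t₂ = 2 * Real.pi * k →
      |f t₁ - 2 * Real.pi * k| ≠ Real.pi)
    (h2 : ∀ k : ℤ, ∀ᶠ t in 𝓝[>] 0, |f t - 2 * Real.pi * k| ≠ Real.pi) :
    ∃ k : ℤ, ∀ᶠ t in 𝓝[>] 0, |f t - 2 * Real.pi * k| < Real.pi := by
  have hπ := Real.pi_pos
  -- Once the curve meets the axis of a hill, it cannot later meet a valley axis beside it and
  -- remains on this hill. If it never meets such an axis, it lies between two consecutive ones, and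
  -- finally on one side of the valley axis between them.
  by_cases hA : ∃ t₂ ∈ Ioo 0 a, ∃ k : ℤ, f t₂ = 2 * Real.pi * k
  · obtain ⟨t₂, ht₂, k, hk⟩ := hA
    refine ⟨k, ?_⟩
    filter_upwards [Ioo_mem_nhdsGT ht₂.1] with t ht
    by_contra hlt
    have htI : t ∈ Ioo 0 a := ⟨ht.1, ht.2.trans ht₂.2⟩
    obtain ⟨t₁, ht₁, he⟩ := exists_eq_of_mem_uIcc (f := fun t => |f t - 2 * Real.pi * k|) (v := Real.pi)
      ordConnected_Ioo (hf.sub continuousOn_const).abs ht₂ htI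
      (by
        rw [mem_uIcc]
        left
        simp only [hk, sub_self, abs_zero]
        exact ⟨hπ.le, not_lt.1 hlt⟩)
    rw [uIcc_of_ge ht.2.le] at ht₁
    rcases eq_or_lt_of_le ht₁.2 with h | h
    · rw [h] at he
      simp only [hk, sub_self, abs_zero] at he
      exact hπ.ne he
    · exact h1 t₁ ⟨ht.1.trans_le ht₁.1, h.trans ht₂.2⟩ t₂ ht₂ h k hk he
  · push Not at hA
    set k := ⌊f (a / 2) / (2 * Real.pi)⌋ with hk
    have hm : a / 2 ∈ Ioo 0 a := ⟨half_pos ha, half_lt_self ha⟩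
    have hk1 : 2 * Real.pi * k ≤ f (a / 2) := by
      have := Int.floor_le (f (a / 2) / (2 * Real.pi))
      rwa [← hk, le_div_iff₀ (by positivity), mul_comm] at this
    have hk2 : f (a / 2) < 2 * Real.pi * (k + 1 : ℤ) := by
      have := Int.lt_floor_add_one (f (a / 2) / (2 * Real.pi))
      rw [← hk, div_lt_iff₀ (by positivity), mul_comm] at this
      exact_mod_cast this
    have hlow : ∀ t ∈ Ioo 0 a, 2 * Real.pi * k < f t := fun t ht => by
      by_contra hlt
      obtain ⟨t₁, ht₁, he⟩ := exists_eq_of_mem_uIcc ordConnected_Ioo hf ht hm (v := 2 * Real.pi * k)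
        (mem_uIcc.2 (Or.inl ⟨not_lt.1 hlt, hk1⟩))
      exact hA t₁ (ordConnected_Ioo.uIcc_subset ht hm ht₁) k he
    have hup : ∀ t ∈ Ioo 0 a, f t < 2 * Real.pi * (k + 1 : ℤ) := fun t ht => by
      by_contra hlt
      obtain ⟨t₁, ht₁, he⟩ := exists_eq_of_mem_uIcc ordConnected_Ioo hf hm ht
        (v := 2 * Real.pi * (k + 1 : ℤ)) (mem_uIcc.2 (Or.inl ⟨hk2.le, not_lt.1 hlt⟩))
      exact hA t₁ (ordConnected_Ioo.uIcc_subset hm ht ht₁) (k + 1) he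
    obtain ⟨a', ha', hs⟩ := mem_nhdsGT_iff_exists_Ioo_subset.1 ((h2 k).and (Ioo_mem_nhdsGT ha))
    have ha'0 : (0 : ℝ) < a' := ha'
    have hm' : a' / 2 ∈ Ioo 0 a' := ⟨half_pos ha'0, half_lt_self ha'0⟩
    have hne : ∀ t ∈ Ioo 0 a', f t ≠ 2 * Real.pi * k + Real.pi := fun t ht he =>
      (hs ht).1 (by rw [he]; simp [abs_of_pos hπ])
    have hf' : ContinuousOn f (Ioo 0 a') := hf.mono fun t ht => (hs ht).2
    push_cast at hup
    rcases lt_or_ge (f (a' / 2)) (2 * Real.pi * k + Real.pi) with hlt | hge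
    · refine ⟨k, ?_⟩
      filter_upwards [Ioo_mem_nhdsGT ha'0] with t ht
      have h3 : f t < 2 * Real.pi * k + Real.pi := by
        by_contra hc
        obtain ⟨t₁, ht₁, he⟩ := exists_eq_of_mem_uIcc ordConnected_Ioo hf' hm' ht
          (v := 2 * Real.pi * k + Real.pi) (mem_uIcc.2 (Or.inl ⟨hlt.le, not_lt.1 hc⟩))
        exact hne t₁ (ordConnected_Ioo.uIcc_subset hm' ht ht₁) he
      have h4 := hlow t (hs ht).2
      rw [abs_lt]; constructor <;> linarith
    · refine ⟨k + 1, ?_⟩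
      filter_upwards [Ioo_mem_nhdsGT ha'0] with t ht
      have h3 : 2 * Real.pi * k + Real.pi < f t := by
        by_contra hc
        obtain ⟨t₁, ht₁, he⟩ := exists_eq_of_mem_uIcc ordConnected_Ioo hf' ht hm'
          (v := 2 * Real.pi * k + Real.pi) (mem_uIcc.2 (Or.inl ⟨not_lt.1 hc, hge⟩))
        exact hne t₁ (ordConnected_Ioo.uIcc_subset ht hm' ht₁) he
      have h4 := hup t (hs ht).2
      push_cast
      rw [abs_lt]; constructor <;> linarith

/-- A path that stays where `cos Im > -1/2` unless `|Im| > π` cannot leave the hill. -/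
theorem abs_lt_pi_of_path {f : ℝ → ℝ} (hf : ContinuousOn f (Icc 0 1)) (h0 : |f 0| < Real.pi)
    (hcos : ∀ t ∈ Icc (0 : ℝ) 1, |f t| ≤ Real.pi → -(1 / 2) < Real.cos (f t)) : |f 1| < Real.pi := by
  by_contra h1
  have m0 : (0 : ℝ) ∈ Icc (0 : ℝ) 1 := ⟨le_rfl, zero_le_one⟩
  have m1 : (1 : ℝ) ∈ Icc (0 : ℝ) 1 := ⟨zero_le_one, le_rfl⟩
  obtain ⟨t, ht, he⟩ := exists_eq_of_mem_uIcc (f := fun t => |f t|) (v := Real.pi) ordConnected_Icc hf.abs m0 m1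
    (mem_uIcc.2 (Or.inl ⟨h0.le, not_lt.1 h1⟩))
  have he' : |f t| = Real.pi := he
  have := hcos t (ordConnected_Icc.uIcc_subset m0 m1 ht) he'.le
  rw [← Real.cos_abs, he', Real.cos_pi] at this
  norm_num at this

end Hill

end

/-! ### Ends with μ > 0: paths of descent and the recessive solution on a hill -/

noncomputable section

variable {μ l : ℕ} {B h X : ℂ → ℂ} {ρ : ℝ}

/-- The logarithm of the leading term of the exponent, as a function of `s = log t`. -/
def hillCoord (μ : ℕ) (κ₀ s : ℂ) : ℂ := κ₀ - μ / 2 * s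

/-- The inverse of `hillCoord`. -/
def hillParam (μ : ℕ) (κ₀ w : ℂ) : ℂ := 2 / μ * (κ₀ - w)

theorem hillParam_hillCoord (hμ : μ ≠ 0) (κ₀ s : ℂ) : hillParam μ κ₀ (hillCoord μ κ₀ s) = s := by
  have : (μ : ℂ) ≠ 0 := by exact_mod_cast hμ
  rw [hillCoord, hillParam]; field_simp; ring

theorem hillCoord_re (κ₀ s : ℂ) : (hillCoord μ κ₀ s).re = κ₀.re - μ / 2 * s.re := by
  have : (μ / 2 : ℂ) = ((μ / 2 : ℝ) : ℂ) := by push_cast; ring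
  rw [hillCoord, this, sub_re, re_ofReal_mul]

theorem hillParam_re (κ₀ w : ℂ) : (hillParam μ κ₀ w).re = 2 / μ * (κ₀.re - w.re) := by
  have : (2 / μ : ℂ) = ((2 / μ : ℝ) : ℂ) := by push_cast; ring
  rw [hillParam, this, re_ofReal_mul, sub_re]

theorem hillParam_re_lt (hμ : μ ≠ 0) {κ₀ w : ℂ} {R : ℝ} (hw : κ₀.re - μ / 2 * R < w.re) :
    (hillParam μ κ₀ w).re < R := by
  have h0 : (0 : ℝ) < μ := by positivity
  rw [hillParam_re, div_mul_eq_mul_div, div_lt_iff₀ h0]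
  linarith

/-- The constant κ₀ is chosen to absorb the leading coefficient of X, so that dX/dw = e^w (1 +
o(1)). It is determined up to multiples of 2πi, one value for each hill. -/
theorem endRate_hillParam (hμ : μ ≠ 0) (hB0 : B 0 ≠ 0) {κ₀ : ℂ} (hκ : exp κ₀ = -(2 / μ * B 0)) (w : ℂ) :
    endRate μ B (hillParam μ κ₀ w) = -(μ / 2) * (exp w * (B (exp (hillParam μ κ₀ w)) / B 0)) := by
  have h0 : (μ : ℂ) ≠ 0 := by exact_mod_cast hμ
  have e : -(μ / 2 * hillParam μ κ₀ w) = w - κ₀ := by rw [hillParam]; field_simp; ring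
  rw [endRate, e, exp_sub, hκ]
  field_simp

theorem hasDerivAt_comp_hillParam (hμ : μ ≠ 0) (hB0 : B 0 ≠ 0) {κ₀ : ℂ} (hκ : exp κ₀ = -(2 / μ * B 0))
    {w : ℂ} (hX : HasDerivAt X (endRate μ B (hillParam μ κ₀ w)) (hillParam μ κ₀ w)) :
    HasDerivAt (fun w => X (hillParam μ κ₀ w)) (exp w * (B (exp (hillParam μ κ₀ w)) / B 0)) w := by
  have h0 : (μ : ℂ) ≠ 0 := by exact_mod_cast hμ
  have h1 : HasDerivAt (hillParam μ κ₀) (2 / μ * (-1)) w :=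
    ((hasDerivAt_id w).const_sub κ₀).const_mul (2 / (μ : ℂ))
  refine (hX.comp w h1).congr_deriv ?_
  rw [endRate_hillParam hμ hB0 hκ]
  field_simp

theorem convexComb_mem_slitPlane {y : ℂ} (hy : y ∈ slitPlane) {N t : ℝ} (hN : 0 < N) (ht : t ∈ Icc (0 : ℝ) 1) :
    (N : ℂ) + t * (y - N) ∈ slitPlane := by
  have hre : ((N : ℂ) + t * (y - N)).re = (1 - t) * N + t * y.re := by simp; ring
  have him : ((N : ℂ) + t * (y - N)).im = t * y.im := by simp
  rw [mem_slitPlane_iff] at hy ⊢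
  rw [hre, him]
  rcases eq_or_lt_of_le ht.1 with h0 | h0
  · left; rw [← h0]; simpa using hN
  · rcases hy with h | h
    · left; nlinarith [ht.2]
    · right; exact mul_ne_zero h0.ne' h

/-- The angle between y and the positive axis is at most 120°. So a segment from N to y comes no
nearer to 0 than half of the interpolated modulus. -/
theorem half_le_norm_convexComb {y : ℂ} (hy : -(1 / 2) * ‖y‖ ≤ y.re) {N t : ℝ} (hN : 0 < N)
    (ht : t ∈ Icc (0 : ℝ) 1) : (N + t * (‖y‖ - N)) / 2 ≤ ‖(N : ℂ) + t * (y - N)‖ := by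
  have hre : ((N : ℂ) + t * (y - N)).re = (1 - t) * N + t * y.re := by simp; ring
  have him : ((N : ℂ) + t * (y - N)).im = t * y.im := by simp
  have h1 : 0 ≤ 1 - t := sub_nonneg.2 ht.2
  have h2 := norm_nonneg y
  have hsq : ‖y‖ ^ 2 = y.re ^ 2 + y.im ^ 2 := by rw [← normSq_eq_norm_sq, normSq_apply]; ring
  refine (le_abs_self _).trans (abs_le_of_sq_le_sq ?_ (norm_nonneg _))
  rw [← normSq_eq_norm_sq, normSq_apply, hre, him]
  have h3 : 0 ≤ t * (1 - t) * N * (y.re + 1 / 2 * ‖y‖) := by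
    have := ht.1
    have h4 : 0 ≤ y.re + 1 / 2 * ‖y‖ := by linarith
    positivity
  have h5 : t ^ 2 * ‖y‖ ^ 2 = t ^ 2 * (y.re ^ 2 + y.im ^ 2) := by rw [hsq]
  have h6 := sq_nonneg (t * ‖y‖ - (1 - t) * N)
  linarith

/-- Paths of descent on a hill, from far away points on its axis. -/
theorem descentPath_hill (hμ : μ ≠ 0) (hl : μ < 2 * l) (hB0 : B 0 ≠ 0) (hB : ContinuousAt B 0)
    (hh : ContinuousAt h 0) {κ₀ : ℂ} (hκ : exp κ₀ = -(2 / μ * B 0)) (R : ℝ) :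
    ∃ C R₂ : ℝ, 0 ≤ C ∧ R₂ ≤ R ∧ ∀ s : ℂ, s.re < R₂ → |(hillCoord μ κ₀ s).im| < Real.pi →
      -(1 / 2) < Real.cos (hillCoord μ κ₀ s).im → ∀ᶠ n : ℕ in atTop,
      DescentPath (endRate μ B) (endPotential l h) (leftHalfPlane R) (hillParam μ κ₀ (Real.log n : ℝ)) s
        (C * Real.exp (1 / 2 * s.re)) := by
  have hμ0 : (0 : ℝ) < μ := by positivity
  have hμc : (μ : ℂ) ≠ 0 := by exact_mod_cast hμ
  have hbc : Tendsto (fun t => B t / B 0) (𝓝 0) (𝓝 1) := by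
    simpa [hB0] using hB.tendsto.div_const (B 0)
  obtain ⟨R₁, hR₁⟩ := exists_forall_re_lt ((Metric.tendsto_nhds.1 hbc (1 / 20) (by norm_num)).and
    (hh.norm.eventually (gt_mem_nhds (lt_add_one ‖h 0‖))))
  set R₃ := min (min R R₁) 0 with hR₃
  set Λ := κ₀.re - μ / 2 * R₃ with hΛ
  -- Since l ≥ (μ + 1)/2 and |e^s| is of order |y|^{-2/μ} for y = e^w, the potential is
  -- O(|y|^{-1-ν}). Its integral along the path is O(|y|^{-ν}), and at the endpoint this is a
  -- multiple of e^{Re s/2}.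
  set ν : ℝ := (μ : ℝ)⁻¹ with hν
  have hν0 : 0 < ν := inv_pos.2 hμ0
  set C₁ := (‖h 0‖ + 1) * Real.exp ((1 + ν) * κ₀.re) * 2 ^ (1 + ν) * 6 * μ with hC₁
  have hC₁0 : 0 ≤ C₁ := by positivity
  -- The margin corresponds to the factor 2 in `half_le_norm_convexComb` and keeps the whole path
  -- left of `R₃`.
  set R₂ := R₃ - 2 / μ * Real.log 2 with hR₂
  have hR₂₃ : R₂ ≤ R₃ := by
    have : 0 ≤ 2 / (μ : ℝ) * Real.log 2 := mul_nonneg (by positivity) (Real.log_nonneg (by norm_num))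
    linarith
  refine ⟨C₁ * Real.exp (-(ν * κ₀.re)), R₂, by positivity,
    hR₂₃.trans ((min_le_left _ _).trans (min_le_left _ _)), fun s hs him hcos => ?_⟩
  set w := hillCoord μ κ₀ s with hw
  have hwre : Λ + Real.log 2 < w.re := by
    rw [hw, hillCoord_re, hΛ]
    have : μ / 2 * s.re < μ / 2 * R₂ := by gcongr
    have e : μ / 2 * R₂ = μ / 2 * R₃ - Real.log 2 := by rw [hR₂]; field_simp
    linarith
  set y := exp w with hy
  have hyn : ‖y‖ = Real.exp w.re := norm_exp w
  have hy0 : 0 < ‖y‖ := by rw [hyn]; exact Real.exp_pos _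
  have hybig : 2 * Real.exp Λ < ‖y‖ := by
    have : 2 * Real.exp Λ = Real.exp (Real.log 2 + Λ) := by
      rw [Real.exp_add, Real.exp_log (zero_lt_two' ℝ)]
    rw [hyn, this]
    exact Real.exp_lt_exp.2 (by linarith)
  have hlog : log y = w := log_exp (abs_lt.1 him).1 (abs_lt.1 him).2.le
  have hyslit : y ∈ slitPlane := by
    rw [mem_slitPlane_iff_arg]
    refine ⟨?_, exp_ne_zero _⟩
    have : arg y = w.im := by rw [← log_im, hlog]
    rw [this]
    exact (abs_lt.1 him).2.ne
  have hyre : -(1 / 2) * ‖y‖ ≤ y.re := by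
    rw [hyn, hy, exp_re]
    nlinarith [Real.exp_pos w.re]
  have hn : ∀ᶠ n : ℕ in atTop, 3 * ‖y‖ < (n : ℝ) := tendsto_natCast_atTop_atTop.eventually_gt_atTop _
  filter_upwards [hn] with n hn1
  generalize hN : (n : ℝ) = N at hn1 ⊢
  have hN0 : 0 < N := by linarith
  -- In the plane of y = e^w, where X is nearly y, the path is the straight segment from the large
  -- number N to y. It avoids the cut and is carried back by the logarithm.
  set yt : ℝ → ℂ := fun t => (N : ℂ) + t * (y - N) with hyt
  set v : ℝ → ℝ := fun t => N + t * (‖y‖ - N) with hv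
  have hvpos : ∀ t ∈ Icc (0 : ℝ) 1, ‖y‖ ≤ v t := fun t ht => by
    simp only [hv]; nlinarith [ht.1, ht.2]
  have hyv : ∀ t ∈ Icc (0 : ℝ) 1, v t / 2 ≤ ‖yt t‖ := fun t ht => half_le_norm_convexComb hyre hN0 ht
  have hyts : ∀ t ∈ Icc (0 : ℝ) 1, yt t ∈ slitPlane := fun t ht => convexComb_mem_slitPlane hyslit hN0 ht
  have hytd : ∀ t, HasDerivAt yt (y - N) t := fun t =>
    (((Complex.ofRealCLM.hasDerivAt (x := t)).mul_const (y - N)).const_add (N : ℂ)).congr_deriv (by simp)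
  have hvd : ∀ t, HasDerivAt v (‖y‖ - N) t := fun t =>
    (((hasDerivAt_id t).mul_const (‖y‖ - N)).const_add N).congr_deriv (by simp)
  have hyN : ‖y - N‖ ≤ 3 * (N - ‖y‖) := by
    refine (norm_sub_le _ _).trans ?_
    rw [Complex.norm_real, Real.norm_eq_abs, abs_of_pos hN0]
    linarith
  refine ⟨fun t => hillParam μ κ₀ (log (yt t)), fun t => 2 / μ * (-((y - N) / yt t)),
    fun t => C₁ * v t ^ (-ν), fun t => C₁ * ((‖y‖ - N) * -ν * v t ^ (-ν - 1)), ?_, ?_, fun t ht => ?_,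
    ?_, ?_, ?_⟩
  · simp [hyt, ofReal_log hN0.le]
  · simp only [hyt, ofReal_one, one_mul, add_sub_cancel]
    rw [hlog, hw, hillParam_hillCoord hμ]
  · have hyt0 : yt t ≠ 0 := slitPlane_ne_zero (hyts t ht)
    have hvt : 0 < v t := hy0.trans_le (hvpos t ht)
    have hlre : (log (yt t)).re = Real.log ‖yt t‖ := log_re _
    have hΛlt : Λ < (log (yt t)).re := by
      rw [hlre, Real.lt_log_iff_exp_lt (norm_pos_iff.2 hyt0)]
      linarith [hyv t ht, hvpos t ht]
    have hre3 : (hillParam μ κ₀ (log (yt t))).re < R₃ := hillParam_re_lt hμ hΛlt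
    obtain ⟨hb, hhb⟩ := hR₁ _ (hre3.trans_le ((min_le_left _ _).trans (min_le_right _ _)))
    rw [dist_eq_norm] at hb
    have hrate : endRate μ B (hillParam μ κ₀ (log (yt t))) * (2 / μ * (-((y - N) / yt t))) =
        B (exp (hillParam μ κ₀ (log (yt t)))) / B 0 * (y - N) := by
      rw [endRate_hillParam hμ hB0 hκ, exp_log hyt0]
      field_simp
    set q := B (exp (hillParam μ κ₀ (log (yt t)))) / B 0 with hq
    refine ⟨hre3.trans_le ((min_le_left _ _).trans (min_le_left _ _)), ?_, ?_, ?_, ?_⟩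
    · exact (((hytd t).clog_real (hyts t ht)).const_sub κ₀).const_mul (2 / (μ : ℂ))
    · rw [hrate]
      have e1 : (q * (y - N)).re = y.re - N + ((q - 1) * (y - N)).re := by
        have : q * (y - N) = y - N + (q - 1) * (y - N) := by ring
        rw [this, add_re, sub_re, ofReal_re]
      have e2 : ((q - 1) * (y - N)).re ≤ 1 / 20 * (3 * (N - ‖y‖)) := by
        refine (re_le_norm _).trans ?_
        rw [norm_mul]
        gcongr
      rw [e1]
      linarith [re_le_norm y]
    · exact (((hvd t).rpow_const (p := -ν) (Or.inl hvt.ne')).const_mul C₁)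
    · have hqn : ‖q‖ ≤ 2 := by
        calc ‖q‖ = ‖1 + (q - 1)‖ := by ring_nf
          _ ≤ 1 + 1 / 20 := (norm_add_le _ _).trans (by rw [norm_one]; gcongr)
          _ ≤ 2 := by norm_num
      have hexp : ‖exp (l * hillParam μ κ₀ (log (yt t)))‖ ≤
          Real.exp ((1 + ν) * κ₀.re) * (2 ^ (1 + ν) * v t ^ (-ν - 1)) := by
        rw [norm_exp]
        have e1 : (l * hillParam μ κ₀ (log (yt t))).re = l * (hillParam μ κ₀ (log (yt t))).re := by
          rw [← ofReal_natCast, re_ofReal_mul]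
        have e2 : l * (hillParam μ κ₀ (log (yt t))).re ≤ (μ + 1) / 2 * (hillParam μ κ₀ (log (yt t))).re := by
          have h3 : (hillParam μ κ₀ (log (yt t))).re ≤ 0 := hre3.le.trans (min_le_right _ _)
          have h4 : ((μ : ℝ) + 1) / 2 ≤ l := by
            have : (μ : ℝ) + 1 ≤ 2 * l := by exact_mod_cast hl
            linarith
          nlinarith
        have e3 : (μ + 1) / 2 * (hillParam μ κ₀ (log (yt t))).re =
            (1 + ν) * κ₀.re + Real.log ‖yt t‖ * (-ν - 1) := by
          rw [hillParam_re, hlre, hν]; field_simp; ring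
        rw [e1]
        refine (Real.exp_le_exp.2 (e2.trans_eq e3)).trans ?_
        rw [Real.exp_add, ← Real.rpow_def_of_pos (norm_pos_iff.2 hyt0)]
        gcongr
        calc ‖yt t‖ ^ (-ν - 1) ≤ (v t / 2) ^ (-ν - 1) :=
              Real.rpow_le_rpow_of_nonpos (by positivity) (hyv t ht) (by linarith)
          _ = _ := by
              rw [Real.div_rpow hvt.le zero_le_two, div_eq_mul_inv, ← Real.rpow_neg zero_le_two, mul_comm]
              congr 2; ring
      rw [hrate, norm_mul, norm_mul, endPotential, norm_mul]
      calc _ ≤ Real.exp ((1 + ν) * κ₀.re) * (2 ^ (1 + ν) * v t ^ (-ν - 1)) * (‖h 0‖ + 1) *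
            (2 * (3 * (N - ‖y‖))) := by gcongr
        _ = _ := by rw [hC₁, hν]; field_simp; ring
  · refine continuousOn_const.mul (ContinuousOn.neg (continuousOn_const.div
      (fun t _ => (hytd t).continuousAt.continuousWithinAt) fun t ht => slitPlane_ne_zero (hyts t ht)))
  · refine continuousOn_const.mul (continuousOn_const.mul (ContinuousOn.rpow_const
      (fun t _ => (hvd t).continuousAt.continuousWithinAt) fun t ht => Or.inl (hy0.trans_le (hvpos t ht)).ne'))
  · have h0 : 0 ≤ C₁ * v 0 ^ (-ν) := by
      have : 0 ≤ v 0 := by simp [hv, hN0.le]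
      positivity
    have h1 : v 1 = Real.exp w.re := by simp [hv, hyn]
    have h2 : v 1 ^ (-ν) = Real.exp (-(ν * κ₀.re)) * Real.exp (1 / 2 * s.re) := by
      rw [h1, ← Real.exp_mul, ← Real.exp_add, hw, hillCoord_re, hν]
      congr 1; field_simp; ring
    simp only [h2]
    linarith

/-- The recessive solution on a hill. -/
theorem exists_recessive_hill (hρ : 0 < ρ) (hB : DifferentiableOn ℂ B (Metric.ball 0 ρ))
    (hB0 : B 0 ≠ 0) (hh : DifferentiableOn ℂ h (Metric.ball 0 ρ)) (hμ : μ ≠ 0) (hl : μ < 2 * l)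
    (hX : ∀ s ∈ leftHalfPlane (Real.log ρ), HasDerivAt X (endRate μ B s) s) {σ : ℝ → ℂ} {a : ℝ} (ha : 0 < a)
    (hσc : ContinuousOn σ (Ioo 0 a)) (hσ : Tendsto (fun t => (σ t).re) (𝓝[>] 0) atBot)
    (hpos : ∀ t ∈ Ioo 0 a, 0 ≤ (X (σ t)).re) (hanti : AntitoneOn (fun t => (X (σ t)).re) (Ioo 0 a)) :
    ∃ V, SolvesOn (relSystem (endRate μ B) (endPotential l h)) V (leftHalfPlane (Real.log ρ)) ∧
      ∀ ε > 0, ∃ R : ℝ, ∀ᶠ t in 𝓝[>] 0, ∀ γ : ℝ → ℂ, ContinuousOn γ (Icc 0 1) → γ 0 = σ t →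
        (∀ τ ∈ Icc (0 : ℝ) 1, (γ τ).re < R ∧ 0 ≤ (X (γ τ)).re) → ‖V (γ 1) - (1, 0)‖ < ε := by
  have hμc : (μ : ℂ) ≠ 0 := by exact_mod_cast hμ
  have hμ0 : (0 : ℝ) < μ := by positivity
  have hBc := (hB.differentiableAt (Metric.ball_mem_nhds _ hρ)).continuousAt
  have hhc := (hh.differentiableAt (Metric.ball_mem_nhds _ hρ)).continuousAt
  have hne : -(2 / μ * B 0) ≠ 0 := neg_ne_zero.2 (mul_ne_zero (div_ne_zero two_ne_zero hμc) hB0)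
  set κ₁ := log (-(2 / μ * B 0)) with hκ₁
  have hbc : Tendsto (fun t => B t / B 0) (𝓝 0) (𝓝 1) := by
    simpa [hB0] using hBc.tendsto.div_const (B 0)
  obtain ⟨R₁, hR₁⟩ := exists_forall_re_lt (Metric.tendsto_nhds.1 hbc (1 / 20) (by norm_num))
  set R₃ := min (Real.log ρ) R₁ with hR₃
  have hmain : ∀ κ₀ : ℂ, exp κ₀ = -(2 / μ * B 0) → ∀ w : ℂ, κ₀.re - μ / 2 * R₃ < w.re →
      HasDerivAt (fun w => X (hillParam μ κ₀ w)) (exp w * (B (exp (hillParam μ κ₀ w)) / B 0)) w ∧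
      ‖B (exp (hillParam μ κ₀ w)) / B 0 - 1‖ ≤ 1 / 20 := fun κ₀ hκ w hw => by
    have hre := hillParam_re_lt hμ hw
    refine ⟨hasDerivAt_comp_hillParam hμ hB0 hκ (hX _ (hre.trans_le (min_le_left _ _))), ?_⟩
    have := hR₁ _ (hre.trans_le (min_le_right _ _))
    rw [dist_eq_norm] at this
    exact this.le
  have hcoord : ∀ (κ₀ : ℂ) {s : ℂ} {R : ℝ}, s.re < R → κ₀.re - μ / 2 * R < (hillCoord μ κ₀ s).re :=
    fun κ₀ s R hs => by
      rw [hillCoord_re]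
      have : μ / 2 * s.re < μ / 2 * R := by gcongr
      linarith
  have hcos : ∀ κ₀ : ℂ, exp κ₀ = -(2 / μ * B 0) → ∃ R₄ : ℝ, ∀ s : ℂ, s.re < R₄ →
      |(hillCoord μ κ₀ s).im| ≤ Real.pi → 0 ≤ (X s).re → -(1 / 2) < Real.cos (hillCoord μ κ₀ s).im := by
    intro κ₀ hκ
    obtain ⟨Λ', -, h'⟩ := exists_cos_of_re_nonneg (by norm_num) le_rfl (fun w hw => (hmain κ₀ hκ w hw).1)
      (fun w hw => (hmain κ₀ hκ w hw).2) 0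
    refine ⟨2 / μ * (κ₀.re - Λ'), fun s hs him hpos => h' _ ?_ (by simpa using him) ?_⟩
    · have := hcoord κ₀ hs
      have e : μ / 2 * (2 / μ * (κ₀.re - Λ')) = κ₀.re - Λ' := by field_simp
      linarith
    · rwa [hillParam_hillCoord hμ]
  have hexpk : ∀ k : ℤ, exp (κ₁ - k * (2 * Real.pi * I)) = -(2 / μ * B 0) := fun k => by
    rw [exp_periodic.sub_int_mul_eq, hκ₁, exp_log hne]
  have himk : ∀ (k : ℤ) (s : ℂ), (hillCoord μ (κ₁ - k * (2 * Real.pi * I)) s).im =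
      (hillCoord μ κ₁ s).im - 2 * Real.pi * k := fun k s => by
    simp [hillCoord]; ring
  obtain ⟨a', ha', hs⟩ := mem_nhdsGT_iff_exists_Ioo_subset.1
    ((hσ.eventually_lt_atBot R₃).and (Ioo_mem_nhdsGT ha))
  have hcont : ContinuousOn (fun t => (hillCoord μ κ₁ (σ t)).im) (Ioo 0 a') := by
    have h1 : ContinuousOn σ (Ioo 0 a') := hσc.mono fun t ht => (hs ht).2
    exact continuous_im.comp_continuousOn (continuousOn_const.sub (continuousOn_const.mul h1))
  -- This fixes the hill on which σ ends. Crossing from a hill axis to a valley axis would lower Re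
  -- X while it must rise towards the end; staying at a single valley axis contradicts Re X ≥ 0.
  obtain ⟨k, hk⟩ := exists_eventually_abs_sub_lt_pi ha' hcont
    (fun t₁ ht₁ t₂ ht₂ hlt k hk he => by
      have h1 := hmain κ₁ (by rw [hκ₁, exp_log hne])
      have := re_valley_lt_re_hill (by norm_num) le_rfl (fun w hw => (h1 w hw).1) (fun w hw => (h1 w hw).2)
        (hcoord κ₁ (hs ht₂).1) (hcoord κ₁ (hs ht₁).1) hk he
      rw [hillParam_hillCoord hμ, hillParam_hillCoord hμ] at this
      exact absurd (hanti (hs ht₁).2 (hs ht₂).2 hlt.le) (not_le.2 this))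
    (fun k => by
      obtain ⟨R₄, hR₄⟩ := hcos _ (hexpk k)
      filter_upwards [hσ.eventually_lt_atBot R₄, Ioo_mem_nhdsGT ha] with t h1 h2 he
      have := hR₄ (σ t) h1 (by rw [himk, he]) (hpos t h2)
      rw [himk, ← Real.cos_abs, he, Real.cos_pi] at this
      norm_num at this)
  set κ₀ := κ₁ - k * (2 * Real.pi * I) with hκ₀
  have hκ := hexpk k
  obtain ⟨C, R₂, hC, hR₂, hpath⟩ := descentPath_hill hμ hl hB0 hBc hhc hκ (Real.log ρ)
  obtain ⟨R₄, hR₄⟩ := hcos κ₀ hκ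
  obtain ⟨M, hM⟩ := exists_nat_gt (max 1 (Real.exp (κ₀.re - μ / 2 * Real.log ρ)))
  obtain ⟨V, hV, hVb⟩ := exists_recessive (isOpen_leftHalfPlane _) (isSimplyConnected_leftHalfPlane _)
    (differentiableOn_endRate hρ hB) (differentiableOn_endPotential (l := l) hρ hh) hX
    (p := fun n => hillParam μ κ₀ (Real.log ((n + M : ℕ) : ℝ) : ℝ)) (fun n => by
      refine hillParam_re_lt hμ ?_
      have h1 : (M : ℝ) ≤ ((n + M : ℕ) : ℝ) := by push_cast; linarith [(Nat.cast_nonneg n : (0 : ℝ) ≤ n)]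
      have h2 : (0 : ℝ) < ((n + M : ℕ) : ℝ) := by linarith [le_max_left 1 (Real.exp (κ₀.re - μ / 2 * Real.log ρ))]
      rw [ofReal_re, Real.lt_log_iff_exp_lt h2]
      linarith [le_max_right 1 (Real.exp (κ₀.re - μ / 2 * Real.log ρ))])
    (S := {s | s.re < R₂ ∧ |(hillCoord μ κ₀ s).im| < Real.pi ∧ -(1 / 2) < Real.cos (hillCoord μ κ₀ s).im})
    (fun s hs => lt_of_lt_of_le hs.1 hR₂)
    (fun s hs => (tendsto_add_atTop_nat M).eventually (hpath s hs.1 hs.2.1 hs.2.2))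
  refine ⟨V, hV, fun ε hε => ?_⟩
  obtain ⟨R₅, hR₅⟩ := exists_forall_mul_exp_lt C (one_half_pos (α := ℝ)) hε
  refine ⟨min (min R₂ R₄) R₅, ?_⟩
  filter_upwards [hk] with t ht γ hγ hγ0 hγp
  have hR2 : ∀ τ ∈ Icc (0 : ℝ) 1, (γ τ).re < R₂ := fun τ hτ =>
    (hγp τ hτ).1.trans_le ((min_le_left _ _).trans (min_le_left _ _))
  have hc : ∀ τ ∈ Icc (0 : ℝ) 1, |(hillCoord μ κ₀ (γ τ)).im| ≤ Real.pi →
      -(1 / 2) < Real.cos (hillCoord μ κ₀ (γ τ)).im := fun τ hτ h1 =>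
    hR₄ _ ((hγp τ hτ).1.trans_le ((min_le_left _ _).trans (min_le_right _ _))) h1 (hγp τ hτ).2
  -- A curve with Re X ≥ 0 that starts on the hill of σ cannot cross a bounding valley axis, so its
  -- endpoint is covered by the bound for V.
  have h1 := abs_lt_pi_of_path (f := fun τ => (hillCoord μ κ₀ (γ τ)).im)
    (continuous_im.comp_continuousOn (continuousOn_const.sub (continuousOn_const.mul hγ)))
    (by simp only [hγ0]; rw [himk]; exact ht) hc
  have m1 : (1 : ℝ) ∈ Icc (0 : ℝ) 1 := ⟨zero_le_one, le_rfl⟩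
  exact (hVb (γ 1) ⟨hR2 1 m1, h1, hc 1 m1 h1.le⟩).trans_lt
    (hR₅ _ ((hγp 1 m1).1.trans_le (min_le_right _ _)))

end

/-! ### From the local solution to a solution on D -/

noncomputable section

theorem exists_log_lift {g : ℝ → ℂ} {U : Set ℝ} (hU : IsOpen U) (hUc : Convex ℝ U)
    (hg : ContinuousOn g U) (h0 : ∀ t ∈ U, g t ≠ 0) {t₀ : ℝ} (ht₀ : t₀ ∈ U) {s₀ : ℂ} (hs₀ : exp s₀ = g t₀) :
    ∃ σ : ℝ → ℂ, ContinuousOn σ U ∧ (∀ t ∈ U, exp (σ t) = g t) ∧ σ t₀ = s₀ := by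
  obtain ⟨f, hf, hfg⟩ := exists_continuousOn_eqOn_exp_comp (hUc.isSimplyConnected ⟨t₀, ht₀⟩) hU hg
    (by rintro ⟨t, ht, h⟩; exact h0 t ht h)
  have h1 : exp (s₀ - f t₀) = 1 := by
    have : exp (f t₀) = g t₀ := hfg ht₀
    rw [exp_sub, hs₀, this, div_self (h0 t₀ ht₀)]
  refine ⟨fun t => f t + (s₀ - f t₀), hf.add continuousOn_const, fun t ht => ?_, by ring⟩
  rw [exp_add, h1, mul_one]
  exact hfg ht

/-- The recessive solution at an end that is approached by a curve of ascent `σ`. -/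
theorem exists_recessive_end {μ l : ℕ} {B h X : ℂ → ℂ} {ρ : ℝ} (hρ : 0 < ρ)
    (hB : DifferentiableOn ℂ B (Metric.ball 0 ρ))
    (hB0 : B 0 ≠ 0) (hh : DifferentiableOn ℂ h (Metric.ball 0 ρ)) (hl : μ < 2 * l)
    (hX : ∀ s ∈ leftHalfPlane (Real.log ρ), HasDerivAt X (endRate μ B s) s) {σ : ℝ → ℂ} {a : ℝ} (ha : 0 < a)
    (hσc : ContinuousOn σ (Ioo 0 a)) (hσ : Tendsto (fun t => (σ t).re) (𝓝[>] 0) atBot)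
    (hpos : ∀ t ∈ Ioo 0 a, 0 ≤ (X (σ t)).re) (hanti : AntitoneOn (fun t => (X (σ t)).re) (Ioo 0 a)) :
    ∃ V, SolvesOn (relSystem (endRate μ B) (endPotential l h)) V (leftHalfPlane (Real.log ρ)) ∧
      ∀ ε > 0, ∃ R : ℝ, ∀ᶠ t in 𝓝[>] 0, ∀ γ : ℝ → ℂ, ContinuousOn γ (Icc 0 1) → γ 0 = σ t →
        (∀ τ ∈ Icc (0 : ℝ) 1, (γ τ).re < R ∧ 0 ≤ (X (γ τ)).re) → ‖V (γ 1) - (1, 0)‖ < ε := by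
  rcases eq_or_ne μ 0 with rfl | hμ
  · obtain ⟨V, hV, hVb⟩ := exists_recessive_log_end hρ hB hB0 hh (by omega : 1 ≤ l) hX hσ
      ((Ioo_mem_nhdsGT ha : _ ∈ 𝓝[>] (0 : ℝ)) |> fun h => Filter.mem_of_superset h hpos)
    refine ⟨V, hV, fun ε hε => ?_⟩
    obtain ⟨R, hR⟩ := hVb ε hε
    exact ⟨R, Eventually.of_forall fun t γ _ _ hγ => hR _ (hγ 1 ⟨zero_le_one, le_rfl⟩).1⟩
  · exact exists_recessive_hill hρ hB hB0 hh hμ hl hX ha hσc hσ hpos hanti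

namespace LiouvilleGreen.TurningPointProblem

variable {P : TurningPointProblem} {j : SignType} {z : ℂ}

/-- The power 3/2 takes the sector |arg| ≤ π/3 into the right half plane. -/
theorem expo_re_nonneg (hz : z ∈ P.T j) (h0 : z ≠ P.z₀) : 0 ≤ (P.expo j z).re := by
  have hr : P.rot j z ≠ 0 := slitPlane_ne_zero (P.T_subset_slit hz h0).2
  have h1 : P.rot j z ^ (3 / 2 : ℂ) = exp ((3 / 2 : ℝ) * log (P.rot j z)) := by
    rw [cpow_def_of_ne_zero hr, mul_comm]; push_cast; rfl
  have h2 : (P.expo j z).re = 2 / 3 * (P.rot j z ^ (3 / 2 : ℂ)).re := by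
    have : (2 / 3 : ℂ) = ((2 / 3 : ℝ) : ℂ) := by push_cast; rfl
    rw [expo, this, re_ofReal_mul]
  rw [h2, h1, exp_re, im_ofReal_mul, log_im]
  have h3 := abs_le.1 hz.2
  have h4 := Real.cos_nonneg_of_neg_pi_div_two_le_of_le (x := 3 / 2 * (P.rot j z).arg)
    (by linarith [h3.1]) (by linarith [h3.2])
  positivity

/-- At a point of the slit domain, (a, a') is an invertible linear function of (W, dW/dζ), whose
values may be prescribed. -/
theorem exists_isSolution_amp (hz : z ∈ P.slit j) (v : ℂ × ℂ) :
    ∃ W, P.IsSolution W ∧ (P.amp j W z, P.ampRate j W z) = v := by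
  have h1 := P.zetaInvQuarter_ne hz
  have h2 := P.zetaRate_ne hz
  set K := exp (P.expo j z) / P.zetaInvQuarter j z with hK
  have hK0 : K ≠ 0 := div_ne_zero (exp_ne_zero _) h1
  obtain ⟨W, hW, hw, hv⟩ := P.exists_isSolution hz.1 (v.1 / K)
    ((v.2 / K - v.1 / K - P.zetaRate j z * (v.1 / K) / (4 * P.ζ z)) / P.zetaRate j z)
  refine ⟨W, hW, Prod.ext ?_ ?_⟩
  · simp only [amp, ← hK, hw]; field_simp
  · simp only [ampRate, ← hK, hw, hv]; field_simp; ring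

namespace LocalForm

variable {pt : OnePoint ℂ} (L : LocalForm P pt)

/-- The logarithmic parameter `s`, where `coord z = e^s`. -/
def lift (s : ℂ) : ℂ := L.param (exp s)

/-- `dz/ds` -/
def liftRate (s : ℂ) : ℂ := (L.ε * exp s ^ (1 + L.κ))⁻¹ * exp s

theorem coord_lift (s : ℂ) : L.coord (L.lift s) = exp s := L.coord_param _ (exp_ne_zero s)

theorem lift_eq {s : ℂ} (h : exp s = L.coord z) : L.lift s = z := by
  rw [lift, h, L.param_coord z (h ▸ exp_ne_zero s)]

theorem hasDerivAt_lift (s : ℂ) : HasDerivAt L.lift (L.liftRate s) s :=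
  (L.hasDerivAt_param _ (exp_ne_zero s)).comp s (hasDerivAt_exp s)

theorem re_lt_of_norm_coord {s : ℂ} {R : ℝ} (h : exp s = L.coord z) (hR : ‖L.coord z‖ < Real.exp R) :
    s.re < R := by
  rwa [← h, norm_exp, Real.exp_lt_exp] at hR

variable (j) in
/-- The slit domain in the logarithmic parameter. -/
def liftDom : Set ℂ := {s ∈ leftHalfPlane (Real.log L.ρ) | L.lift s ∈ P.slit j}

theorem isOpen_liftDom : IsOpen (L.liftDom j) := by
  rw [isOpen_iff_mem_nhds]
  intro s hs
  filter_upwards [(isOpen_leftHalfPlane _).mem_nhds hs.1,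
    (L.hasDerivAt_lift s).continuousAt.eventually (P.eventually_mem_slit hs.2)] with y h1 h2
  exact ⟨h1, h2⟩

theorem mem_liftDom {s : ℂ} (h : exp s = L.coord z) (hz : z ∈ L.dom j L.ρ) : s ∈ L.liftDom j :=
  ⟨L.re_lt_of_norm_coord h (by rw [Real.exp_log L.ρ_pos]; exact hz.2.2), by
    rw [L.lift_eq h]; exact hz.1⟩

theorem lift_mem_dom {s : ℂ} (hs : s ∈ L.liftDom j) : L.lift s ∈ L.dom j L.ρ := by
  refine ⟨hs.2, ?_, ?_⟩
  · rw [L.coord_lift]; exact exp_ne_zero s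
  · rw [L.coord_lift]; simpa using exp_mem_ball L.ρ_pos hs.1

/-- In the variable s = log t the exponent κ, which distinguishes finite points from infinity, drops
out. -/
theorem dexpo_mul_liftRate_sq {s : ℂ} (hs : s ∈ L.liftDom j) :
    (P.dexpo j (L.lift s) * L.liftRate s) ^ 2 = P.u ^ 2 * (exp (-(L.μ / 2 * s)) ^ 2 * L.a (exp s)) := by
  obtain ⟨h1, h2, h3⟩ := L.lift_mem_dom hs
  have h0 := exp_ne_zero s
  have hε : L.ε ≠ 0 := fun h => by simpa [h] using L.ε_sq
  rw [mul_pow, P.dexpo_sq h1, L.f_eq _ h1.1 h2 h3, L.coord_lift, liftRate, ← exp_nat_mul]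
  have e1 : exp ((2 : ℕ) * (-(L.μ / 2 * s))) = (exp s ^ L.μ)⁻¹ := by
    rw [← exp_nat_mul, ← exp_neg]; congr 1; push_cast; ring
  rw [e1, zpow_sub₀ h0, zpow_natCast, zpow_add₀ h0, zpow_one, two_mul, zpow_add₀ h0]
  have := zpow_ne_zero L.κ h0
  field_simp
  rw [L.ε_sq, mul_one]

/-- The exponent in the logarithmic parameter. -/
theorem exists_expo_lift {s₀ : ℂ} (hs₀ : s₀ ∈ L.liftDom j) :
    ∃ B X : ℂ → ℂ, DifferentiableOn ℂ B (Metric.ball 0 L.ρ) ∧ B 0 ≠ 0 ∧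
      (∀ s ∈ leftHalfPlane (Real.log L.ρ), HasDerivAt X (endRate L.μ B s) s) ∧
      ∀ s ∈ connectedComponentIn (L.liftDom j) s₀, P.expo j (L.lift s) = X s ∧
        P.dexpo j (L.lift s) * L.liftRate s = endRate L.μ B s := by
  obtain ⟨b, hb, hba, hb0⟩ := exists_analytic_sqrt L.differentiableOn_a L.a_ne
  have hsub := connectedComponentIn_subset (L.liftDom j) s₀
  have hderiv : ∀ s ∈ L.liftDom j, HasDerivAt (fun s => P.expo j (L.lift s))
      (P.dexpo j (L.lift s) * L.liftRate s) s := fun s hs =>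
    (P.hasDerivAt_expo hs.2).comp s (L.hasDerivAt_lift s)
  have hrate : ∀ {c : ℂ}, DifferentiableOn ℂ (endRate L.μ fun t => c * b t) (leftHalfPlane (Real.log L.ρ)) :=
    differentiableOn_endRate L.ρ_pos (hb.const_mul _)
  obtain ⟨c, hc, hcU⟩ : ∃ c : ℂ, c ≠ 0 ∧ ∀ s ∈ connectedComponentIn (L.liftDom j) s₀,
      P.dexpo j (L.lift s) * L.liftRate s = endRate L.μ (fun t => c * b t) s := by
    have hc1 : ContinuousOn (fun s => P.dexpo j (L.lift s) * L.liftRate s)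
        (connectedComponentIn (L.liftDom j) s₀) := by
      refine ContinuousOn.mono (s := L.liftDom j) (fun s hs => ?_) hsub
      have h1 : ContinuousAt L.liftRate s := by
        have h0 : L.ε * exp s ^ (1 + L.κ) ≠ 0 :=
          mul_ne_zero (fun h => by simpa [h] using L.ε_sq) (zpow_ne_zero _ (exp_ne_zero s))
        exact ((continuousAt_const.mul (continuous_exp.continuousAt.zpow₀ _ (Or.inl (exp_ne_zero s)))).inv₀
          h0).mul continuous_exp.continuousAt
      exact (((P.analyticAt_dexpo hs.2).continuousAt.comp (L.hasDerivAt_lift s).continuousAt).mul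
        h1).continuousWithinAt
    -- Both sides are square roots of the same zero-free function, so on a connected set they agree
    -- up to one sign, which is put into the constant c.
    rcases isPreconnected_connectedComponentIn.eq_or_eq_neg_of_sq_eq hc1
      (hrate.continuousOn.mono fun s hs => (hsub hs).1) (fun s hs => by
        simp only [Pi.pow_apply]
        rw [L.dexpo_mul_liftRate_sq (hsub hs), endRate, mul_pow, mul_pow,
          hba _ (exp_mem_ball L.ρ_pos (hsub hs).1)]
        ring)
      (fun {s} hs => mul_ne_zero (exp_ne_zero _)
        (mul_ne_zero P.u_ne_zero (hb0 _ (exp_mem_ball L.ρ_pos (hsub hs).1)))) with h | h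
    · exact ⟨P.u, P.u_ne_zero, h⟩
    · refine ⟨-P.u, neg_ne_zero.2 P.u_ne_zero, fun s hs => (h hs).trans ?_⟩
      simp [endRate]
  -- X is defined on the entire half plane, across the lifted slit. It coincides with the exponent
  -- only on the component of `s₀`.
  obtain ⟨X, hX, hX₀⟩ := DifferentiableOn.exists_primitive (isOpen_leftHalfPlane _)
    (isSimplyConnected_leftHalfPlane _) (hrate (c := c)) hs₀.1 (P.expo j (L.lift s₀))
  refine ⟨fun t => c * b t, X, hb.const_mul _, mul_ne_zero hc (hb0 0 (Metric.mem_ball_self L.ρ_pos)), hX,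
    fun s hs => ⟨?_, hcU s hs⟩⟩
  have hd : ∀ y ∈ connectedComponentIn (L.liftDom j) s₀,
      HasDerivAt (fun s => P.expo j (L.lift s) - X s) 0 y := fun y hy =>
    ((hderiv y (hsub hy)).fun_sub (hX y (hsub hy).1)).congr_deriv (by rw [hcU y hy, sub_self])
  have := L.isOpen_liftDom.connectedComponentIn.is_const_of_deriv_eq_zero isPreconnected_connectedComponentIn
    (fun y hy => (hd y hy).differentiableAt.differentiableWithinAt) (fun y hy => (hd y hy).deriv)
    hs (mem_connectedComponentIn hs₀)
  simpa [hX₀, sub_eq_zero] using this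

theorem solvesOn_lift {W : ℂ → ℂ} (hW : P.IsSolution W) {B : ℂ → ℂ} {U : Set ℂ} (hU : U ⊆ L.liftDom j)
    (hB : ∀ s ∈ U, P.dexpo j (L.lift s) * L.liftRate s = endRate L.μ B s) :
    SolvesOn (relSystem (endRate L.μ B) (endPotential L.l fun t => L.h t / P.u ^ 2))
      (fun s => (P.amp j W (L.lift s), P.ampRate j W (L.lift s))) U := fun s hs => by
  obtain ⟨h1, h2, h3⟩ := L.lift_mem_dom (hU hs)
  have hΦ := L.Phi_eq _ h1.1 h2 h3
  rw [L.coord_lift] at hΦ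
  have d1 := (IsSolution.hasDerivAt_amp P hW h1).comp s (L.hasDerivAt_lift s)
  have d2 := (IsSolution.hasDerivAt_ampRate P hW h1).comp s (L.hasDerivAt_lift s)
  refine (d1.prodMk d2).congr_deriv ?_
  rw [relSystem_apply, ← hB s hs, hΦ, endPotential, exp_nat_mul]
  refine Prod.ext ?_ ?_ <;> simp only <;> ring

end LocalForm

/-- The solution that is asymptotic to the leading factor of `W_j` at the reference point. -/
theorem RefPoint.exists_solution (r : P.RefPoint j) : ∃ W, P.IsSolution W ∧
    ∀ c z, r.IsProgressivePath c z → Tendsto (P.amp j W ∘ c) (𝓝[>] 0) (𝓝 1) ∧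
      Tendsto (P.ampRate j W ∘ c) (𝓝[>] 0) (𝓝 0) := by
  by_cases hex : ∃ c z, r.IsProgressivePath c z
  swap
  · obtain ⟨W, hW, -⟩ := P.exists_isSolution P.z₀_mem 0 0
    exact ⟨W, hW, fun c z hc => absurd ⟨c, z, hc⟩ hex⟩
  obtain ⟨c₀, z₁, hc₀⟩ := hex
  obtain ⟨L⟩ := r.exists_localForm
  obtain ⟨a, ha, has⟩ := mem_nhdsGT_iff_exists_Ioo_subset.1
    ((hc₀.reaches.eventually_mem (L.mem_sphereNhds j L.ρ_pos)).and (Ioo_mem_nhdsGT (zero_lt_one' ℝ)))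
  have hT : ∀ t ∈ Ioo 0 a, c₀ t ∈ P.T j := fun t ht => (has ht).1.2
  have hdom : ∀ t ∈ Ioo 0 a, c₀ t ∈ L.dom j L.ρ := fun t ht => (has ht).1.1 (hT t ht)
  have hI : Ioo 0 a ⊆ Ioc 0 1 := fun t ht => Ioo_subset_Ioc_self (has ht).2
  have hcoord : ∀ {w}, w ∈ L.dom j L.ρ → ContinuousAt L.coord w := fun hw =>
    (L.hasDerivAt_coord _ hw.2.1).continuousAt
  have ht₀ : a / 2 ∈ Ioo 0 a := ⟨half_pos ha, half_lt_self ha⟩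
  -- One progressive path, lifted to s = log t, selects the component of the lifted domain and the
  -- hill.
  obtain ⟨σ, hσc, hσ, -⟩ := exists_log_lift (g := fun t => L.coord (c₀ t)) isOpen_Ioo (convex_Ioo 0 a)
    (fun t ht => ContinuousAt.comp_continuousWithinAt (hcoord (hdom t ht)) (hc₀.continuousOn.mono hI t ht))
    (fun t ht => (hdom t ht).2.1) ht₀ (exp_log (hdom _ ht₀).2.1)
  have hσU : ∀ t ∈ Ioo 0 a, σ t ∈ connectedComponentIn (L.liftDom j) (σ (a / 2)) := fun t ht =>
    (isPreconnected_Ioo.image σ hσc).subset_connectedComponentIn ⟨_, ht₀, rfl⟩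
      (by rintro _ ⟨t, ht, rfl⟩; exact L.mem_liftDom (hσ t ht) (hdom t ht)) ⟨t, ht, rfl⟩
  have hσlim : Tendsto (fun t => (σ t).re) (𝓝[>] 0) atBot := tendsto_atBot.2 fun R => by
    filter_upwards [hc₀.reaches.eventually_mem (L.mem_sphereNhds j (Real.exp_pos R)), Ioo_mem_nhdsGT ha]
      with t h1 h2
    exact (L.re_lt_of_norm_coord (hσ t h2) (h1.1 h1.2).2.2).le
  have hs₀ := L.mem_liftDom (hσ _ ht₀) (hdom _ ht₀)
  obtain ⟨B, X, hB, hB0, hX, hBX⟩ := L.exists_expo_lift hs₀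
  have hXσ : ∀ t ∈ Ioo 0 a, X (σ t) = P.expo j (c₀ t) := fun t ht => by
    rw [← (hBX _ (hσU t ht)).1, L.lift_eq (hσ t ht)]
  have hh : DifferentiableOn ℂ (fun t => L.h t / P.u ^ 2) (Metric.ball 0 L.ρ) :=
    L.differentiableOn_h.div_const _
  obtain ⟨V, hV, hVε⟩ := exists_recessive_end L.ρ_pos hB hB0 hh L.μ_lt hX ha hσc hσlim
    (fun t ht => by
      rw [hXσ t ht]; exact expo_re_nonneg (hT t ht) (P.slit_ne (hdom t ht).1))
    (fun t ht t' ht' htt => by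
      simp only [hXσ t ht, hXσ t' ht']
      exact antitone_expo hc₀ (hI ht) (hI ht') htt)
  -- W is matched to the local recessive solution V at one point; by uniqueness the two agree on the
  -- whole component.
  obtain ⟨W, hW, hWV⟩ := exists_isSolution_amp (L.lift_mem_dom hs₀).1 (V (σ (a / 2)))
  have hsub : connectedComponentIn (L.liftDom j) (σ (a / 2)) ⊆ L.liftDom j := connectedComponentIn_subset _ _
  have hsub' : connectedComponentIn (L.liftDom j) (σ (a / 2)) ⊆ leftHalfPlane (Real.log L.ρ) := fun s hs =>
    (hsub hs).1
  have heq := SolvesOn.eqOn L.isOpen_liftDom.connectedComponentIn isPreconnected_connectedComponentIn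
    ((differentiableOn_relSystem (differentiableOn_endRate (μ := L.μ) L.ρ_pos hB)
      (differentiableOn_endPotential (l := L.l) L.ρ_pos hh)).continuousOn.mono hsub')
    (L.solvesOn_lift hW hsub fun s hs => (hBX s hs).2) (hV.mono hsub') (mem_connectedComponentIn hs₀) hWV
  refine ⟨W, hW, fun c z hc => ?_⟩
  have hlim : Tendsto (fun t => (P.amp j W (c t), P.ampRate j W (c t))) (𝓝[>] 0) (𝓝 (1, 0)) := by
    rw [Metric.tendsto_nhds]
    intro ε hε
    obtain ⟨R, hR⟩ := hVε ε hε
    -- A second progressive path need not lift near σ by itself. It is joined to c₀ near the end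
    -- inside T_j, where Re X ≥ 0, and the joining curve is lifted starting from σ.
    have hjoin := hc₀.reaches.joined hc.reaches
      (L.mem_sphereNhds j (lt_min L.ρ_pos (Real.exp_pos R)))
    obtain ⟨t, ⟨htγ, htj⟩, ht⟩ := ((hR.and hjoin.curry).and (Ioo_mem_nhdsGT ha)).exists
    filter_upwards [htj] with t' hJ
    obtain ⟨p, hp⟩ := hJ
    have hpT : ∀ τ, p.extend τ ∈ P.T j := fun τ => (hp _).2
    have hpd : ∀ τ, p.extend τ ∈ L.dom j (min L.ρ (Real.exp R)) := fun τ => (hp _).1 (hp _).2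
    have hpρ : ∀ τ, p.extend τ ∈ L.dom j L.ρ := fun τ => L.dom_mono (min_le_left _ _) (hpd τ)
    obtain ⟨γ, hγc, hγ, hγ0⟩ := exists_log_lift (g := fun τ => L.coord (p.extend τ)) isOpen_univ convex_univ
      (fun τ _ => ((hcoord (hpρ τ)).comp p.continuous_extend.continuousAt).continuousWithinAt)
      (fun τ _ => (hpρ τ).2.1) (mem_univ 0) (s₀ := σ t) (by simpa using hσ t ht)
    have hγ' : ∀ τ, exp (γ τ) = L.coord (p.extend τ) := fun τ => hγ τ (mem_univ τ)
    have hγU : ∀ τ, γ τ ∈ connectedComponentIn (L.liftDom j) (σ (a / 2)) := fun τ => by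
      rw [connectedComponentIn_eq (hσU t ht)]
      exact (isPreconnected_univ.image γ hγc).subset_connectedComponentIn ⟨0, mem_univ _, hγ0⟩
        (by rintro _ ⟨τ, -, rfl⟩; exact L.mem_liftDom (hγ' τ) (hpρ τ)) ⟨τ, mem_univ _, rfl⟩
    have h1 := htγ γ (hγc.mono (subset_univ _)) hγ0 fun τ _ =>
      ⟨L.re_lt_of_norm_coord (hγ' τ) ((hpd τ).2.2.trans_le (min_le_right _ _)), by
        rw [← (hBX _ (hγU τ)).1, L.lift_eq (hγ' τ)]
        exact expo_re_nonneg (hpT τ) (P.slit_ne (hpρ τ).1)⟩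
    have h2 := heq (hγU 1)
    simp only [L.lift_eq (hγ' 1), Path.extend_one] at h2
    rwa [dist_eq_norm, h2]
  exact ⟨(continuous_fst.tendsto _).comp hlim, (continuous_snd.tendsto _).comp hlim⟩

end LiouvilleGreen.TurningPointProblem

end

/-! ### The theorem -/

theorem theorem2p1 (P : LiouvilleGreen.TurningPointProblem) (r : ∀ j : SignType, P.RefPoint j)
    (E : SignType → ℕ → ℂ → ℂ) (hE : ∀ j, P.IsEhat j (E j)) :
    ∃ (W : SignType → ℂ → ℂ) (e : SignType → ℕ → ℂ), ∀ j : SignType,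
      -- `W_j` is a solution, chosen before `n`
      P.IsSolution (W j) ∧
      -- `e j s` is the value `Ê_s(z^{(j)})`
      (∀ s, 1 ≤ s → ∀ c, (r j).Reaches c → Tendsto (E j s ∘ c) (𝓝[>] 0) (𝓝 (e j s))) ∧
      -- the integrals converge
      (∀ z c, (r j).IsProgressivePath c z → (r j).RegularAtStart c → ∀ n, 1 ≤ n →
        P.omega j n c < ∞ ∧ P.varpi j n c < ∞) ∧
      ∀ n : ℕ, 1 ≤ n → ∃ η : ℂ → ℂ,
        (∀ z ∈ (r j).region, W j z = P.lgApprox j (E j) (e j) n z * (1 + η z)) ∧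
        ∀ z c, (r j).IsProgressivePath c z → P.omega j n c < ∞ → P.varpi j n c < ∞ →
          ‖η z‖ ≤ (‖P.u‖ ^ n)⁻¹ * (P.omega j n c).toReal *
            Real.exp (‖P.u‖⁻¹ * (P.varpi j n c).toReal +
              (‖P.u‖ ^ n)⁻¹ * (P.omega j n c).toReal) := by
  -- The characterization a → 1, a' → 0 does not mention n, so one W serves all truncations; only η
  -- depends on n.
  choose W hW hlim using fun j => (r j).exists_solution
  choose e he using fun j => (r j).exists_tendsto_E (hE j)
  refine ⟨W, e, fun j => ⟨hW j, he j, fun z c hc hs n hn =>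
    LiouvilleGreen.TurningPointProblem.omega_varpi_lt_top hc hs hn, fun n hn =>
    ⟨P.relErr j (E j) (e j) n (W j), ?_, fun z c hc hω hϖ =>
      LiouvilleGreen.TurningPointProblem.relErr_bound (hE j) (hW j) hc (hlim j c z hc).1 (hlim j c z hc).2
        (fun s hs => he j s hs c hc.reaches)
        (fun s hs => LiouvilleGreen.TurningPointProblem.RefPoint.tendsto_F hc.reaches hs) hn hω hϖ⟩⟩⟩
  rintro z ⟨c, hc⟩
  exact P.lgApprox_mul_relErr (E j) (e j) n (W j) (hc.endpoint ▸ hc.mem 1 ⟨zero_lt_one, le_rfl⟩)
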